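/- **Definitions.** A finite non-empty poset $\mathcal P$ is *convex* if every non-empty subset has a supremum. A *convex flag* on $\mathcal P$ consists of finite-dimensional affine spaces $\mathbb A_x$ over $\mathbb Q$ and (non-empty) polytopes $P_x\subset\mathbb A_x$ $(x\in\mathcal P)$, and of affine maps $\psi_{x,y}:\mathbb A_y\to\mathbb A_x$ for $y\preceq x$ with $\psi_{x,y}(P_y)\subset P_x$, $\psi_{x,x}=\mathrm{id}$ and $\psi_{x,z}=\psi_{x,y}\psi_{y,z}$. A *lattice* $\Lambda$ on it is a family of non-empty discrete sets $\Lambda_x\subset\mathbb A_x$, closed under integral affine combinations, with $\psi_{x,y}\Lambda_y\subset\Lambda_x$. A *basis* $E$ of $\Lambda$ is a choice, for every $x$, of an origin $o\in\Lambda_x$ and of independent vectors $e_1,\dots,e_l$ with $\Lambda_x=\{o+\sum\lambda_ie_i:\lambda\in\mathbb Z^l\}$; for odd $p$ it defines the lifting $\gamma_x:\Lambda_x/p\Lambda_x\to\Lambda_x$ which takes the coefficients modulo $p$ to their representatives in $\{-\frac{p-1}2,\dots,\frac{p-1}2\}$. A *point* $\mathbf q$ of the flag with *base* $x$ is a point $\mathbf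 q_x\in P_x$ together with its images $\mathbf q_y=\psi_{y,x}\mathbf q_x$ for $y\succeq x$; it is *defined over* these $y$. The convex combination $\sum\alpha_i\mathbf q_i$ (with $\alpha_i>0$, $\sum\alpha_i=1$) has as base the supremum $y$ of the bases, and its value there is $\sum\alpha_i\mathbf q_{i,y}$. A *representation* $\varphi:V\to(\mathcal P,\Lambda)$ in a vector space $V$ over $\mathbb F_p$ consists of affine subspaces $V_x\subset V$ and surjective affine maps $\varphi_x:V_x\to\Lambda_x/p\Lambda_x$ such that $V_y\subset V_x$ and $\varphi_x=\psi_{x,y}\varphi_y$ on $V_y$ for $y\preceq x$. For a function $h:V\to\mathbb N=\{0,1,\dots\}$ and $S\subset V$ put $h(S)=\sum_{v\in S}h(v)$. The representation is a *flag decomposition* of $f:V\to\mathbb N$ if it comes with a basis $E$ of $\Lambda$ and functions $f_x:V_x\to\mathbb N$ (extended by $0$ to $V$) such that $F:=\sum_{x}f_x\le f$ and such that for every $x$ the polytope $P_x$ is the convex hull of $\{q\in\Lambda_x: f^*(q)\ne0\}$, where $f^*(q)=\sum_{y\preceq x}f_y\big((\gamma_x\varphi_x)^{-1}(q)\big)$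 for $q\in\Lambda_x$. Put $F_x=\sum_{y\preceq x}f_y$ and $f^*(S)=\sum_{q\in S}f^*(q)$ for $S\subset\Lambda_x$. The decomposition is * *$\varepsilon$-sharp* if $F(V)\ge(1-\varepsilon)f(V)$; * *$K$-bounded*, for $K:\mathcal P\to\mathbb N$ with $K(x)\ge K(y)$ whenever $x\preceq y$, if for all $x$ the coefficients of all points of $P_x\cap\Lambda_x$ in the basis $E_x$ have absolute value at most $K(x)$. *Proper points* are the convex combinations of points $\mathbf q$ with $f_x((\gamma_x\varphi_x)^{-1}(\mathbf q_x))>0$, $x$ being the base of $\mathbf q$. For a non-empty face $\Gamma$ of $P_x$ (possibly $\Gamma=P_x$) let $x_\Gamma$ be the minimum of all $z\preceq x$ such that every proper point $\mathbf q$ that is defined over $x$ and has $\mathbf q_x\in\Gamma$ is defined over $z$. The face $\Gamma$ is *good* if $\psi_{x,x_\Gamma}(P_{x_\Gamma})\subset\Gamma$; the element $x$ is *reduced* if $x_{P_x}=x$. A face $\Gamma$ of $P_x$ is *$\varepsilon$-large* if $f^*(\Gamma\cap\Lambda_x)\ge\varepsilon F(V)$ and $f^*(\Gamma'\cap\Lambda_x)\le(1-\varepsilon)f^*(\Gamma\cap\Lambda_x)$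 for every non-empty proper face $\Gamma'$ of $\Gamma$; an element $x$ is *$\varepsilon$-large* if $f^*(P_x\cap\Lambda_x)\ge\varepsilon F(V)$. A reduced element $x$ is *$(g,\delta)$-complete* (with respect to $K$) if for every affine function $\xi:V_x\to\mathbb F_p$ that is not constant on the fibers of $\varphi_x$, $F_x$ is $(g(K(x)),\delta)$-thick along $\xi$, that is, with $k=g(K(x))$, $$F_x\big(\{v\in V_x:\xi(v)\in[-k,k] \bmod p\}\big)<(1-\delta)F_x(V_x).$$ A $K$-bounded flag decomposition is *$(g,\varepsilon,\delta)$-complete* if all elements of $\mathcal P$ are reduced, all $\varepsilon$-large elements are $(g,\delta)$-complete, and all $\varepsilon$-large faces of all $P_x$ are good. The *gap* $G(x)$ is the minimum of the positive values of $f^*$ on $\Lambda_x$. **Theorem (Flag Decomposition Lemma).** Let $d\ge0$ be an integer and $\varepsilon>0$. There are $\delta>0$ and $M\in\mathbb N$, depending only on $d$ and $\varepsilon$, such that for every non-decreasing $g:\mathbb N\to\mathbb N$ there are $p_0,K_0\in\mathbb N$, depending only on $d,\varepsilon,g$, with the following property. Let $p>p_0$ be a prime, $V$ a $d$-dimensional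 vector space over $\mathbb F_p$, and $f:V\to\mathbb N$ a function that is not identically zero. Then $f$ has an $\varepsilon$-sharp flag decomposition $\varphi:V\to(\mathcal P,\Lambda)$, and there is a function $K:\mathcal P\to\mathbb N$, such that: 1. (Boundedness) the decomposition is $K$-bounded, $1\le K(x)\le K_0$ for all $x\in\mathcal P$, and $|\mathcal P|\le M$; 2. (Completeness) the decomposition is $(g,\varepsilon,\delta)$-complete; 3. (Large gap) $G(x)\ge\delta^3(2K(x))^{-d}f(V)$ for all $x\in\mathcal P$. -/

import Mathlib

open scoped Classical

noncomputable section

/-! ### Polytopes and faces in rational coordinate spaces -/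

/-- The `n`-dimensional affine space over `ℚ`. -/
abbrev QSpace (n : ℕ) : Type := Fin n → ℚ

/-- A polytope is the convex hull of a finite non-empty set of points. -/
def IsPolytope {n : ℕ} (Q : Set (QSpace n)) : Prop :=
  ∃ s : Finset (QSpace n), s.Nonempty ∧ Q = convexHull ℚ (s : Set (QSpace n))

/-- A (non-empty) face of a polytope: the set of maximisers of some linear functional. The polytope
itself is one of its faces. -/
def IsFace {n : ℕ} (Q Γ : Set (QSpace n)) : Prop :=
  Γ.Nonempty ∧ IsExposed ℚ Q Γ

/-! ### Reduction of an affine space over `ℤ` modulo `p` -/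

section TorsorMod

variable {G : Type*} [AddCommGroup G] (T : Type*) [AddTorsor G T] (p : ℕ)

/-- Two points are congruent modulo `p` if their difference is `p` times a translation. -/
def torsorModSetoid : Setoid T where
  r a b := a -ᵥ b ∈ LinearMap.range (LinearMap.lsmul ℤ G p)
  iseqv :=
    { refl := fun a => by rw [vsub_self]; exact Submodule.zero_mem _
      symm := fun {a b} h => by rw [← neg_vsub_eq_vsub_rev]; exact Submodule.neg_mem _ h
      trans := fun {a b c} h h' => by
        rw [← vsub_add_vsub_cancel a b c]; exact Submodule.add_mem _ h h' }

/-- The quotient `T / pT` of an affine space `T` over `ℤ`. -/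
def TorsorMod : Type _ := Quotient (torsorModSetoid T p)

variable {T}

/-- The class of a point modulo `p`. -/
def TorsorMod.mk (a : T) : TorsorMod T p := Quotient.mk (torsorModSetoid T p) a

variable {p}

theorem TorsorMod.mk_eq {a b : T} :
    TorsorMod.mk p a = TorsorMod.mk p b ↔ a -ᵥ b ∈ LinearMap.range (LinearMap.lsmul ℤ G p) :=
  Quotient.eq

/-- A representative of a class modulo `p`. -/
def TorsorMod.out (c : TorsorMod T p) : T := Quotient.out (s := torsorModSetoid T p) c

theorem TorsorMod.mk_out (c : TorsorMod T p) : TorsorMod.mk p c.out = c :=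
  Quotient.out_eq (s := torsorModSetoid T p) c

/-- `T / pT` is an affine space over the vector space `G / pG` over `ℤ / p`. -/
instance TorsorMod.instAddTorsor : AddTorsor (ModN G p) (TorsorMod T p) where
  vadd := Quotient.map₂ (fun (g : G) (a : T) => g +ᵥ a) (by
    intro g g' hg a a' ha
    change (g +ᵥ a) -ᵥ (g' +ᵥ a') ∈ LinearMap.range (LinearMap.lsmul ℤ G p)
    have h1 : g - g' ∈ LinearMap.range (LinearMap.lsmul ℤ G p) :=
      (Submodule.quotientRel_def _).1 hg
    have h2 : a -ᵥ a' ∈ LinearMap.range (LinearMap.lsmul ℤ G p) := ha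
    rw [vadd_vsub_vadd_comm]
    exact Submodule.add_mem _ h1 h2)
  zero_vadd := by
    rintro ⟨a⟩
    exact congrArg (TorsorMod.mk p) (zero_vadd G a)
  add_vadd := by
    rintro ⟨g⟩ ⟨g'⟩ ⟨a⟩
    exact congrArg (TorsorMod.mk p) (add_vadd g g' a)
  vsub := Quotient.lift₂ (fun a b : T => (Submodule.Quotient.mk (a -ᵥ b) : ModN G p)) (by
    intro a b a' b' ha hb
    have h1 : a -ᵥ a' ∈ LinearMap.range (LinearMap.lsmul ℤ G p) := ha
    have h2 : b -ᵥ b' ∈ LinearMap.range (LinearMap.lsmul ℤ G p) := hb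
    refine (Submodule.Quotient.eq _).2 ?_
    rw [← vsub_sub_vsub_comm]
    exact Submodule.sub_mem _ h1 h2)
  nonempty := ⟨TorsorMod.mk p (Classical.choice (AddTorsor.nonempty (G := G)))⟩
  vsub_vadd' := by
    rintro ⟨a⟩ ⟨b⟩
    exact congrArg (TorsorMod.mk p) (vsub_vadd a b)
  vadd_vsub' := by
    rintro ⟨g⟩ ⟨a⟩
    exact congrArg Submodule.Quotient.mk (vadd_vsub g a)

end TorsorMod

/-! ### Lattices -/

/-- A lattice in `ℚⁿ` (not necessarily of full rank, not necessarily through `0`): a non-empty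
discrete set closed under integral affine combinations. -/
structure AffineLattice (n : ℕ) where
  carrier : AffineSubspace ℤ (QSpace n)
  nonempty : (carrier : Set (QSpace n)).Nonempty
  discrete : IsDiscrete (carrier : Set (QSpace n))

namespace AffineLattice

variable {n : ℕ} (L : AffineLattice n)

/-- The set of points of the lattice. -/
abbrev points : Set (QSpace n) := (L.carrier : Set (QSpace n))

/-- The group of differences of points of the lattice. -/
abbrev Dir : Type := L.carrier.direction

instance instNonemptyCarrier : Nonempty L.carrier := L.nonempty.to_subtype

/-- The quotient `L / pL`. -/
abbrev Mod (p : ℕ) : Type := TorsorMod L.carrier p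

/-- An affine basis of a lattice: an origin `o` in the lattice and independent vectors
`e₁, …, e_l` such that the lattice consists of the points `o + ∑ λᵢ eᵢ` with `λᵢ ∈ ℤ`. -/
structure AffBasis where
  rank : ℕ
  origin : L.carrier
  vec : Module.Basis (Fin rank) ℤ L.Dir

variable {L}

/-- The coefficients of a lattice point in an affine basis. -/
def AffBasis.coord (E : L.AffBasis) (q : L.carrier) (i : Fin E.rank) : ℤ :=
  E.vec.repr (q -ᵥ E.origin) i

/-- The lifting `γ : L / pL → L` of an affine basis: replace each coefficient modulo `p` by its
residue of least absolute value (the one in `{-(p-1)/2, …, (p-1)/2}` when `p` is odd). The result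
does not depend on the representative of `c` whose coefficients are taken. -/
def AffBasis.lift (E : L.AffBasis) {p : ℕ} (c : L.Mod p) : L.carrier :=
  (∑ i, ((E.coord c.out i : ℤ) : ZMod p).valMinAbs • E.vec i) +ᵥ E.origin

end AffineLattice

/-! ### Convex flags -/

/-- A convex flag over a poset `P`. The poset is convex (non-empty, and each of its non-empty
subsets has a supremum), every element `x` carries a polytope in an affine space over `ℚ`, and for
`y ≤ x` there is an affine map from the space of `y` to that of `x`, sending polytope to polytope,
functorially. -/
structure ConvexFlag (P : Type) [PartialOrder P] where
  nonempty : Nonempty P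
  exists_sup : ∀ S : Set P, S.Nonempty → ∃ s, IsLUB S s
  dim : P → ℕ
  poly : ∀ x, Set (QSpace (dim x))
  isPolytope : ∀ x, IsPolytope (poly x)
  map : ∀ {y x : P}, y ≤ x → (QSpace (dim y) →ᵃ[ℚ] QSpace (dim x))
  map_poly : ∀ {y x : P} (h : y ≤ x), Set.MapsTo (map h) (poly y) (poly x)
  map_id : ∀ (x : P) (q : QSpace (dim x)), map (le_refl x) q = q
  map_comp : ∀ {z y x : P} (h : z ≤ y) (h' : y ≤ x) (q : QSpace (dim z)),
    map (h.trans h') q = map h' (map h q)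

variable {P : Type} [PartialOrder P]

namespace ConvexFlag

variable (F : ConvexFlag P)

/-- A point of a convex flag: a point of the polytope of `base`; its images in the spaces of all
`y ≥ base` are determined, and its domain is the set of those `y`. -/
structure Point where
  base : P
  pt : QSpace (F.dim base)
  mem : pt ∈ F.poly base

variable {F}

/-- The set of convex combinations of points from a set `S` of points of the flag. Points with
coefficient zero do not contribute to a convex combination, so that only positive coefficients are
needed. The domain of a convex combination is the intersection of the domains of the points, that
is, its base is the supremum of the bases. -/
def conv (S : Set F.Point) : Set F.Point :=
  {q | ∃ (n : ℕ) (r : Fin n → F.Point) (α : Fin n → ℚ),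
    (∀ i, r i ∈ S) ∧ (∀ i, 0 < α i) ∧ ∑ i, α i = 1 ∧
    IsLUB (Set.range fun i => (r i).base) q.base ∧
    ∃ h : ∀ i, (r i).base ≤ q.base, q.pt = ∑ i, α i • F.map (h i) (r i).pt}

/-- `z` is the element `x_Γ`, with respect to a set `Ω` of points: the minimum of all `z ≤ x` that
lie in the domain of every point of `Ω` that is defined over `x` and whose image there is
in `Γ`. -/
def IsFaceElement (Ω : Set F.Point) (x : P) (Γ : Set (QSpace (F.dim x))) (z : P) : Prop :=
  IsLeast {z | z ≤ x ∧ ∀ q ∈ Ω, ∀ h : q.base ≤ x, F.map h q.pt ∈ Γ → q.base ≤ z} z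

/-- The face `Γ` of the polytope of `x` is good: the polytope of `x_Γ` is mapped into `Γ`. -/
def IsGood (Ω : Set F.Point) (x : P) (Γ : Set (QSpace (F.dim x))) : Prop :=
  ∃ z, IsFaceElement Ω x Γ z ∧ ∃ h : z ≤ x, Set.MapsTo (F.map h) (F.poly z) Γ

/-- The element `x` is reduced: `x = x_Γ` for `Γ` the whole polytope of `x`. -/
def IsReduced (Ω : Set F.Point) (x : P) : Prop :=
  IsFaceElement Ω x (F.poly x) x

end ConvexFlag

/-- A lattice in a convex flag. -/
structure FlagLattice (F : ConvexFlag P) where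
  lat : ∀ x, AffineLattice (F.dim x)
  map_lat : ∀ {y x : P} (h : y ≤ x), Set.MapsTo (F.map h) (lat y).points (lat x).points

/-- A choice of an affine basis of every lattice of the flag. -/
abbrev FlagLattice.Bases {F : ConvexFlag P} (Λ : FlagLattice F) : Type :=
  ∀ x, (Λ.lat x).AffBasis

/-- The basis `E` is `K`-bounded, for a decreasing function `K`: the coefficients of all lattice
points of the polytope of `x` are at most `K x` in absolute value. -/
def FlagLattice.IsBounded {F : ConvexFlag P} (Λ : FlagLattice F) (E : Λ.Bases) (K : P → ℕ) : Prop :=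
  Antitone K ∧ ∀ x (q : (Λ.lat x).carrier), (q : QSpace (F.dim x)) ∈ F.poly x →
    ∀ i, |(E x).coord q i| ≤ (K x : ℤ)

/-! ### Representations and flag decompositions -/

/-- A representation of a convex flag with lattice in a vector space `V` over `ℤ / p`: affine
subspaces `V_x` and surjective affine maps `φ_x : V_x → Λ_x / pΛ_x`, compatible with the maps of
the flag. -/
structure FlagRep {F : ConvexFlag P} (Λ : FlagLattice F) (p : ℕ) (V : Type*) [AddCommGroup V]
    [Module (ZMod p) V] where
  sub : P → AffineSubspace (ZMod p) V
  [sub_nonempty : ∀ x, Nonempty (sub x)]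
  φ : ∀ x, sub x →ᵃ[ZMod p] (Λ.lat x).Mod p
  surj : ∀ x, Function.Surjective (φ x)
  sub_mono : ∀ {y x : P}, y ≤ x → sub y ≤ sub x
  compat : ∀ {y x : P} (h : y ≤ x) (v : sub y) (q : (Λ.lat y).carrier),
    φ y v = TorsorMod.mk p q →
      φ x ⟨v, sub_mono h v.2⟩ = TorsorMod.mk p ⟨F.map h q, Λ.map_lat h q.2⟩

/-- `f(S)`: the sum of the values of `f` over a set `S`. -/
def mass {V : Type*} [Fintype V] (f : V → ℕ) (S : Set V) : ℕ := ∑ v, S.indicator f v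

/-- The sum `∑_{y ≤ x} f_y`. -/
def sumBelow [Fintype P] {V : Type*} (part : P → V → ℕ) (x : P) (v : V) : ℕ :=
  ∑ y with y ≤ x, part y v

/-- The slab `{v ∈ W : ξ(v) ∈ [-K, K]}` of an affine function `ξ` on an affine subspace `W`. -/
def slab {p : ℕ} {V : Type*} [AddCommGroup V] [Module (ZMod p) V] (W : AffineSubspace (ZMod p) V)
    [Nonempty W] (ξ : W →ᵃ[ZMod p] ZMod p) (K : ℕ) : Set V :=
  {v | ∃ h : v ∈ W, ∃ k : ℤ, |k| ≤ (K : ℤ) ∧ ξ ⟨v, h⟩ = (k : ZMod p)}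

/-- The restriction of `f` to the affine subspace `W` is `(K, δ)`-thin along `ξ`. -/
def IsThin {p : ℕ} {V : Type*} [AddCommGroup V] [Module (ZMod p) V] [Fintype V]
    (W : AffineSubspace (ZMod p) V) [Nonempty W] (f : V → ℕ) (K : ℕ) (δ : ℝ)
    (ξ : W →ᵃ[ZMod p] ZMod p) : Prop :=
  (1 - δ) * (mass f (W : Set V) : ℝ) ≤ (mass f (slab W ξ K) : ℝ)

/-- `(K, δ)`-thick means not `(K, δ)`-thin. -/
def IsThick {p : ℕ} {V : Type*} [AddCommGroup V] [Module (ZMod p) V] [Fintype V]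
    (W : AffineSubspace (ZMod p) V) [Nonempty W] (f : V → ℕ) (K : ℕ) (δ : ℝ)
    (ξ : W →ᵃ[ZMod p] ZMod p) : Prop :=
  ¬ IsThin W f K δ ξ

section Decomposition

variable [Fintype P] {F : ConvexFlag P} {Λ : FlagLattice F} {p : ℕ} {V : Type*} [AddCommGroup V]
  [Module (ZMod p) V] [Fintype V]

/-- The preimage of the point `q` under `V_x → Λ_x / pΛ_x → Λ_x`, the second map being the lifting
of the basis (it is empty if `q` is not in `Λ_x`). -/
def FlagRep.fiber (φ : FlagRep Λ p V) (E : Λ.Bases) (x : P) (q : QSpace (F.dim x)) : Set V :=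
  have := φ.sub_nonempty
  {v | ∃ h : v ∈ φ.sub x, (((E x).lift (φ.φ x ⟨v, h⟩) : (Λ.lat x).carrier) : QSpace (F.dim x)) = q}

/-- `f*(q) = ∑_{y ≤ x} f_y(φ_x⁻¹ q)` for a point `q` over `x`. -/
def FlagRep.star (φ : FlagRep Λ p V) (E : Λ.Bases) (part : P → V → ℕ) (x : P)
    (q : QSpace (F.dim x)) : ℕ :=
  ∑ y with y ≤ x, mass (part y) (φ.fiber E x q)

/-- The data turning a representation into a flag decomposition of `f`: functions `f_x` (here
`part x`) on `V_x`, extended by zero to `V`, and a basis of the lattice. -/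
structure FlagDecomposition (φ : FlagRep Λ p V) (f : V → ℕ) where
  part : P → V → ℕ
  basis : Λ.Bases
  part_supp : ∀ x v, v ∉ φ.sub x → part x v = 0
  sum_le : ∀ v, ∑ x, part x v ≤ f v
  convexHull_eq : ∀ x, convexHull ℚ
    {q : QSpace (F.dim x) | q ∈ (Λ.lat x).points ∧ φ.star basis part x q ≠ 0} = F.poly x

namespace FlagDecomposition

variable {φ : FlagRep Λ p V} {f : V → ℕ} (D : FlagDecomposition φ f)

/-- `F(V)`, the total mass of the decomposition. -/
def total : ℕ := mass (fun v => ∑ x, D.part x v) Set.univ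

/-- `f*(q)` for a point `q` over `x`. -/
def star (x : P) (q : QSpace (F.dim x)) : ℕ := φ.star D.basis D.part x q

/-- `f*(S)` for a set `S` of points over `x`; only finitely many terms are non-zero. -/
def starSet (x : P) (S : Set (QSpace (F.dim x))) : ℕ := ∑ᶠ q ∈ S, D.star x q

/-- `ε`-sharpness: `F(V) ≥ (1 - ε) f(V)`. -/
def IsSharp (ε : ℝ) : Prop := (1 - ε) * (mass f Set.univ : ℝ) ≤ (D.total : ℝ)

/-- The proper points: the convex hull of the set of all points `q` of the flag that satisfy
`f_x(φ_x⁻¹ q_x) > 0` where `x` is the base of `q`. -/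
def proper : Set F.Point :=
  ConvexFlag.conv {q | 0 < mass (D.part q.base) (φ.fiber D.basis q.base q.pt)}

/-- `ε`-large faces of the polytope of `x`. -/
def IsLargeFace (ε : ℝ) (x : P) (Γ : Set (QSpace (F.dim x))) : Prop :=
  IsFace (F.poly x) Γ ∧
  ε * (D.total : ℝ) ≤ (D.starSet x (Γ ∩ (Λ.lat x).points) : ℝ) ∧
  ∀ Γ', IsFace Γ Γ' → Γ' ≠ Γ →
    (D.starSet x (Γ' ∩ (Λ.lat x).points) : ℝ)
      ≤ (1 - ε) * (D.starSet x (Γ ∩ (Λ.lat x).points) : ℝ)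

/-- `ε`-large elements. -/
def IsLargeElement (ε : ℝ) (x : P) : Prop :=
  ε * (D.total : ℝ) ≤ (D.starSet x (F.poly x ∩ (Λ.lat x).points) : ℝ)

/-- The element `x` is `(g, δ)`-complete: it is reduced, and `∑_{y ≤ x} f_y` is
`(g(K(x)), δ)`-thick along every affine function on `V_x` that is not constant on the fibers
of `φ_x`. -/
def IsCompleteElement (K : P → ℕ) (g : ℕ → ℕ) (δ : ℝ) (x : P) : Prop :=
  have := φ.sub_nonempty
  ConvexFlag.IsReduced D.proper x ∧
  ∀ ξ : φ.sub x →ᵃ[ZMod p] ZMod p, (∃ v w, φ.φ x v = φ.φ x w ∧ ξ v ≠ ξ w) →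
    IsThick (φ.sub x) (sumBelow D.part x) (g (K x)) δ ξ

/-- `K`-boundedness of the decomposition. -/
def IsBounded (K : P → ℕ) : Prop := Λ.IsBounded D.basis K

/-- A reduced `K`-bounded decomposition is `(g, ε, δ)`-complete if its `ε`-large elements are
`(g, δ)`-complete and its `ε`-large faces are good. -/
def IsComplete (K : P → ℕ) (g : ℕ → ℕ) (ε δ : ℝ) : Prop :=
  (∀ x, ConvexFlag.IsReduced D.proper x) ∧ D.IsBounded K ∧
  (∀ x, D.IsLargeElement ε x → D.IsCompleteElement K g δ x) ∧
  ∀ x Γ, D.IsLargeFace ε x Γ → ConvexFlag.IsGood D.proper x Γ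

/-- The gap of `x`: the least positive value of `f*` over `Λ_x`. -/
def gap (x : P) : ℕ :=
  sInf {m | 0 < m ∧ ∃ q ∈ (Λ.lat x).points, D.star x q = m}

end FlagDecomposition

end Decomposition

end

/-! The decomposition is read off from a finite system of marked subsets of the support of `f`.
Poset elements are the non-empty intersections `W J` of a working set `U` with marked sets, ordered
by inclusion. Affine functions to `ZMod p` are attached to intersections; those attached to index
sets contained in `J` are active at `J` and are small on `W J`. Lifting their values to residues of
least absolute value sends `W J` to integer vectors in a box. The hull of these vectors is the
polytope at `J`, their integral affine span is the lattice, and passing to a larger element forgets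
coordinates. Each `v ∈ U` gives its weight `f v` to the smallest intersection containing it, so that
`F_x` is `f` restricted to the set of `x`.

A suitable system is found by repeated correction, starting without marks and functions. First all
light fibers are deleted. If `f` on some `W J` is then thin along a function not determined by the
active ones, this function is attached to `J` and the points outside the slab are deleted. If a
large face at `J` is not cut out by an intersection of marks, the points over it are marked. When
neither applies, thickness, goodness of large faces and the gap all hold
(`exists_isCompleteSystem`).

The number of corrections is bounded in terms of `d` and `ε` only. A function attached to `J`
shrinks the space of directions along which the active functions are constant, so at most `d` are
attached to one `J`. Passing to a proper face lowers the dimension of the affine span in `V`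
(`spanDim_lt`), so chains of nested marks have length at most `d`. For the marks placed on one `J`,
consider the smallest marked subset around a random `(d + 1)`-tuple: its average dimension drops by
a fixed amount with each new mark, because a large face contains many tuples lying in none of its
proper faces (`pow_le_sum_generic`, `potential_addMark_le`). Together these give `Inv.size_le`.

The sizes of the functions grow by one application of `g` and `boxBound` per correction, hence stay
bounded independently of `p`. Only finitely many lattices are spanned by subsets of the resulting
box, so a large `p` divides none of their indices in their saturations. This makes reduction modulo
`p` well defined (`exists_reduction_map`) and yields the dimension drop for faces. -/

noncomputable section

/-! ### Lattices spanned by finite sets of integer vectors -/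

/-- Integer vectors as rational vectors. -/
def ratVec (N : ℕ) : (Fin N → ℤ) →ₗ[ℤ] QSpace N where
  toFun z k := (z k : ℚ)
  map_add' := by intros; ext; simp
  map_smul' := by intros; ext; simp

@[simp] theorem ratVec_apply {N : ℕ} (z : Fin N → ℤ) (k : Fin N) : ratVec N z k = (z k : ℚ) := rfl

theorem ratVec_injective (N : ℕ) : Function.Injective (ratVec N) := by
  intro a b h
  ext k
  have := congrFun h k
  simpa using this

/-- The integral affine span of a finite set of integer vectors. -/
def latticeSpan {N : ℕ} (S : Finset (Fin N → ℤ)) : AffineSubspace ℤ (QSpace N) :=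
  affineSpan ℤ (ratVec N '' (S : Set (Fin N → ℤ)))

theorem ratVec_mem_latticeSpan {N : ℕ} {S : Finset (Fin N → ℤ)} {z : Fin N → ℤ} (hz : z ∈ S) :
    ratVec N z ∈ latticeSpan S :=
  subset_affineSpan ℤ _ (Set.mem_image_of_mem _ hz)

theorem latticeSpan_mono {N : ℕ} {S T : Finset (Fin N → ℤ)} (h : S ⊆ T) :
    latticeSpan S ≤ latticeSpan T :=
  affineSpan_mono ℤ (Set.image_mono (by exact_mod_cast h))

theorem exists_int_of_mem_latticeSpan {N : ℕ} {S : Finset (Fin N → ℤ)} {q : QSpace N}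
    (hq : q ∈ latticeSpan S) : ∃ z : Fin N → ℤ, ratVec N z = q := by
  have : latticeSpan S ≤ (LinearMap.range (ratVec N)).toAffineSubspace := by
    refine affineSpan_le.2 ?_
    rintro _ ⟨z, -, rfl⟩
    exact ⟨z, rfl⟩
  exact this hq

theorem exists_int_of_mem_direction {N : ℕ} {S : Finset (Fin N → ℤ)} {q : QSpace N}
    (hq : q ∈ (latticeSpan S).direction) : ∃ z : Fin N → ℤ, ratVec N z = q := by
  have : (latticeSpan S).direction ≤ LinearMap.range (ratVec N) := by
    rw [latticeSpan, direction_affineSpan, vectorSpan_def, Submodule.span_le]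
    rintro _ ⟨_, ⟨a, -, rfl⟩, _, ⟨b, -, rfl⟩, rfl⟩
    exact ⟨a - b, by simp⟩
  exact this hq

theorem isDiscrete_of_subset_range_ratVec {N : ℕ} {s : Set (QSpace N)}
    (h : ∀ q ∈ s, ∃ z : Fin N → ℤ, ratVec N z = q) : IsDiscrete s := by
  refine ⟨DiscreteTopology.of_forall_le_dist (r := 1) one_pos ?_⟩
  rintro ⟨a, ha⟩ ⟨b, hb⟩ hab
  obtain ⟨z, rfl⟩ := h a ha
  obtain ⟨w, rfl⟩ := h b hb
  have hzw : z ≠ w := by rintro rfl; exact hab rfl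
  obtain ⟨k, hk⟩ := Function.ne_iff.1 hzw
  refine le_trans ?_ (dist_le_pi_dist (ratVec N z) (ratVec N w) k)
  rw [ratVec_apply, ratVec_apply, Int.dist_cast_rat]
  exact Int.pairwise_one_le_dist hk

/-- The lattice spanned by a non-empty finite set of integer vectors. -/
def spanLattice {N : ℕ} (S : Finset (Fin N → ℤ)) (hS : S.Nonempty) : AffineLattice N where
  carrier := latticeSpan S
  nonempty := ⟨_, ratVec_mem_latticeSpan hS.choose_spec⟩
  discrete := isDiscrete_of_subset_range_ratVec fun _ h => exists_int_of_mem_latticeSpan h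

instance latticeSpan_direction_finite {N : ℕ} (S : Finset (Fin N → ℤ)) :
    Module.Finite ℤ (latticeSpan S).direction := by
  rw [latticeSpan, direction_affineSpan, vectorSpan_def]
  exact Module.Finite.span_of_finite ℤ
    (((S.finite_toSet.image _).vsub (S.finite_toSet.image _)))

instance spanLattice_dir_finite {N : ℕ} (S : Finset (Fin N → ℤ)) (hS : S.Nonempty) :
    Module.Finite ℤ (spanLattice S hS).Dir := latticeSpan_direction_finite S

/-- A basis of the lattice spanned by a finite set. -/
def spanBasis {N : ℕ} (S : Finset (Fin N → ℤ)) (hS : S.Nonempty) : (spanLattice S hS).AffBasis where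
  rank := Module.finrank ℤ (spanLattice S hS).Dir
  origin := ⟨ratVec N hS.choose, ratVec_mem_latticeSpan hS.choose_spec⟩
  vec := Module.finBasis ℤ (spanLattice S hS).Dir

/-- The integer vectors with coefficients of absolute value at most `B`. -/
def intBox (N B : ℕ) : Finset (Fin N → ℤ) := Finset.Icc (fun _ => -(B : ℤ)) (fun _ => (B : ℤ))

theorem mem_intBox {N B : ℕ} {z : Fin N → ℤ} : z ∈ intBox N B ↔ ∀ k, |z k| ≤ (B : ℤ) := by
  simp only [intBox, Finset.mem_Icc, Pi.le_def, abs_le, forall_and]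

theorem intBox_mono {N B C : ℕ} (h : B ≤ C) : intBox N B ⊆ intBox N C := by
  intro z hz
  rw [mem_intBox] at hz ⊢
  exact fun k => (hz k).trans (by exact_mod_cast h)

theorem exists_subset_intBox {N : ℕ} (S : Finset (Fin N → ℤ)) : ∃ B, S ⊆ intBox N B := by
  refine ⟨S.sup fun z => Finset.univ.sup fun k => (z k).natAbs, fun z hz => mem_intBox.2 fun k => ?_⟩
  have h1 : (z k).natAbs ≤ Finset.univ.sup fun k => (z k).natAbs :=
    Finset.le_sup (f := fun k => (z k).natAbs) (Finset.mem_univ k)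
  have h2 := Finset.le_sup (f := fun z : Fin N → ℤ => Finset.univ.sup fun k => (z k).natAbs) hz
  rw [Int.abs_eq_natAbs]
  exact_mod_cast h1.trans h2

theorem abs_le_of_mem_convexHull {N B : ℕ} {S : Finset (Fin N → ℤ)} (hS : S ⊆ intBox N B)
    {q : QSpace N} (hq : q ∈ convexHull ℚ (ratVec N '' (S : Set (Fin N → ℤ)))) (k : Fin N) :
    |q k| ≤ (B : ℚ) := by
  have hc : Convex ℚ {q : QSpace N | |q k| ≤ (B : ℚ)} := by
    have : {q : QSpace N | |q k| ≤ (B : ℚ)} = (LinearMap.proj (R := ℚ) k : QSpace N →ₗ[ℚ] ℚ) ⁻¹'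
        Set.Icc (-(B : ℚ)) B := by
      ext q; simp [abs_le]
    rw [this]
    exact (convex_Icc _ _).linear_preimage _
  refine convexHull_min ?_ hc hq
  rintro _ ⟨z, hz, rfl⟩
  have := mem_intBox.1 (hS hz) k
  simp only [Set.mem_ofPred_eq, ratVec_apply]
  exact_mod_cast this

/-- The hull lies in a box and so contains only finitely many integer points. The bound depends on
`S` alone and not on `p`. -/
theorem exists_coord_bound {N : ℕ} (S : Finset (Fin N → ℤ)) (hS : S.Nonempty) :
    ∃ K : ℕ, ∀ q : (spanLattice S hS).carrier,
      (q : QSpace N) ∈ convexHull ℚ (ratVec N '' (S : Set (Fin N → ℤ))) →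
      ∀ i, |(spanBasis S hS).coord q i| ≤ (K : ℤ) := by
  obtain ⟨B, hB⟩ := exists_subset_intBox S
  let T : Set (spanLattice S hS).carrier :=
    {q | (q : QSpace N) ∈ convexHull ℚ (ratVec N '' (S : Set (Fin N → ℤ)))}
  have hT : T.Finite := by
    refine Set.Finite.of_finite_image (f := Subtype.val) ?_ Subtype.val_injective.injOn
    refine ((intBox N B).finite_toSet.image (ratVec N)).subset ?_
    rintro _ ⟨q, hq, rfl⟩
    obtain ⟨z, hz⟩ := exists_int_of_mem_latticeSpan q.2
    refine ⟨z, mem_intBox.2 fun k => ?_, hz⟩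
    have := abs_le_of_mem_convexHull hB hq k
    rw [← hz, ratVec_apply] at this
    exact_mod_cast this
  refine ⟨hT.toFinset.sup fun q => Finset.univ.sup fun i => ((spanBasis S hS).coord q i).natAbs,
    fun q hq i => ?_⟩
  have h1 : ((spanBasis S hS).coord q i).natAbs ≤
      Finset.univ.sup fun i => ((spanBasis S hS).coord q i).natAbs :=
    Finset.le_sup (f := fun i => ((spanBasis S hS).coord q i).natAbs) (Finset.mem_univ i)
  have h2 := Finset.le_sup (f := fun q => Finset.univ.sup fun i =>
    ((spanBasis S hS).coord q i).natAbs) (hT.mem_toFinset.2 hq)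
  rw [Int.abs_eq_natAbs]
  exact_mod_cast h1.trans h2

/-- A bound for the coordinates, in the basis `spanBasis S`, of the lattice points of the convex
hull of `S`. -/
def coordBound {N : ℕ} (S : Finset (Fin N → ℤ)) : ℕ :=
  if hS : S.Nonempty then (exists_coord_bound S hS).choose else 0

/-- A bound for `coordBound S` that is uniform over the subsets `S` of a box. -/
def boxBound (N B : ℕ) : ℕ := 1 + (intBox N B).powerset.sup coordBound

theorem one_le_boxBound (N B : ℕ) : 1 ≤ boxBound N B := Nat.le_add_right _ _

theorem boxBound_mono (N : ℕ) : Monotone (boxBound N) := fun _ _ h =>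
  Nat.add_le_add_left (Finset.sup_mono (Finset.powerset_mono.2 (intBox_mono h))) _

theorem abs_coord_le_boxBound {N B : ℕ} {S : Finset (Fin N → ℤ)} (hS : S.Nonempty)
    (hB : S ⊆ intBox N B) (q : (spanLattice S hS).carrier)
    (hq : (q : QSpace N) ∈ convexHull ℚ (ratVec N '' (S : Set (Fin N → ℤ)))) (i) :
    |(spanBasis S hS).coord q i| ≤ (boxBound N B : ℤ) := by
  have h1 := (exists_coord_bound S hS).choose_spec q hq i
  have h2 : coordBound S ≤ boxBound N B :=
    (Finset.le_sup (f := coordBound) (Finset.mem_powerset.2 hB)).trans (Nat.le_add_left _ _)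
  rw [coordBound, dif_pos hS] at h2
  exact h1.trans (by exact_mod_cast h2)

/-! ### Primes that do not divide the index of a span in its saturation -/

/-- The integer `p` does not divide the index of the lattice spanned by `S` in its saturation. -/
def IsCoprimeTo {N : ℕ} (p : ℕ) (S : Finset (Fin N → ℤ)) : Prop :=
  ∀ z : Fin N → ℤ, ratVec N ((p : ℤ) • z) ∈ (latticeSpan S).direction →
    ratVec N z ∈ (latticeSpan S).direction

/-- The torsion submodule of a finitely generated module over `ℤ` is finitely generated, so a single
non-zero integer annihilates it. -/
theorem exists_torsion_exponent {M : Type*} [AddCommGroup M] [Module.Finite ℤ M] :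
    ∃ e : ℤ, e ≠ 0 ∧ ∀ (a : ℤ) (x : M), a ≠ 0 → a • x = 0 → e • x = 0 := by
  obtain ⟨e, he, he'⟩ := Submodule.annihilator_top_inter_nonZeroDivisors
    (R := ℤ) (M := Submodule.torsion ℤ M) (Submodule.torsion_isTorsion)
  refine ⟨e, nonZeroDivisors.ne_zero he', fun a x ha hx => ?_⟩
  have hx' : x ∈ Submodule.torsion ℤ M :=
    (Submodule.mem_torsion_iff _).2 ⟨⟨a, mem_nonZeroDivisors_of_ne_zero ha⟩, hx⟩
  have := Submodule.mem_annihilator.1 he ⟨x, hx'⟩ Submodule.mem_top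
  simpa using congrArg Subtype.val this

/-- The torsion of `ℤ ^ N` modulo the direction of the lattice is killed by some `e ≠ 0`. A prime
exceeding `|e|` is coprime to `e`, and Bézout recovers `z` from `p z` and `e z`. -/
theorem exists_isCoprimeTo {N : ℕ} (S : Finset (Fin N → ℤ)) :
    ∃ p₀ : ℕ, ∀ p : ℕ, p.Prime → p₀ < p → IsCoprimeTo p S := by
  let D : Submodule ℤ (Fin N → ℤ) := (latticeSpan S).direction.comap (ratVec N)
  obtain ⟨e, he, h⟩ := exists_torsion_exponent (M := (Fin N → ℤ) ⧸ D)
  refine ⟨e.natAbs, fun p hp hlt z hz => ?_⟩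
  have hpz : ((p : ℤ) • z) ∈ D := hz
  have h1 : e • z ∈ D := by
    have := h p (D.mkQ z) (by exact_mod_cast hp.ne_zero)
      (by rw [← map_smul]; exact (Submodule.Quotient.mk_eq_zero D).2 hpz)
    rw [← map_smul] at this
    exact (Submodule.Quotient.mk_eq_zero D).1 this
  have hcop : IsCoprime (p : ℤ) e := by
    rw [Int.isCoprime_iff_gcd_eq_one, Int.gcd_comm]
    have : Nat.Coprime p e.natAbs := by
      refine (Nat.Prime.coprime_iff_not_dvd hp).2 fun hd => ?_
      exact absurd (Nat.le_of_dvd (Int.natAbs_pos.2 he) hd) (not_le.2 hlt)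
    simpa [Int.gcd, Nat.gcd_comm] using this
  obtain ⟨u, v, huv⟩ := hcop
  have : z = u • ((p : ℤ) • z) + v • (e • z) := by
    rw [smul_smul, smul_smul, ← add_smul, huv, one_smul]
  change z ∈ D
  rw [this]
  exact D.add_mem (D.smul_mem _ hpz) (D.smul_mem _ h1)

/-- A bound beyond which all primes are coprime to all subsets of a box. -/
def primeBound (N B : ℕ) : ℕ :=
  (intBox N B).powerset.sup fun S => (exists_isCoprimeTo S).choose

theorem isCoprimeTo_of_primeBound_lt {N B p : ℕ} (hp : p.Prime) (h : primeBound N B < p)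
    {S : Finset (Fin N → ℤ)} (hS : S ⊆ intBox N B) : IsCoprimeTo p S :=
  (exists_isCoprimeTo S).choose_spec p hp (lt_of_le_of_lt
    (Finset.le_sup (f := fun S => (exists_isCoprimeTo S).choose) (Finset.mem_powerset.2 hS)) h)

/-! ### Lifting affine functions modulo `p` to the integers -/

section ModP

variable {p : ℕ} {V : Type*} [AddCommGroup V] [Module (ZMod p) V] {N : ℕ}

/-- The integer vector of residues of least absolute value of a family of affine functions. -/
def liftVec (η : Fin N → V →ᵃ[ZMod p] ZMod p) (v : V) : Fin N → ℤ := fun k => (η k v).valMinAbs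

/-- The set of integer vectors obtained by lifting from a finite set. -/
def liftImage (η : Fin N → V →ᵃ[ZMod p] ZMod p) (W : Finset V) : Finset (Fin N → ℤ) :=
  W.image (liftVec η)

theorem liftVec_mem_liftImage (η : Fin N → V →ᵃ[ZMod p] ZMod p) {W : Finset V} {v : V}
    (hv : v ∈ W) : liftVec η v ∈ liftImage η W := Finset.mem_image_of_mem _ hv

theorem liftImage_nonempty (η : Fin N → V →ᵃ[ZMod p] ZMod p) {W : Finset V} (hW : W.Nonempty) :
    (liftImage η W).Nonempty := hW.image _

/-- The rational vector `q` is integral and reduces to the values of `η` at `v`. -/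
def Reduces (η : Fin N → V →ᵃ[ZMod p] ZMod p) (v : V) (q : QSpace N) : Prop :=
  ∃ z : Fin N → ℤ, ratVec N z = q ∧ ∀ k, (z k : ZMod p) = η k v

theorem reduces_liftVec (η : Fin N → V →ᵃ[ZMod p] ZMod p) (v : V) :
    Reduces η v (ratVec N (liftVec η v)) :=
  ⟨_, rfl, fun _ => ZMod.coe_valMinAbs _⟩

theorem affineMap_smul_vsub_vadd (ξ : V →ᵃ[ZMod p] ZMod p) (c : ZMod p) (u v w : V) :
    ξ (c • (u -ᵥ v) +ᵥ w) = c * (ξ u - ξ v) + ξ w := by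
  rw [ξ.map_vadd, map_smul, ξ.linearMap_vsub]
  simp

theorem Reduces.smul_vsub_vadd {η : Fin N → V →ᵃ[ZMod p] ZMod p} {u v w : V} {a b c : QSpace N}
    (hu : Reduces η u a) (hv : Reduces η v b) (hw : Reduces η w c) (m : ℤ) :
    Reduces η ((m : ZMod p) • (u -ᵥ v) +ᵥ w) (m • (a -ᵥ b) +ᵥ c) := by
  obtain ⟨a, rfl, ha⟩ := hu
  obtain ⟨b, rfl, hb⟩ := hv
  obtain ⟨c, rfl, hc⟩ := hw
  refine ⟨m • (a - b) + c, by rw [map_add, map_smul, map_sub]; rfl, fun k => ?_⟩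
  rw [affineMap_smul_vsub_vadd, ← ha, ← hb, ← hc]
  simp

/-- Replacing each scalar of an affine combination over `ZMod p` by an integer representative gives
an integral affine combination of the lifted points. -/
theorem exists_reduces_of_mem_affineSpan {η : Fin N → V →ᵃ[ZMod p] ZMod p} {W : Finset V} {v : V}
    (hv : v ∈ affineSpan (ZMod p) (W : Set V)) :
    ∃ q ∈ latticeSpan (liftImage η W), Reduces η v q := by
  refine affineSpan_induction hv (fun v hv => ?_) (fun c u v w hu hv hw => ?_)
  · exact ⟨_, ratVec_mem_latticeSpan (liftVec_mem_liftImage η hv), reduces_liftVec η v⟩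
  · obtain ⟨a, ha, hua⟩ := hu
    obtain ⟨b, hb, hvb⟩ := hv
    obtain ⟨e, he, hwe⟩ := hw
    refine ⟨c.valMinAbs • (a -ᵥ b) +ᵥ e, AffineSubspace.smul_vsub_vadd_mem _ _ ha hb he, ?_⟩
    have := hua.smul_vsub_vadd hvb hwe c.valMinAbs
    rwa [ZMod.coe_valMinAbs] at this

theorem exists_mem_affineSpan_reduces {η : Fin N → V →ᵃ[ZMod p] ZMod p} {W : Finset V}
    {q : QSpace N} (hq : q ∈ latticeSpan (liftImage η W)) :
    ∃ v ∈ affineSpan (ZMod p) (W : Set V), Reduces η v q := by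
  refine affineSpan_induction hq ?_ (fun c u v w hu hv hw => ?_)
  · rintro _ ⟨z, hz, rfl⟩
    obtain ⟨v, hv, rfl⟩ := Finset.mem_image.1 (Finset.mem_coe.1 hz)
    exact ⟨v, subset_affineSpan _ _ hv, reduces_liftVec η v⟩
  · obtain ⟨a, ha, hua⟩ := hu
    obtain ⟨b, hb, hvb⟩ := hv
    obtain ⟨e, he, hwe⟩ := hw
    exact ⟨_, AffineSubspace.smul_vsub_vadd_mem _ (c : ZMod p) ha hb he,
      hua.smul_vsub_vadd hvb hwe c⟩

/-- Two lifts of the same values differ by `p m` with `m` integral. Coprimality puts `m` itself into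
the direction of the lattice, which is what congruence inside the lattice requires. -/
theorem mk_eq_of_reduces {η : Fin N → V →ᵃ[ZMod p] ZMod p} {S : Finset (Fin N → ℤ)}
    {hS : S.Nonempty} (hcop : IsCoprimeTo p S) {v : V} {q r : (spanLattice S hS).carrier}
    (hq : Reduces η v q) (hr : Reduces η v r) : TorsorMod.mk p q = TorsorMod.mk p r := by
  obtain ⟨z, hz, hzv⟩ := hq
  obtain ⟨w, hw, hwv⟩ := hr
  have : ∀ k, ∃ m : ℤ, z k - w k = p * m := fun k => by
    have h : ((z k - w k : ℤ) : ZMod p) = 0 := by push_cast; rw [hzv, hwv, sub_self]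
    exact (ZMod.intCast_zmod_eq_zero_iff_dvd _ _).1 h
  choose m hm using this
  have hpm : (p : ℤ) • m = z - w := by ext k; simp [hm k]
  have hdir : ratVec N ((p : ℤ) • m) ∈ (latticeSpan S).direction := by
    rw [hpm, map_sub, hz, hw]
    exact AffineSubspace.vsub_mem_direction q.2 r.2
  rw [TorsorMod.mk_eq]
  refine ⟨⟨ratVec N m, hcop m hdir⟩, Subtype.ext ?_⟩
  have h2 : (p : ℤ) • ratVec N m = (q : QSpace N) - r := by rw [← map_smul, hpm, map_sub, hz, hw]
  exact h2

theorem Reduces.add_smul {η : Fin N → V →ᵃ[ZMod p] ZMod p} {S : Finset (Fin N → ℤ)} {v : V}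
    {q g : QSpace N} (hq : Reduces η v q) (hg : g ∈ (latticeSpan S).direction) :
    Reduces η v ((p : ℤ) • g + q) := by
  obtain ⟨z, rfl, hz⟩ := hq
  obtain ⟨w, rfl⟩ := exists_int_of_mem_direction hg
  exact ⟨(p : ℤ) • w + z, by rw [map_add, map_smul], fun k => by simp [hz]⟩

/-- Additive maps between modules over `ZMod p` are linear, so no condition on scalars is needed. -/
theorem exists_affineMap_of_parallelogram {G H S T : Type*} [AddCommGroup G] [Module (ZMod p) G]
    [AddTorsor G S] [AddCommGroup H] [Module (ZMod p) H] [AddTorsor H T] (φ : S → T)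
    (h : ∀ a b c, φ ((a -ᵥ b) +ᵥ c) = (φ a -ᵥ φ b) +ᵥ φ c) :
    ∃ ψ : S →ᵃ[ZMod p] T, ⇑ψ = φ := by
  obtain ⟨o⟩ : Nonempty S := AddTorsor.nonempty (G := G)
  have h0 : ∀ (g : G) (c : S), φ (g +ᵥ c) = (φ (g +ᵥ o) -ᵥ φ o) +ᵥ φ c := fun g c => by
    rw [← h, vadd_vsub]
  let L : G →+ H :=
    { toFun := fun g => φ (g +ᵥ o) -ᵥ φ o
      map_zero' := by simp
      map_add' := fun a b => by
        rw [add_vadd, h0 a (b +ᵥ o), vadd_vsub_assoc] }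
  exact ⟨⟨φ, L.toZModLinearMap p, fun c g => h0 g c⟩, rfl⟩

/-- This becomes the map `φ_x` of the representation. The equivalence with `Reduces` later makes
compatibility a matter of forgetting coordinates. -/
theorem exists_reduction_map {η : Fin N → V →ᵃ[ZMod p] ZMod p} {W : Finset V} (hW : W.Nonempty)
    (hcop : IsCoprimeTo p (liftImage η W)) [Nonempty (affineSpan (ZMod p) (W : Set V))] :
    ∃ φ : affineSpan (ZMod p) (W : Set V) →ᵃ[ZMod p]
        (spanLattice (liftImage η W) (liftImage_nonempty η hW)).Mod p,
      Function.Surjective φ ∧ ∀ v q, φ v = TorsorMod.mk p q ↔ Reduces η (v : V) q := by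
  have hex : ∀ v : affineSpan (ZMod p) (W : Set V),
      ∃ q : (spanLattice (liftImage η W) (liftImage_nonempty η hW)).carrier,
        Reduces η (v : V) q := fun v => by
    obtain ⟨q, hq, hr⟩ := exists_reduces_of_mem_affineSpan v.2
    exact ⟨⟨q, hq⟩, hr⟩
  choose r hr using hex
  obtain ⟨φ, hφ⟩ := exists_affineMap_of_parallelogram (p := p) (fun v => TorsorMod.mk p (r v))
    (fun a b c => by
      have h1 : Reduces η (((a -ᵥ b) +ᵥ c : affineSpan (ZMod p) (W : Set V)) : V)
          ((r a -ᵥ r b) +ᵥ r c :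
            (spanLattice (liftImage η W) (liftImage_nonempty η hW)).carrier) := by
        have := (hr a).smul_vsub_vadd (hr b) (hr c) 1
        rw [Int.cast_one, one_smul, one_smul] at this
        exact this
      exact (mk_eq_of_reduces hcop (hr _) h1))
  refine ⟨φ, fun c => ?_, fun v q => ?_⟩
  · obtain ⟨v, hv, hvc⟩ := exists_mem_affineSpan_reduces c.out.2
    refine ⟨⟨v, hv⟩, ?_⟩
    rw [hφ, ← TorsorMod.mk_out c]
    exact mk_eq_of_reduces hcop (hr _) hvc
  · rw [hφ]
    refine ⟨fun h => ?_, fun h => mk_eq_of_reduces hcop (hr v) h⟩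
    obtain ⟨g, hg⟩ := TorsorMod.mk_eq.1 h.symm
    have h3 : (q : QSpace N) = (p : ℤ) • (g : QSpace N) + r v := by
      have : (p : ℤ) • (g : QSpace N) = (q : QSpace N) - r v := congrArg Subtype.val hg
      rw [this, sub_add_cancel]
    rw [h3]
    exact (hr v).add_smul g.2

/-- Coefficients below `p / 2` in absolute value are their own least residues. -/
theorem lift_mk_eq_self {L : AffineLattice N} (E : L.AffBasis) (q : L.carrier)
    (h : ∀ i, 2 * |E.coord q i| < p) : E.lift (TorsorMod.mk p q) = q := by
  have hc : ∀ i, ((E.coord (TorsorMod.mk p q).out i : ℤ) : ZMod p).valMinAbs = E.coord q i := by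
    intro i
    have hp : NeZero p := ⟨by rintro rfl; have := h i; have := abs_nonneg (E.coord q i); omega⟩
    obtain ⟨g, hg⟩ := TorsorMod.mk_eq.1 (TorsorMod.mk_out (TorsorMod.mk p q))
    have h1 : E.coord (TorsorMod.mk p q).out i = p * E.vec.repr g i + E.coord q i := by
      have h2 : (TorsorMod.mk p q).out -ᵥ E.origin = (p : ℤ) • g + (q -ᵥ E.origin) := by
        rw [← vsub_add_vsub_cancel _ q E.origin]
        exact congrArg (· + _) hg.symm
      simp only [AffineLattice.AffBasis.coord]
      rw [h2]
      simp
    rw [ZMod.valMinAbs_spec]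
    refine ⟨by rw [h1]; simp, ?_⟩
    have := abs_lt.1 (show |E.coord q i * 2| < p by rw [abs_mul]; simpa [mul_comm] using h i)
    exact ⟨this.1, this.2.le⟩
  unfold AffineLattice.AffBasis.lift
  simp only [hc]
  have : ∑ i, E.coord q i • E.vec i = q -ᵥ E.origin := E.vec.sum_repr _
  rw [this, vsub_vadd]

/-! ### Rank and number of lifted points -/

theorem rank_le_finrank [Fact p.Prime] [Finite V] {η : Fin N → V →ᵃ[ZMod p] ZMod p}
    {W : Finset V} (hW : W.Nonempty) (hcop : IsCoprimeTo p (liftImage η W)) :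
    (spanBasis (liftImage η W) (liftImage_nonempty η hW)).rank ≤ Module.finrank (ZMod p) V := by
  have : Nonempty (affineSpan (ZMod p) (W : Set V)) := by
    obtain ⟨w, hw⟩ := hW
    exact ⟨⟨w, subset_affineSpan _ _ hw⟩⟩
  obtain ⟨φ, hφ, -⟩ := exists_reduction_map hW hcop
  have h1 := Nat.card_le_card_of_surjective φ hφ
  have h2 : Nat.card (affineSpan (ZMod p) (W : Set V)) ≤ Nat.card V :=
    Nat.card_le_card_of_injective _ Subtype.val_injective
  have h3 : Nat.card V = p ^ Module.finrank (ZMod p) V := by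
    have := Module.natCard_eq_pow_finrank (K := ZMod p) (V := V)
    simpa using this
  have h4 : Nat.card ((spanLattice (liftImage η W) (liftImage_nonempty η hW)).Mod p) =
      p ^ (spanBasis (liftImage η W) (liftImage_nonempty η hW)).rank := by
    rw [Nat.card_congr (Equiv.vaddConst (TorsorMod.mk p
      (spanBasis (liftImage η W) (liftImage_nonempty η hW)).origin)).symm]
    exact ModN.natCard_eq _ _
  rw [h4] at h1
  exact (Nat.pow_le_pow_iff_right (Fact.out : p.Prime).one_lt).1 (h1.trans (h2.trans h3.le))

/-- Counting in the lattice basis, whose rank is at most the dimension of `V`, replaces the exponent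
`N` of the ambient box by the exponent that occurs in the gap. -/
theorem card_liftImage_le [Fact p.Prime] [Finite V] {η : Fin N → V →ᵃ[ZMod p] ZMod p}
    {W : Finset V} (hW : W.Nonempty) (hcop : IsCoprimeTo p (liftImage η W)) {B : ℕ}
    (hB : liftImage η W ⊆ intBox N B) :
    (liftImage η W).card ≤ (2 * boxBound N B + 1) ^ Module.finrank (ZMod p) V := by
  set S := liftImage η W
  set hS := liftImage_nonempty η hW
  set E := spanBasis S hS
  set K := boxBound N B
  let F : (Fin N → ℤ) → (Fin E.rank → ℤ) := fun z =>
    if hz : ratVec N z ∈ latticeSpan S then E.coord ⟨ratVec N z, hz⟩ else 0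
  have hF : ∀ z (hz : z ∈ S), F z = E.coord ⟨ratVec N z, ratVec_mem_latticeSpan hz⟩ :=
    fun z hz => dif_pos (ratVec_mem_latticeSpan hz)
  have h1 : S.card ≤ (Finset.Icc (fun _ : Fin E.rank => -(K : ℤ)) fun _ => (K : ℤ)).card := by
    refine Finset.card_le_card_of_injOn F (fun z hz => ?_) (fun z hz w hw h => ?_)
    · have : ∀ i, |F z i| ≤ (K : ℤ) := fun i => by
        rw [hF z hz]
        exact abs_coord_le_boxBound hS hB _ (subset_convexHull _ _ (Set.mem_image_of_mem _ hz)) i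
      simp only [Finset.coe_Icc, Set.mem_Icc, Pi.le_def]
      exact ⟨fun i => (abs_le.1 (this i)).1, fun i => (abs_le.1 (this i)).2⟩
    · rw [hF z hz, hF w hw] at h
      have := E.vec.repr.injective (DFunLike.coe_injective h)
      exact ratVec_injective N (congrArg Subtype.val (vsub_left_injective _ this))
  have h2 : (Finset.Icc (fun _ : Fin E.rank => -(K : ℤ)) fun _ => (K : ℤ)).card =
      (2 * K + 1) ^ E.rank := by
    rw [Pi.card_Icc]
    simp only [Int.card_Icc, Finset.prod_const, Finset.card_univ, Fintype.card_fin]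
    congr 1
    omega
  exact h1.trans (h2.le.trans (Nat.pow_le_pow_right (by omega) (rank_le_finrank hW hcop)))

/-! ### Dimension drop for proper faces -/

/-- The value of a linear functional with rational coefficients. -/
def ratDot (l : Fin N → ℚ) : QSpace N →ₗ[ℚ] ℚ := ∑ k, l k • LinearMap.proj k

theorem exists_int_ratDot {l : Fin N → ℚ} {c e : ℚ} {S : Finset (Fin N → ℤ)}
    (h : ∀ z ∈ S, ∃ m : ℤ, ratDot l (ratVec N z) = c + m * e) {q : QSpace N}
    (hq : q ∈ latticeSpan S) : ∃ m : ℤ, ratDot l q = c + m * e := by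
  refine affineSpan_induction hq ?_ (fun k u v w hu hv hw => ?_)
  · rintro _ ⟨z, hz, rfl⟩
    exact h z hz
  · obtain ⟨a, ha⟩ := hu
    obtain ⟨b, hb⟩ := hv
    obtain ⟨f, hf⟩ := hw
    refine ⟨k * (a - b) + f, ?_⟩
    rw [vadd_eq_add, vsub_eq_sub, map_add, map_zsmul, map_sub, ha, hb, hf]
    push_cast
    simp only [zsmul_eq_mul]
    ring

/-- The dimension of the affine span of a finite set. -/
def spanDim (p : ℕ) {V : Type*} [AddCommGroup V] [Module (ZMod p) V] (X : Finset V) : ℕ :=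
  Module.finrank (ZMod p) (vectorSpan (ZMod p) (X : Set V))

theorem spanDim_mono [Fact p.Prime] [Finite V] {X Y : Finset V} (h : X ⊆ Y) :
    spanDim p X ≤ spanDim p Y :=
  Submodule.finrank_mono (vectorSpan_mono _ (by exact_mod_cast h))

theorem spanDim_le_finrank [Fact p.Prime] [Finite V] (X : Finset V) :
    spanDim p X ≤ Module.finrank (ZMod p) V := Submodule.finrank_le _

/-- Let `e ≠ 0` be the difference between the value of `l` at `y` and `c`. If `y` were in the span,
its lift would differ by some `p m` from a point of the lattice of `X`, where `l` equals `c`. By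
coprimality `m` is a difference of lattice points of `insert y X`, so `l m` is an integer multiple
of `e`. But `p` times `l m` is `e`, so `p` would divide `1`. -/
theorem not_mem_affineSpan_of_ratDot_ne [Fact p.Prime] {η : Fin N → V →ᵃ[ZMod p] ZMod p} {B : ℕ}
    (hp : ∀ S : Finset (Fin N → ℤ), S ⊆ intBox N B → IsCoprimeTo p S) {X : Finset V} {y : V}
    (hX : liftImage η (insert y X) ⊆ intBox N B) {l : Fin N → ℚ} {c : ℚ}
    (hc : ∀ x ∈ X, ratDot l (ratVec N (liftVec η x)) = c)
    (hy : ratDot l (ratVec N (liftVec η y)) ≠ c) : y ∉ affineSpan (ZMod p) (X : Set V) := by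
  intro hmem
  obtain ⟨q, hq, z, rfl, hz⟩ := exists_reduces_of_mem_affineSpan (η := η) hmem
  set S := liftImage η (insert y X)
  have hXS : liftImage η X ⊆ S := Finset.image_subset_image (Finset.subset_insert _ _)
  set e := ratDot l (ratVec N (liftVec η y)) - c with he
  have he0 : e ≠ 0 := sub_ne_zero.2 hy
  have hlz : ratDot l (ratVec N z) = c := by
    obtain ⟨m, hm⟩ := exists_int_ratDot (l := l) (c := c) (e := 0) (fun w hw => by
      obtain ⟨x, hx, rfl⟩ := Finset.mem_image.1 hw
      exact ⟨0, by simp [hc x hx]⟩) hq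
    simpa using hm
  have hyS : ratVec N (liftVec η y) ∈ latticeSpan S :=
    ratVec_mem_latticeSpan (liftVec_mem_liftImage η (Finset.mem_insert_self _ _))
  have : ∀ k, ∃ m : ℤ, liftVec η y k - z k = p * m := fun k => by
    have h : ((liftVec η y k - z k : ℤ) : ZMod p) = 0 := by
      push_cast; rw [hz, liftVec, ZMod.coe_valMinAbs, sub_self]
    exact (ZMod.intCast_zmod_eq_zero_iff_dvd _ _).1 h
  choose m hm using this
  have hpm : (p : ℤ) • m = liftVec η y - z := by ext k; simp [hm k]
  have hdir : ratVec N m ∈ (latticeSpan S).direction := by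
    refine hp S hX m ?_
    rw [hpm, map_sub]
    exact AffineSubspace.vsub_mem_direction hyS (latticeSpan_mono hXS hq)
  obtain ⟨q₁, h₁, q₂, h₂, h12⟩ := (AffineSubspace.mem_direction_iff_eq_vsub ⟨_, hyS⟩ _).1 hdir
  have hval : ∀ w ∈ S, ∃ m : ℤ, ratDot l (ratVec N w) = c + m * e := fun w hw => by
    obtain ⟨x, hx, rfl⟩ := Finset.mem_image.1 hw
    rcases Finset.mem_insert.1 hx with rfl | hx
    · exact ⟨1, by rw [he]; ring⟩
    · exact ⟨0, by simp [hc x hx]⟩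
  obtain ⟨a, ha⟩ := exists_int_ratDot hval h₁
  obtain ⟨b, hb⟩ := exists_int_ratDot hval h₂
  have h5 : (p : ℚ) * ((a - b : ℤ) : ℚ) * e = e := by
    have h6 : ratDot l (ratVec N ((p : ℤ) • m)) = e := by rw [hpm, map_sub, map_sub, hlz]
    rw [map_zsmul, map_zsmul, h12, vsub_eq_sub, map_sub, ha, hb] at h6
    simp only [zsmul_eq_mul] at h6
    push_cast at h6 ⊢
    linarith
  have h7 : (p : ℤ) * (a - b) = 1 := by
    have := mul_right_cancel₀ he0 (h5.trans (one_mul e).symm)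
    exact_mod_cast this
  have h8 := Int.isUnit_iff.1 (IsUnit.of_mul_eq_one _ h7)
  have h9 := (Fact.out : p.Prime).one_lt
  omega

/-- With equal dimensions the spans of `X` and `Y` would coincide, and a point of `Y` off the
hyperplane would lie in the span of `X`. Non-emptiness of `X` matters: the empty set and a singleton
both have `spanDim` zero. -/
theorem spanDim_lt [Fact p.Prime] [Finite V] {η : Fin N → V →ᵃ[ZMod p] ZMod p} {B : ℕ}
    (hp : ∀ S : Finset (Fin N → ℤ), S ⊆ intBox N B → IsCoprimeTo p S) {X Y : Finset V}
    (hXY : X ⊂ Y) (hX : X.Nonempty) (hY : liftImage η Y ⊆ intBox N B) {l : Fin N → ℚ} {c : ℚ}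
    (hc : ∀ y ∈ Y, y ∈ X ↔ ratDot l (ratVec N (liftVec η y)) = c) : spanDim p X < spanDim p Y := by
  have hsub := hXY.subset
  obtain ⟨y, hy, hyX⟩ := Finset.exists_of_ssubset hXY
  refine lt_of_le_of_ne (spanDim_mono hsub) fun heq => ?_
  have hle : vectorSpan (ZMod p) (X : Set V) ≤ vectorSpan (ZMod p) (Y : Set V) :=
    vectorSpan_mono _ (by exact_mod_cast hsub)
  have hdir := Submodule.eq_of_le_of_finrank_eq hle heq
  obtain ⟨x, hx⟩ := hX
  have hmem : y ∈ affineSpan (ZMod p) (X : Set V) := by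
    have h1 : y -ᵥ x ∈ (affineSpan (ZMod p) (X : Set V)).direction := by
      rw [direction_affineSpan, hdir]
      exact vsub_mem_vectorSpan _ hy (hsub hx)
    have := AffineSubspace.vadd_mem_of_mem_direction h1 (subset_affineSpan (ZMod p) _ hx)
    rwa [vsub_vadd] at this
  refine not_mem_affineSpan_of_ratDot_ne hp ?_ (fun x hx => (hc x (hsub hx)).1 hx)
    (fun h => hyX ((hc y hy).2 h)) hmem
  exact (Finset.image_subset_image (Finset.insert_subset hy hsub)).trans hY

end ModP

/-! ### Generic tuples -/

/-- The total weight of a finite set. -/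
def weight {V : Type*} (f : V → ℕ) (X : Finset V) : ℝ := ∑ v ∈ X, (f v : ℝ)

theorem weight_nonneg {V : Type*} (f : V → ℕ) (X : Finset V) : 0 ≤ weight f X :=
  Finset.sum_nonneg fun _ _ => Nat.cast_nonneg _

theorem weight_mono {V : Type*} (f : V → ℕ) {X Y : Finset V} (h : X ⊆ Y) :
    weight f X ≤ weight f Y :=
  Finset.sum_le_sum_of_subset_of_nonneg h fun _ _ _ => Nat.cast_nonneg _

theorem weight_sdiff {V : Type*} (f : V → ℕ) {X Y : Finset V} (h : X ⊆ Y) :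
    weight f (Y \ X) = weight f Y - weight f X :=
  eq_sub_of_add_eq (Finset.sum_sdiff h)

theorem exists_least_of_inter_closed {V : Type*} {C : Finset V → Prop} {X : Finset V} (hX : C X)
    (hinter : ∀ Z Z', C Z → C Z' → C (Z ∩ Z')) {Y : Finset V} (hY : Y ⊆ X) :
    ∃ Z, C Z ∧ Y ⊆ Z ∧ ∀ Z', C Z' → Y ⊆ Z' → Z ⊆ Z' := by
  have hne : ∃ k, ∃ Z, C Z ∧ Y ⊆ Z ∧ Z.card = k := ⟨_, X, hX, hY, rfl⟩
  obtain ⟨Z, hZ, hYZ, hk⟩ := Nat.find_spec hne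
  refine ⟨Z, hZ, hYZ, fun Z' hZ' hYZ' => ?_⟩
  have h1 := Nat.find_min' hne ⟨Z ∩ Z', hinter _ _ hZ hZ', Finset.subset_inter hYZ hYZ', rfl⟩
  rw [← hk] at h1
  exact Finset.inter_eq_left.1 (Finset.eq_of_subset_of_card_le Finset.inter_subset_left h1)

theorem sum_fin_succ_tuple {V : Type*} [Fintype V] (r : ℕ) (g : (Fin (r + 1) → V) → ℝ) :
    ∑ t, g t = ∑ v, ∑ t : Fin r → V, g (Fin.cons v t) := by
  rw [← Fintype.sum_prod_type']
  exact (Fintype.sum_equiv (Fin.consEquiv fun _ => V) _ _ fun _ => rfl).symm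

/-- Tuples are chosen point by point. As long as the closed set `Z` generated so far is not `X`, a
proportion of at least `ε` of `X` lies outside it, and any such point raises the dimension of the
closure. After `r` steps the dimension has nowhere left to grow. -/
theorem pow_le_sum_generic_extensions {V : Type*} [Fintype V] (f : V → ℕ) {C : Finset V → Prop}
    {X : Finset V} (hX : C X) (hsub : ∀ Z, C Z → Z ⊆ X)
    (hinter : ∀ Z Z', C Z → C Z' → C (Z ∩ Z')) {ε : ℝ} (hε : 0 ≤ ε) (hε1 : ε ≤ 1)
    (hlarge : ∀ Z, C Z → Z ≠ X → weight f Z ≤ (1 - ε) * weight f X) {dim : Finset V → ℕ} {d : ℕ}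
    (hd : dim X ≤ d) (hdim : ∀ Z Z', C Z → C Z' → Z.Nonempty → Z ⊂ Z' → dim Z < dim Z') (r : ℕ) :
    ∀ Z, C Z → Z.Nonempty → (Z = X ∨ d ≤ dim Z + r) →
      (ε * weight f X) ^ r ≤ ∑ t : Fin r → V,
        if (∀ i, t i ∈ X) ∧ ∀ Z', C Z' → Z ⊆ Z' → (∀ i, t i ∈ Z') → Z' = X
        then ∏ i, (f (t i) : ℝ) else 0 := by
  induction r with
  | zero =>
    intro Z hZ hne h
    have hZX : Z = X := by
      rcases h with h | h
      · exact h
      · by_contra hne'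
        have := hdim Z X hZ hX hne (lt_of_le_of_ne (hsub Z hZ) hne')
        omega
    rw [Fintype.sum_unique, if_pos]
    · simp
    · exact ⟨fun i => i.elim0, fun Z' hZ' h _ => (hsub Z' hZ').antisymm (hZX ▸ h)⟩
  | succ r ih =>
    intro Z hZ hne h
    rw [sum_fin_succ_tuple]
    -- `G` contains the admissible choices for the next point; once `Z = X`, every point of `X` will
    -- do.
    let G : Finset V := if Z = X then X else X \ Z
    have hGX : G ⊆ X := by
      dsimp only [G]; split_ifs
      · exact subset_rfl
      · exact Finset.sdiff_subset
    have hG : ε * weight f X ≤ weight f G := by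
      dsimp only [G]; split_ifs with hZX
      · exact mul_le_of_le_one_left (weight_nonneg f X) hε1
      · rw [weight_sdiff f (hsub Z hZ)]
        linarith [hlarge Z hZ hZX]
    have h0 : 0 ≤ ε * weight f X := mul_nonneg hε (weight_nonneg f X)
    have hstep : ∀ v ∈ G, (f v : ℝ) * (ε * weight f X) ^ r ≤ ∑ t : Fin r → V,
        if (∀ i, (Fin.cons v t : Fin (r + 1) → V) i ∈ X) ∧ ∀ Z', C Z' → Z ⊆ Z' →
          (∀ i, (Fin.cons v t : Fin (r + 1) → V) i ∈ Z') → Z' = X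
        then ∏ i, (f ((Fin.cons v t : Fin (r + 1) → V) i) : ℝ) else 0 := by
      intro v hv
      have hvX := hGX hv
      obtain ⟨Z₁, hZ₁, hsub₁, hleast⟩ := exists_least_of_inter_closed hX hinter
        (Finset.insert_subset hvX (hsub Z hZ))
      have hZZ₁ : Z ⊆ Z₁ := (Finset.subset_insert _ _).trans hsub₁
      have hvZ₁ : v ∈ Z₁ := hsub₁ (Finset.mem_insert_self _ _)
      have hor : Z₁ = X ∨ d ≤ dim Z₁ + r := by
        by_cases hZX : Z = X
        · exact Or.inl ((hsub _ hZ₁).antisymm (hZX ▸ hZZ₁))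
        · right
          have hv' : v ∉ Z := by
            dsimp only [G] at hv
            rw [if_neg hZX] at hv
            exact (Finset.mem_sdiff.1 hv).2
          have h1 : Z ⊂ Z₁ := Finset.ssubset_iff_subset_ne.2
            ⟨hZZ₁, fun h => hv' (h ▸ hvZ₁)⟩
          have h2 := hdim Z Z₁ hZ hZ₁ hne h1
          have h3 := h.resolve_left hZX
          omega
      refine (mul_le_mul_of_nonneg_left (ih Z₁ hZ₁ (hne.mono hZZ₁) hor)
        (Nat.cast_nonneg _)).trans ?_
      rw [Finset.mul_sum]
      refine Finset.sum_le_sum fun t _ => ?_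
      split_ifs with h1 h2 h2
      · rw [Fin.prod_univ_succ]
        simp
      · exfalso
        refine h2 ⟨Fin.cases hvX h1.1, fun Z' hZ' hZZ' ht => ?_⟩
        exact h1.2 Z' hZ' (hleast Z' hZ' (Finset.insert_subset (ht 0) hZZ'))
          (fun i => by simpa using ht i.succ)
      · rw [mul_zero]
        exact Finset.prod_nonneg fun _ _ => Nat.cast_nonneg _
      · rw [mul_zero]
    calc (ε * weight f X) ^ (r + 1) = (ε * weight f X) * (ε * weight f X) ^ r := pow_succ' _ _
      _ ≤ weight f G * (ε * weight f X) ^ r := mul_le_mul_of_nonneg_right hG (pow_nonneg h0 _)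
      _ = ∑ v ∈ G, (f v : ℝ) * (ε * weight f X) ^ r := Finset.sum_mul _ _ _
      _ ≤ _ := Finset.sum_le_sum hstep
      _ ≤ _ := Finset.sum_le_sum_of_subset_of_nonneg (Finset.subset_univ _) fun v _ _ =>
        Finset.sum_nonneg fun t _ => by
          split_ifs
          · exact Finset.prod_nonneg fun _ _ => Nat.cast_nonneg _
          · exact le_rfl

/-- Tuples of `d + 1` points of a large set `X` that lie in no proper closed subset have large
total weight. -/
theorem pow_le_sum_generic {V : Type*} [Fintype V] (f : V → ℕ) {C : Finset V → Prop}
    {X : Finset V} (hX : C X) (hsub : ∀ Z, C Z → Z ⊆ X)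
    (hinter : ∀ Z Z', C Z → C Z' → C (Z ∩ Z')) {ε : ℝ} (hε : 0 ≤ ε) (hε1 : ε ≤ 1)
    (hlarge : ∀ Z, C Z → Z ≠ X → weight f Z ≤ (1 - ε) * weight f X) {dim : Finset V → ℕ} {d : ℕ}
    (hd : dim X ≤ d) (hdim : ∀ Z Z', C Z → C Z' → Z.Nonempty → Z ⊂ Z' → dim Z < dim Z') :
    (ε * weight f X) ^ (d + 1) ≤ ∑ t : Fin (d + 1) → V,
        if (∀ i, t i ∈ X) ∧ ∀ Z', C Z' → (∀ i, t i ∈ Z') → Z' = X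
        then ∏ i, (f (t i) : ℝ) else 0 := by
  have h0 : 0 ≤ ε * weight f X := mul_nonneg hε (weight_nonneg f X)
  have hstep : ∀ v ∈ X, (f v : ℝ) * (ε * weight f X) ^ d ≤ ∑ t : Fin d → V,
      if (∀ i, (Fin.cons v t : Fin (d + 1) → V) i ∈ X) ∧ ∀ Z', C Z' →
        (∀ i, (Fin.cons v t : Fin (d + 1) → V) i ∈ Z') → Z' = X
      then ∏ i, (f ((Fin.cons v t : Fin (d + 1) → V) i) : ℝ) else 0 := by
    intro v hv
    -- The first point only serves to make the closed set non-empty, hence `d + 1` points instead of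
    -- `d`.
    obtain ⟨Z₁, hZ₁, hsub₁, hleast⟩ := exists_least_of_inter_closed hX hinter
      (Finset.singleton_subset_iff.2 hv)
    refine (mul_le_mul_of_nonneg_left (pow_le_sum_generic_extensions f hX hsub hinter hε hε1 hlarge
      hd hdim d Z₁ hZ₁ ⟨v, Finset.singleton_subset_iff.1 hsub₁⟩ (Or.inr (by omega)))
      (Nat.cast_nonneg _)).trans ?_
    rw [Finset.mul_sum]
    refine Finset.sum_le_sum fun t _ => ?_
    split_ifs with h1 h2 h2
    · rw [Fin.prod_univ_succ]
      simp
    · exfalso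
      refine h2 ⟨Fin.cases hv h1.1, fun Z' hZ' ht => ?_⟩
      exact h1.2 Z' hZ' (hleast Z' hZ' (Finset.singleton_subset_iff.2 (ht 0)))
        (fun i => by simpa using ht i.succ)
    · rw [mul_zero]
      exact Finset.prod_nonneg fun _ _ => Nat.cast_nonneg _
    · rw [mul_zero]
  rw [sum_fin_succ_tuple]
  calc (ε * weight f X) ^ (d + 1) = (ε * weight f X) * (ε * weight f X) ^ d := pow_succ' _ _
    _ ≤ weight f X * (ε * weight f X) ^ d :=
      mul_le_mul_of_nonneg_right (mul_le_of_le_one_left (weight_nonneg f X) hε1) (pow_nonneg h0 _)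
    _ = ∑ v ∈ X, (f v : ℝ) * (ε * weight f X) ^ d := Finset.sum_mul _ _ _
    _ ≤ _ := Finset.sum_le_sum hstep
    _ ≤ _ := Finset.sum_le_sum_of_subset_of_nonneg (Finset.subset_univ _) fun v _ _ =>
      Finset.sum_nonneg fun t _ => by
        split_ifs
        · exact Finset.prod_nonneg fun _ _ => Nat.cast_nonneg _
        · exact le_rfl

/-! ### Systems of marked subsets -/

/-- A set `U` with finitely many marked subsets `A j`, `j < n`, and affine functions `ξ k`, `k < m`.
The mark `A j` was placed as a face of the intersection of the marked sets in `par j`, and the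
function `ξ k` was attached to the intersection of the marked sets in `fpar k`, on which it takes
values of size at most `b k`. -/
structure MarkSystem (p : ℕ) (V : Type*) [AddCommGroup V] [Module (ZMod p) V] where
  n : ℕ
  m : ℕ
  U : Finset V
  A : ℕ → Finset V
  par : ℕ → Finset ℕ
  dep : ℕ → ℕ
  ξ : ℕ → V →ᵃ[ZMod p] ZMod p
  fpar : ℕ → Finset ℕ
  b : ℕ → ℕ

namespace MarkSystem

variable {p : ℕ} {V : Type*} [AddCommGroup V] [Module (ZMod p) V] (S : MarkSystem p V)

/-- The intersection of the marked sets in `J`. -/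
def W (J : Finset ℕ) : Finset V := S.U.filter fun v => ∀ j ∈ J, v ∈ S.A j

/-- The function `ξ k` is attached to a set containing the intersection of the sets in `J`. -/
def Active (J : Finset ℕ) (k : ℕ) : Prop := k < S.m ∧ S.fpar k ⊆ J

/-- The functions attached to sets containing the intersection of the sets in `J`; the others are
replaced by zero. -/
def η (N : ℕ) (J : Finset ℕ) (k : Fin N) : V →ᵃ[ZMod p] ZMod p :=
  if S.Active J k then S.ξ k else 0

/-- The bound for the values of the functions active on `J`. -/
def bound (J : Finset ℕ) : ℕ := ((Finset.range S.m).filter fun k => S.fpar k ⊆ J).sup S.b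

/-- A bound for the coordinates of the lattice points of the polytope of `J`. -/
def coordSize (N : ℕ) (J : Finset ℕ) : ℕ := boxBound N (S.bound J)

/-- A rational linear functional, pulled back to `V`. -/
def functional (N : ℕ) (J : Finset ℕ) (l : Fin N → ℚ) (v : V) : ℚ :=
  ratDot l (ratVec N (liftVec (S.η N J) v))

/-- The part of the set of `J` lying over a face of its polytope. -/
def IsFaceSet (N : ℕ) (J : Finset ℕ) (Y X : Finset V) : Prop :=
  ∃ (l : Fin N → ℚ) (c : ℚ), ∀ w ∈ Y, S.functional N J l w ≤ c ∧
    (w ∈ X ↔ S.functional N J l w = c)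

/-- The directions of the set of `J` along which all active functions are constant. -/
def fiberDir (J : Finset ℕ) : Submodule (ZMod p) V :=
  vectorSpan (ZMod p) (S.W J : Set V) ⊓
    ⨅ k : ℕ, ⨅ _ : S.Active J k, LinearMap.ker (S.ξ k).linear

/-- The marks placed on `J` that contain the tuple `t`. -/
def kids {r : ℕ} (J : Finset ℕ) (t : Fin r → V) : Finset ℕ :=
  (Finset.range S.n).filter fun j => S.par j = J ∧ ∀ i, t i ∈ S.A j

/-- The average dimension of the smallest marked subset of `J` that contains a random tuple. -/
def potential [Fintype V] (f : V → ℕ) (d : ℕ) (J : Finset ℕ) : ℝ :=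
  ∑ t : Fin (d + 1) → V, (∏ i, (f (t i) : ℝ)) * spanDim p (S.W (J ∪ S.kids J t))

/-- The structural conditions on a system of marked subsets that bound its size. -/
structure Inv [Fintype V] (f : V → ℕ) (d N : ℕ) (c : ℝ) : Prop where
  par_lt : ∀ j < S.n, ∀ i ∈ S.par j, i < j
  dep_lt : ∀ j < S.n, ∀ i ∈ S.par j, S.dep i < S.dep j
  dep_le : ∀ j < S.n, S.dep j + spanDim p (S.W {j}) ≤ d
  fpar_subset : ∀ k < S.m, S.fpar k ⊆ Finset.range S.n
  functions : ∀ J, ((Finset.range S.m).filter fun k => S.fpar k = J).card +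
    Module.finrank (ZMod p) (S.fiberDir J) ≤ d
  marks : ∀ J, (((Finset.range S.n).filter fun j => S.par j = J).card : ℝ) * c +
    S.potential f d J ≤ d * weight f Finset.univ ^ (d + 1)
  faces : ∀ j < S.n, S.IsFaceSet N (S.par j) (S.W (S.par j)) (S.A j)
  supp : ∀ v ∈ S.U, f v ≠ 0

/-- The attached functions have the prescribed size. -/
def Bounded : Prop := ∀ k < S.m, ∀ v ∈ S.W (S.fpar k), |(S.ξ k v).valMinAbs| ≤ (S.b k : ℤ)

variable {S}

theorem mem_W {J : Finset ℕ} {v : V} : v ∈ S.W J ↔ v ∈ S.U ∧ ∀ j ∈ J, v ∈ S.A j :=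
  Finset.mem_filter

theorem W_anti {J J' : Finset ℕ} (h : J ⊆ J') : S.W J' ⊆ S.W J := fun v hv => by
  rw [mem_W] at hv ⊢
  exact ⟨hv.1, fun j hj => hv.2 j (h hj)⟩

theorem Active.mono {J J' : Finset ℕ} (h : J ⊆ J') {k : ℕ} (hk : S.Active J k) : S.Active J' k :=
  ⟨hk.1, hk.2.trans h⟩

theorem bound_mono {J J' : Finset ℕ} (h : J ⊆ J') : S.bound J ≤ S.bound J' := by
  refine Finset.sup_mono fun k hk => ?_
  simp only [Finset.mem_filter] at hk ⊢
  exact ⟨hk.1, hk.2.trans h⟩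

theorem coordSize_mono {N : ℕ} {J J' : Finset ℕ} (h : J ⊆ J') :
    S.coordSize N J ≤ S.coordSize N J' := boxBound_mono N (bound_mono h)

theorem Bounded.liftImage_subset (hS : S.Bounded) (N : ℕ) (J : Finset ℕ) {Y : Finset V}
    (hY : Y ⊆ S.W J) : liftImage (S.η N J) Y ⊆ intBox N (S.bound J) := by
  intro z hz
  obtain ⟨v, hv, rfl⟩ := Finset.mem_image.1 hz
  refine mem_intBox.2 fun k => ?_
  unfold liftVec η
  split_ifs with hk
  · refine (hS k hk.1 v (W_anti hk.2 (hY hv))).trans ?_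
    exact_mod_cast Finset.le_sup (f := S.b)
      (Finset.mem_filter.2 ⟨Finset.mem_range.2 hk.1, hk.2⟩)
  · simp

theorem mem_fiberDir {J : Finset ℕ} {g : V} : g ∈ S.fiberDir J ↔
    g ∈ vectorSpan (ZMod p) (S.W J : Set V) ∧ ∀ k, S.Active J k → (S.ξ k).linear g = 0 := by
  simp [fiberDir, Submodule.mem_iInf]

theorem fiberDir_mono {S' : MarkSystem p V} {J J' : Finset ℕ} (hW : S'.W J' ⊆ S.W J)
    (hξ : ∀ k, S.Active J k → S'.Active J' k ∧ S'.ξ k = S.ξ k) :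
    S'.fiberDir J' ≤ S.fiberDir J := by
  intro g hg
  rw [mem_fiberDir] at hg ⊢
  refine ⟨vectorSpan_mono _ (by exact_mod_cast hW) hg.1, fun k hk => ?_⟩
  rw [← (hξ k hk).2]
  exact hg.2 k (hξ k hk).1

theorem functional_eq_sum (N : ℕ) (J : Finset ℕ) (l : Fin N → ℚ) (v : V) :
    S.functional N J l v = ∑ k : Fin N, l k * (((S.η N J k) v).valMinAbs : ℚ) := by
  simp [functional, ratDot, liftVec, LinearMap.sum_apply]

theorem functional_add (N : ℕ) (J : Finset ℕ) (l l' : Fin N → ℚ) (v : V) :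
    S.functional N J (l + l') v = S.functional N J l v + S.functional N J l' v := by
  simp [functional_eq_sum, add_mul, Finset.sum_add_distrib]

theorem IsFaceSet.mono {N : ℕ} {J : Finset ℕ} {Y Y' X : Finset V} (h : S.IsFaceSet N J Y X)
    (hY : Y' ⊆ Y) : S.IsFaceSet N J Y' X := by
  obtain ⟨l, c, h⟩ := h
  exact ⟨l, c, fun w hw => h w (hY hw)⟩

/-- The sum of the two functionals reaches `c + c'` exactly where both bounds are attained. The
intersection may be empty, so face sets are not required to be non-empty. -/
theorem IsFaceSet.inter {N : ℕ} {J : Finset ℕ} {Y X X' : Finset V} (h : S.IsFaceSet N J Y X)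
    (h' : S.IsFaceSet N J Y X') : S.IsFaceSet N J Y (X ∩ X') := by
  obtain ⟨l, c, h⟩ := h
  obtain ⟨l', c', h'⟩ := h'
  refine ⟨l + l', c + c', fun w hw => ?_⟩
  rw [functional_add, Finset.mem_inter, (h w hw).2, (h' w hw).2]
  refine ⟨add_le_add (h w hw).1 (h' w hw).1, fun e => by rw [e.1, e.2], fun e => ?_⟩
  have h1 := (h w hw).1
  have h2 := (h' w hw).1
  constructor <;> linarith

theorem isFaceSet_self (N : ℕ) (J : Finset ℕ) (Y : Finset V) : S.IsFaceSet N J Y Y :=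
  ⟨0, 0, fun w hw => by simp [functional_eq_sum, hw]⟩

/-- A face set of a system remains one when more functions become active. -/
theorem IsFaceSet.congr {S' : MarkSystem p V} {N : ℕ} {J : Finset ℕ} {Y X : Finset V}
    (h : S.IsFaceSet N J Y X) (hξ : ∀ k, S.Active J k → S'.Active J k ∧ S'.ξ k = S.ξ k) :
    S'.IsFaceSet N J Y X := by
  obtain ⟨l, c, h⟩ := h
  refine ⟨fun k => if S.Active J k then l k else 0, c, fun w hw => ?_⟩
  have : S'.functional N J (fun k => if S.Active J k then l k else 0) w =
      S.functional N J l w := by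
    rw [functional_eq_sum, functional_eq_sum]
    refine Finset.sum_congr rfl fun k _ => ?_
    unfold η
    split_ifs with h1 h2 h2
    · rw [(hξ k h1).2]
    · exact absurd (hξ k h1).1 h2
    · simp
    · simp
  rw [this]
  exact h w hw

theorem spanDim_lt_of_isFaceSet [Fact p.Prime] [Finite V] {N : ℕ} {J : Finset ℕ}
    (hS : S.Bounded)
    (hp : ∀ T : Finset (Fin N → ℤ), T ⊆ intBox N (S.bound J) → IsCoprimeTo p T)
    {Y X : Finset V} (hY : Y ⊆ S.W J) (hX : S.IsFaceSet N J Y X) (hne : X.Nonempty)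
    (hXY : X ⊂ Y) : spanDim p X < spanDim p Y := by
  obtain ⟨l, c, h⟩ := hX
  exact spanDim_lt (η := S.η N J) hp hXY hne (hS.liftImage_subset N J hY) (l := l) (c := c)
    fun y hy => (h y hy).2

theorem mem_kids {r j : ℕ} {J : Finset ℕ} {t : Fin r → V} :
    j ∈ S.kids J t ↔ j < S.n ∧ S.par j = J ∧ ∀ i, t i ∈ S.A j := by
  simp [kids]

/-! ### Restricting to a smaller set -/

variable (S) in
/-- The restriction of a system to a smaller set. -/
def restrict (U' : Finset V) : MarkSystem p V := { S with U := U' }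

theorem W_restrict {U' : Finset V} (h : U' ⊆ S.U) (J : Finset ℕ) :
    (S.restrict U').W J ⊆ S.W J := fun _ hv => by
  rw [mem_W] at hv ⊢
  exact ⟨h hv.1, hv.2⟩

theorem Inv.restrict [Fintype V] [Fact p.Prime] {f : V → ℕ} {d N : ℕ} {c : ℝ}
    (hS : S.Inv f d N c) {U' : Finset V} (h : U' ⊆ S.U) : (S.restrict U').Inv f d N c where
  par_lt := hS.par_lt
  dep_lt := hS.dep_lt
  dep_le j hj := (Nat.add_le_add_left (spanDim_mono (W_restrict h _)) _).trans (hS.dep_le j hj)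
  fpar_subset := hS.fpar_subset
  functions J := (Nat.add_le_add_left (Submodule.finrank_mono (fiberDir_mono (S := S)
    (W_restrict h J) fun k hk => ⟨hk, rfl⟩)) _).trans (hS.functions J)
  marks J := by
    refine le_trans (add_le_add_right ?_ _) (hS.marks J)
    refine Finset.sum_le_sum fun t _ => mul_le_mul_of_nonneg_left ?_
      (Finset.prod_nonneg fun _ _ => Nat.cast_nonneg _)
    exact_mod_cast spanDim_mono (W_restrict h _)
  faces j hj := (hS.faces j hj).mono (W_restrict h _)
  supp v hv := hS.supp v (h hv)

theorem Bounded.restrict (hS : S.Bounded) {U' : Finset V} (h : U' ⊆ S.U) :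
    (S.restrict U').Bounded := fun k hk v hv => hS k hk v (W_restrict h _ hv)

/-! ### Attaching a function -/

variable (S) in
/-- Attach the function `ζ` of size `K` to the intersection of the marked sets in `J`. -/
def addFunction (J : Finset ℕ) (ζ : V →ᵃ[ZMod p] ZMod p) (K : ℕ) : MarkSystem p V :=
  { S with
    m := S.m + 1
    ξ := Function.update S.ξ S.m ζ
    fpar := Function.update S.fpar S.m J
    b := Function.update S.b S.m K }

theorem active_addFunction {J J' : Finset ℕ} {ζ : V →ᵃ[ZMod p] ZMod p} {K k : ℕ}
    (hk : S.Active J' k) :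
    (S.addFunction J ζ K).Active J' k ∧ (S.addFunction J ζ K).ξ k = S.ξ k := by
  have hne : k ≠ S.m := hk.1.ne
  simp only [Active, addFunction, Function.update_of_ne hne]
  exact ⟨⟨hk.1.trans (Nat.lt_succ_self _), hk.2⟩, trivial⟩

theorem filter_range_update {α : Type*} (m : ℕ) (g : ℕ → α) (a : α) (q : α → Prop) :
    (Finset.range (m + 1)).filter (fun k => q (Function.update g m a k)) =
      if q a then insert m ((Finset.range m).filter fun k => q (g k))
      else (Finset.range m).filter fun k => q (g k) := by
  rw [Finset.range_add_one, Finset.filter_insert, Function.update_self]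
  have : (Finset.range m).filter (fun k => q (Function.update g m a k)) =
      (Finset.range m).filter fun k => q (g k) := by
    refine Finset.filter_congr fun k hk => ?_
    rw [Function.update_of_ne (Finset.mem_range.1 hk).ne]
  rw [this]

theorem card_filter_range_update {α : Type*} (m : ℕ) (g : ℕ → α) (a : α) (q : α → Prop) :
    ((Finset.range (m + 1)).filter (fun k => q (Function.update g m a k))).card =
      ((Finset.range m).filter fun k => q (g k)).card + if q a then 1 else 0 := by
  rw [filter_range_update]
  split_ifs
  · rw [Finset.card_insert_of_notMem (by simp)]
  · rfl

/-- The new function is not constant along `fiberDir J`, so the dimension of that space drops and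
pays for the function. Earlier face sets persist, with coefficient zero on newly active coordinates.
-/
theorem Inv.addFunction [Fintype V] [Fact p.Prime] {f : V → ℕ} {d N : ℕ} {c : ℝ}
    (hS : S.Inv f d N c) {J : Finset ℕ} (hJ : J ⊆ Finset.range S.n) {ζ : V →ᵃ[ZMod p] ZMod p}
    {K : ℕ} (hζ : ∃ g ∈ S.fiberDir J, ζ.linear g ≠ 0) : (S.addFunction J ζ K).Inv f d N c where
  par_lt := hS.par_lt
  dep_lt := hS.dep_lt
  dep_le := hS.dep_le
  fpar_subset k hk := by
    simp only [MarkSystem.addFunction, Function.update_apply] at hk ⊢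
    split_ifs with h
    · exact hJ
    · exact hS.fpar_subset k (by omega)
  functions J' := by
    have hcard : ((Finset.range (S.addFunction J ζ K).m).filter
        fun k => (S.addFunction J ζ K).fpar k = J').card =
        ((Finset.range S.m).filter fun k => S.fpar k = J').card + if J = J' then 1 else 0 := by
      convert card_filter_range_update S.m S.fpar J (· = J') <;> rfl
    have hmono : (S.addFunction J ζ K).fiberDir J' ≤ S.fiberDir J' :=
      fiberDir_mono subset_rfl fun k hk => active_addFunction hk
    have h1 := hS.functions J'
    rw [hcard]
    split_ifs with h
    · subst h
      have h2 : (S.addFunction J ζ K).fiberDir J < S.fiberDir J := by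
        refine lt_of_le_of_ne hmono fun heq => ?_
        obtain ⟨g, hg, hne⟩ := hζ
        rw [← heq, mem_fiberDir] at hg
        have := hg.2 S.m ⟨Nat.lt_succ_self _, by simp [MarkSystem.addFunction]⟩
        simp only [MarkSystem.addFunction, Function.update_self] at this
        exact hne this
      have := Submodule.finrank_lt_finrank_of_lt h2
      omega
    · have := Submodule.finrank_mono hmono
      omega
  marks := hS.marks
  faces j hj := (hS.faces j hj).congr fun k hk => active_addFunction hk
  supp := hS.supp

/-! ### Placing a mark -/

variable (S) in
/-- Mark the subset `X` of the intersection of the marked sets in `J`. -/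
def addMark (J : Finset ℕ) (X : Finset V) : MarkSystem p V :=
  { S with
    n := S.n + 1
    A := Function.update S.A S.n X
    par := Function.update S.par S.n J
    dep := Function.update S.dep S.n (1 + J.sup S.dep) }

theorem W_addMark {J J' : Finset ℕ} {X : Finset V} (h : S.n ∉ J') :
    (S.addMark J X).W J' = S.W J' := by
  ext v
  rw [mem_W, mem_W]
  refine and_congr Iff.rfl (forall₂_congr fun j hj => ?_)
  have : j ≠ S.n := by rintro rfl; exact h hj
  simp only [addMark, Function.update_of_ne this]

theorem W_addMark_singleton {J : Finset ℕ} {X : Finset V} (hX : X ⊆ S.U) :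
    (S.addMark J X).W {S.n} = X := by
  ext v
  simp only [mem_W, addMark, Finset.mem_singleton, forall_eq, Function.update_self]
  exact ⟨fun h => h.2, fun h => ⟨hX h, h⟩⟩

theorem kids_addMark_of_ne {r : ℕ} {J J' : Finset ℕ} {X : Finset V} (h : J ≠ J')
    (t : Fin r → V) : (S.addMark J X).kids J' t = S.kids J' t := by
  ext j
  rw [mem_kids, mem_kids]
  simp only [addMark]
  by_cases hj : j = S.n
  · subst hj
    simp [h]
  · simp only [Function.update_of_ne hj]
    refine and_congr_left fun _ => ?_
    omega

theorem kids_subset_addMark {r : ℕ} {J J' : Finset ℕ} {X : Finset V} (t : Fin r → V) :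
    S.kids J' t ⊆ (S.addMark J X).kids J' t := by
  intro j hj
  rw [mem_kids] at hj ⊢
  simp only [addMark, Function.update_of_ne hj.1.ne]
  exact ⟨by omega, hj.2⟩

theorem kids_subset_range {r : ℕ} {J : Finset ℕ} (t : Fin r → V) :
    S.kids J t ⊆ Finset.range S.n := Finset.filter_subset _ _

theorem potential_le [Fintype V] [Fact p.Prime] (f : V → ℕ) (J : Finset ℕ) :
    S.potential f (Module.finrank (ZMod p) V) J ≤
      Module.finrank (ZMod p) V * weight f Finset.univ ^ (Module.finrank (ZMod p) V + 1) := by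
  set d := Module.finrank (ZMod p) V
  have h1 : weight f Finset.univ ^ (d + 1) = ∑ t : Fin (d + 1) → V, ∏ i, (f (t i) : ℝ) := by
    unfold weight
    rw [Finset.sum_pow']
    simp
  rw [h1, Finset.mul_sum]
  refine Finset.sum_le_sum fun t _ => ?_
  rw [mul_comm]
  refine mul_le_mul_of_nonneg_right ?_ (Finset.prod_nonneg fun _ _ => Nat.cast_nonneg _)
  exact_mod_cast spanDim_le_finrank _

end MarkSystem

/-! ### Marking a large face lowers the potential -/

namespace MarkSystem

variable {p : ℕ} {V : Type*} [AddCommGroup V] [Module (ZMod p) V] {S : MarkSystem p V}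

/-- A face set of `J` that carries a proportion of at least `ε` of the whole weight, and none of
whose proper face sets carries a proportion of more than `1 - ε` of its weight. -/
structure IsLargeFaceSet (S : MarkSystem p V) (f : V → ℕ) (ε : ℝ) (N : ℕ) (J : Finset ℕ)
    (X : Finset V) : Prop where
  subset : X ⊆ S.W J
  nonempty : X.Nonempty
  isFaceSet : S.IsFaceSet N J (S.W J) X
  le_weight : ε * weight f S.U ≤ weight f X
  weight_le : ∀ Z ⊆ X, S.IsFaceSet N J X Z → Z ≠ X → weight f Z ≤ (1 - ε) * weight f X

/-- For a tuple generic in `X`, the smallest old marked subset around it strictly contains `X`,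
while the new one lies in `X`; its dimension drops by at least one. For other tuples it does not
grow. The amount subtracted is a lower bound for the weight of the generic tuples. -/
theorem potential_addMark_le [Fintype V] [Fact p.Prime] {f : V → ℕ} {N : ℕ} {c ε : ℝ}
    (hS : S.Inv f (Module.finrank (ZMod p) V) N c)
    (hb : S.Bounded) (hε : 0 ≤ ε) (hε1 : ε ≤ 1) {J : Finset ℕ}
    (hJ : J ⊆ Finset.range S.n)
    (hp : ∀ T : Finset (Fin N → ℤ), T ⊆ intBox N (S.bound J) → IsCoprimeTo p T)
    {X : Finset V} (hX : S.IsLargeFaceSet f ε N J X)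
    (hnew : ∀ J' ⊆ Finset.range S.n, S.W J' ≠ X) :
    (S.addMark J X).potential f (Module.finrank (ZMod p) V) J +
      (ε * (ε * weight f S.U)) ^ (Module.finrank (ZMod p) V + 1) ≤
      S.potential f (Module.finrank (ZMod p) V) J := by
  set d := Module.finrank (ZMod p) V with hd
  let C : Finset V → Prop := fun Z => Z ⊆ X ∧ S.IsFaceSet N J X Z
  have hgen := pow_le_sum_generic f (C := C) (X := X) ⟨subset_rfl, isFaceSet_self N J X⟩
    (fun Z hZ => hZ.1) (fun Z Z' hZ hZ' => ⟨Finset.inter_subset_left.trans hZ.1, hZ.2.inter hZ'.2⟩)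
    hε hε1 (fun Z hZ hne => hX.weight_le Z hZ.1 hZ.2 hne) (dim := spanDim p) (d := d)
    (spanDim_le_finrank X) (fun Z Z' hZ hZ' hne hlt =>
      spanDim_lt_of_isFaceSet hb hp (hZ'.1.trans hX.subset) (hZ.2.mono hZ'.1) hne hlt)
  have hpow : (ε * (ε * weight f S.U)) ^ (d + 1) ≤ (ε * weight f X) ^ (d + 1) :=
    pow_le_pow_left₀ (mul_nonneg hε (mul_nonneg hε (weight_nonneg _ _)))
      (mul_le_mul_of_nonneg_left hX.le_weight hε) _
  have hnJ : S.n ∉ J := fun h => by simpa using hJ h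
  have hWJ : (S.addMark J X).W J = S.W J := W_addMark hnJ
  have hmono : ∀ t : Fin (d + 1) → V,
      (S.addMark J X).W (J ∪ (S.addMark J X).kids J t) ⊆ S.W (J ∪ S.kids J t) := fun t => by
    have hn : S.n ∉ J ∪ S.kids J t := fun h => by
      simpa using Finset.union_subset hJ (kids_subset_range t) h
    rw [← W_addMark (S := S) (J := J) (X := X) hn]
    exact W_anti (Finset.union_subset_union_right (kids_subset_addMark t))
  refine le_trans (add_le_add_right (hpow.trans hgen) _) ?_
  unfold potential
  rw [← Finset.sum_add_distrib]
  refine Finset.sum_le_sum fun t _ => ?_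
  have hw : (0 : ℝ) ≤ ∏ i, (f (t i) : ℝ) := Finset.prod_nonneg fun _ _ => Nat.cast_nonneg _
  split_ifs with ht
  -- An old mark on `J` containing the tuple meets `X` in a face set of `X`, which by genericity is
  -- all of `X`.
  · have hkids : ∀ j ∈ S.kids J t, X ⊆ S.A j := by
      intro j hj
      obtain ⟨hjn, hpar, htj⟩ := mem_kids.1 hj
      have h1 : S.IsFaceSet N J X (S.A j) := by
        have := hS.faces j hjn
        rw [hpar] at this
        exact this.mono hX.subset
      have h2 := ht.2 (X ∩ S.A j) ⟨Finset.inter_subset_left, (isFaceSet_self N J X).inter h1⟩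
        (fun i => Finset.mem_inter.2 ⟨ht.1 i, htj i⟩)
      exact Finset.inter_eq_left.1 h2
    have hXold : X ⊆ S.W (J ∪ S.kids J t) := by
      intro v hv
      refine mem_W.2 ⟨(mem_W.1 (hX.subset hv)).1, fun j hj => ?_⟩
      rcases Finset.mem_union.1 hj with hj | hj
      · exact (mem_W.1 (hX.subset hv)).2 j hj
      · exact hkids j hj hv
    have hsub : S.W (J ∪ S.kids J t) ⊆ S.W J := W_anti Finset.subset_union_left
    have hlt : spanDim p X < spanDim p (S.W (J ∪ S.kids J t)) :=
      spanDim_lt_of_isFaceSet hb hp hsub (hX.isFaceSet.mono hsub) hX.nonempty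
        (Finset.ssubset_iff_subset_ne.2 ⟨hXold, fun h =>
          hnew _ (Finset.union_subset hJ (kids_subset_range t)) h.symm⟩)
    have hnewX : (S.addMark J X).W (J ∪ (S.addMark J X).kids J t) ⊆ X := by
      intro v hv
      have hmem : S.n ∈ (S.addMark J X).kids J t := mem_kids.2
        ⟨Nat.lt_succ_self _, by simp [addMark], fun i => by simpa [addMark] using ht.1 i⟩
      have := (mem_W.1 hv).2 S.n (Finset.mem_union_right _ hmem)
      simpa [addMark] using this
    have h3 : spanDim p ((S.addMark J X).W (J ∪ (S.addMark J X).kids J t)) + 1 ≤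
        spanDim p (S.W (J ∪ S.kids J t)) :=
      Nat.succ_le_of_lt (lt_of_le_of_lt (spanDim_mono hnewX) hlt)
    have h4 : ((spanDim p ((S.addMark J X).W (J ∪ (S.addMark J X).kids J t)) : ℝ) + 1) ≤
        spanDim p (S.W (J ∪ S.kids J t)) := by exact_mod_cast h3
    calc _ = (∏ i, (f (t i) : ℝ)) *
          ((spanDim p ((S.addMark J X).W (J ∪ (S.addMark J X).kids J t)) : ℝ) + 1) := by ring
      _ ≤ _ := mul_le_mul_of_nonneg_left h4 hw
  · rw [add_zero]
    refine mul_le_mul_of_nonneg_left ?_ hw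
    exact_mod_cast spanDim_mono (hmono t)

theorem Inv.addMark [Fintype V] [Fact p.Prime] {f : V → ℕ} {N : ℕ} {c ε : ℝ}
    (hS : S.Inv f (Module.finrank (ZMod p) V) N c)
    (hb : S.Bounded) (hε : 0 ≤ ε) (hε1 : ε ≤ 1)
    (hc : c ≤ (ε * (ε * weight f S.U)) ^ (Module.finrank (ZMod p) V + 1)) {J : Finset ℕ}
    (hJ : J ⊆ Finset.range S.n)
    (hp : ∀ T : Finset (Fin N → ℤ), T ⊆ intBox N (S.bound J) → IsCoprimeTo p T)
    {X : Finset V} (hX : S.IsLargeFaceSet f ε N J X)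
    (hnew : ∀ J' ⊆ Finset.range S.n, S.W J' ≠ X) :
    (S.addMark J X).Inv f (Module.finrank (ZMod p) V) N c := by
  set d := Module.finrank (ZMod p) V with hd
  have hpar : ∀ j < S.n, (S.addMark J X).par j = S.par j := fun j hj =>
    Function.update_of_ne hj.ne _ _
  have hdep : ∀ j < S.n, (S.addMark J X).dep j = S.dep j := fun j hj =>
    Function.update_of_ne hj.ne _ _
  have hparn : (S.addMark J X).par S.n = J := Function.update_self _ _ _
  have hdepn : (S.addMark J X).dep S.n = 1 + J.sup S.dep := Function.update_self _ _ _
  have hcase : ∀ j < (S.addMark J X).n, j < S.n ∨ j = S.n := fun j hj => by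
    have : j < S.n + 1 := hj
    omega
  have hlt : ∀ j ∈ J, j < S.n := fun j hj => Finset.mem_range.1 (hJ hj)
  have hnJ : S.n ∉ J := fun h => lt_irrefl _ (hlt _ h)
  have hparlt : ∀ j < S.n, S.n ∉ S.par j := fun j hj h => by
    have := hS.par_lt j hj _ h
    omega
  have hXne : X ≠ S.W J := fun h => hnew J hJ h.symm
  have hdim : spanDim p X < spanDim p (S.W J) :=
    spanDim_lt_of_isFaceSet hb hp subset_rfl hX.isFaceSet hX.nonempty
      (Finset.ssubset_iff_subset_ne.2 ⟨hX.subset, hXne⟩)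
  have hact : ∀ J' k, S.Active J' k →
      (S.addMark J X).Active J' k ∧ (S.addMark J X).ξ k = S.ξ k := fun J' k hk => ⟨hk, rfl⟩
  refine ⟨fun j hj i hi => ?_, fun j hj i hi => ?_, fun j hj => ?_, fun k hk => ?_, fun J' => ?_,
    fun J' => ?_, fun j hj => ?_, hS.supp⟩
  · rcases hcase j hj with h | rfl
    · rw [hpar j h] at hi
      exact hS.par_lt j h i hi
    · rw [hparn] at hi
      exact hlt i hi
  · rcases hcase j hj with h | rfl
    · rw [hpar j h] at hi
      rw [hdep j h, hdep i ((hS.par_lt j h i hi).trans h)]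
      exact hS.dep_lt j h i hi
    · rw [hparn] at hi
      rw [hdepn, hdep i (hlt i hi)]
      have := Finset.le_sup (f := S.dep) hi
      omega
  · rcases hcase j hj with h | rfl
    · rw [hdep j h, W_addMark (by simpa using h.ne')]
      exact hS.dep_le j h
    · rw [hdepn, W_addMark_singleton (hX.subset.trans (Finset.filter_subset _ _))]
      -- On the empty intersection the depth is `1`, paid for by the strict drop from the dimension
      -- of `W ∅`. Otherwise the deepest mark in `J` supplies the bound.
      rcases J.eq_empty_or_nonempty with rfl | hne
      · have := spanDim_le_finrank (p := p) (S.W ∅)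
        simp only [Finset.sup_empty, Nat.bot_eq_zero]
        omega
      · obtain ⟨i, hi, hsup⟩ := Finset.exists_mem_eq_sup J hne S.dep
        have h1 := hS.dep_le i (hlt i hi)
        have h2 : spanDim p (S.W J) ≤ spanDim p (S.W {i}) :=
          spanDim_mono (W_anti (Finset.singleton_subset_iff.2 hi))
        omega
  · exact (hS.fpar_subset k hk).trans (Finset.range_mono (Nat.le_succ _))
  -- If `J'` contains the new index, no function can have been attached to it yet.
  · by_cases hn : S.n ∈ J'
    · have h0 : ((Finset.range S.m).filter fun k => S.fpar k = J') = ∅ := by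
        refine Finset.filter_eq_empty_iff.2 fun k hk h => ?_
        have := hS.fpar_subset k (Finset.mem_range.1 hk) (h ▸ hn)
        simp at this
      have h1 : ((Finset.range (S.addMark J X).m).filter
          fun k => (S.addMark J X).fpar k = J').card = 0 := by
        exact Finset.card_eq_zero.2 h0
      rw [h1, zero_add]
      exact Submodule.finrank_le _
    · refine (Nat.add_le_add_left (Submodule.finrank_mono (fiberDir_mono (S := S) (J := J')
        (W_addMark hn).subset fun k hk => hact J' k hk)) _).trans (hS.functions J')
  · have hcard : ((Finset.range (S.addMark J X).n).filter
        fun j => (S.addMark J X).par j = J').card =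
        ((Finset.range S.n).filter fun j => S.par j = J').card + if J = J' then 1 else 0 := by
      convert card_filter_range_update S.n S.par J (· = J') <;> rfl
    rw [hcard]
    by_cases hn : S.n ∈ J'
    · have h0 : ((Finset.range S.n).filter fun j => S.par j = J') = ∅ :=
        Finset.filter_eq_empty_iff.2 fun j hj h => hparlt j (Finset.mem_range.1 hj) (h ▸ hn)
      have h1 : J ≠ J' := by rintro rfl; exact hnJ hn
      rw [h0, if_neg h1]
      simpa using potential_le f J'
    · by_cases h : J = J'
      · subst h
        rw [if_pos rfl]
        have h1 := potential_addMark_le hS hb hε hε1 hJ hp hX hnew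
        have h2 := hS.marks J
        push_cast
        linarith
      · rw [if_neg h, add_zero]
        refine le_trans (le_of_eq ?_) (hS.marks J')
        congr 1
        refine Finset.sum_congr rfl fun t _ => ?_
        rw [kids_addMark_of_ne h, W_addMark]
        intro hmem
        rcases Finset.mem_union.1 hmem with h' | h'
        · exact hn h'
        · simpa using kids_subset_range t h'
  · rcases hcase j hj with h | rfl
    · have hA : (S.addMark J X).A j = S.A j := Function.update_of_ne h.ne _ _
      rw [hpar j h, hA, W_addMark (hparlt j h)]
      exact (hS.faces j h).congr (hact _)
    · have hA : (S.addMark J X).A S.n = X := Function.update_self _ _ _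
      rw [hparn, hA, W_addMark hnJ]
      exact hX.isFaceSet.congr (hact _)

theorem Bounded.addMark (hb : S.Bounded) {J : Finset ℕ} {X : Finset V}
    (hf : ∀ k < S.m, S.fpar k ⊆ Finset.range S.n) : (S.addMark J X).Bounded := by
  intro k hk v hv
  rw [W_addMark] at hv
  · exact hb k hk v hv
  · intro h
    simpa using hf k hk h

/-! ### The number of marks and functions -/

/-- A bound for the number of marks of depth at most `k`, if no more than `C` marks are placed on
the same intersection. -/
def markBound (C : ℕ) : ℕ → ℕ
  | 0 => C
  | k + 1 => C * 2 ^ markBound C k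

/-- A mark of depth at most `k + 1` is placed on a set of marks of depth at most `k`. This leaves `2
^ markBound C k` possible parents, with at most `C` marks each. -/
theorem card_marks_le {n C : ℕ} {par : ℕ → Finset ℕ} {dep : ℕ → ℕ}
    (hpar : ∀ j < n, ∀ i ∈ par j, i < j) (hdep : ∀ j < n, ∀ i ∈ par j, dep i < dep j)
    (hC : ∀ J, ((Finset.range n).filter fun j => par j = J).card ≤ C) (k : ℕ) :
    ((Finset.range n).filter fun j => dep j ≤ k).card ≤ markBound C k := by
  induction k with
  | zero =>
    refine le_trans (Finset.card_le_card fun j hj => ?_) (hC ∅)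
    simp only [Finset.mem_filter, Finset.mem_range] at hj ⊢
    refine ⟨hj.1, Finset.eq_empty_of_forall_notMem fun i hi => ?_⟩
    have := hdep j hj.1 i hi
    omega
  | succ k ih =>
    have h1 := Finset.card_le_mul_card_image_of_maps_to (f := par)
      (s := (Finset.range n).filter fun j => dep j ≤ k + 1)
      (t := ((Finset.range n).filter fun j => dep j ≤ k).powerset) (fun j hj => by
        simp only [Finset.mem_filter, Finset.mem_range, Finset.mem_powerset] at hj ⊢
        intro i hi
        have h1 := hpar j hj.1 i hi
        have h2 := hdep j hj.1 i hi
        simp only [Finset.mem_filter, Finset.mem_range]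
        omega) C (fun J _ => by
          refine le_trans (Finset.card_le_card ?_) (hC J)
          exact Finset.filter_subset_filter _ (Finset.filter_subset _ _))
    rw [Finset.card_powerset] at h1
    exact h1.trans (Nat.mul_le_mul_left _ (Nat.pow_le_pow_right two_pos ih))

/-- A bound for the number of marks and functions of a system. -/
def sizeBound (d C : ℕ) : ℕ := markBound C d + 2 ^ markBound C d * d

theorem Inv.n_le [Fintype V] {f : V → ℕ} {d N C : ℕ} {c : ℝ} (hS : S.Inv f d N c) (hc : 0 < c)
    (hC : d * weight f Finset.univ ^ (d + 1) ≤ C * c) : S.n ≤ markBound C d := by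
  have h1 : ∀ J, ((Finset.range S.n).filter fun j => S.par j = J).card ≤ C := fun J => by
    have h2 := hS.marks J
    have h3 : 0 ≤ S.potential f d J := Finset.sum_nonneg fun t _ =>
      mul_nonneg (Finset.prod_nonneg fun _ _ => Nat.cast_nonneg _) (Nat.cast_nonneg _)
    have h4 : (((Finset.range S.n).filter fun j => S.par j = J).card : ℝ) * c ≤ C * c := by
      linarith
    exact_mod_cast le_of_mul_le_mul_right h4 hc
  refine le_trans (le_of_eq ?_) (card_marks_le hS.par_lt hS.dep_lt h1 d)
  rw [Finset.filter_true_of_mem, Finset.card_range]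
  intro j hj
  exact (Nat.le_add_right _ _).trans (hS.dep_le j (Finset.mem_range.1 hj))

theorem Inv.size_le [Fintype V] {f : V → ℕ} {d N C : ℕ} {c : ℝ} (hS : S.Inv f d N c) (hc : 0 < c)
    (hC : d * weight f Finset.univ ^ (d + 1) ≤ C * c) : S.n + S.m ≤ sizeBound d C := by
  have hn := hS.n_le hc hC
  refine Nat.add_le_add hn ?_
  have h1 := Finset.card_le_mul_card_image_of_maps_to (f := S.fpar) (s := Finset.range S.m)
    (t := (Finset.range S.n).powerset) (fun k hk =>
      Finset.mem_powerset.2 (hS.fpar_subset k (Finset.mem_range.1 hk))) d (fun J _ =>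
      (Nat.le_add_right _ _).trans (hS.functions J))
  rw [Finset.card_range, Finset.card_powerset, Finset.card_range, mul_comm] at h1
  exact h1.trans (Nat.mul_le_mul_right _ (Nat.pow_le_pow_right two_pos hn))

end MarkSystem

/-! ### Sizes of the attached functions -/

theorem abs_valMinAbs_le_of_eq_intCast {p : ℕ} [NeZero p] {x : ZMod p} {k : ℤ} (h : x = k) :
    |x.valMinAbs| ≤ |k| := by
  rw [Int.abs_eq_natAbs, Int.abs_eq_natAbs]
  exact_mod_cast ZMod.natAbs_min_of_le_div_two p _ _ (by rw [ZMod.coe_valMinAbs, h])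
    (ZMod.natAbs_valMinAbs_le x)

/-- The successive bounds for the sizes of the functions attached to a system. -/
def sizeSeq (g : ℕ → ℕ) (N : ℕ) : ℕ → ℕ
  | 0 => 0
  | s + 1 => max (sizeSeq g N s) (g (boxBound N (sizeSeq g N s)))

theorem sizeSeq_mono (g : ℕ → ℕ) (N : ℕ) : Monotone (sizeSeq g N) :=
  monotone_nat_of_le_succ fun _ => le_max_left _ _

namespace MarkSystem

variable {p : ℕ} {V : Type*} [AddCommGroup V] [Module (ZMod p) V] {S : MarkSystem p V}

/-! ### Removing fibers of small weight -/

/-- The fiber of the point under `v` over the set of `J`. -/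
def fiberSet (S : MarkSystem p V) (N : ℕ) (J : Finset ℕ) (v : V) : Finset V :=
  (S.W J).filter fun w => liftVec (S.η N J) w = liftVec (S.η N J) v

/-- Take `U'` maximising its weight minus `θ J` for every point occupied over every `J`. Deleting a
fiber lighter than `θ J` would vacate a point over `J`, occupy no new ones and thus raise the score.
Comparison with `U` itself bounds the loss for all `J` at once, although deletions over one `J`
affect the fibers over others. -/
theorem exists_restrict_gap (S : MarkSystem p V) (f : V → ℕ) (N : ℕ) (θ : Finset ℕ → ℝ)
    (hθ : ∀ J, 0 ≤ θ J) : ∃ U' ⊆ S.U,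
      (∀ J ⊆ Finset.range S.n, ∀ v ∈ (S.restrict U').W J,
        θ J ≤ weight f ((S.restrict U').fiberSet N J v)) ∧
      weight f S.U - ∑ J ∈ (Finset.range S.n).powerset,
        ((liftImage (S.η N J) (S.W J)).card : ℝ) * θ J ≤ weight f U' := by
  let score : Finset V → ℝ := fun U' => weight f U' - ∑ J ∈ (Finset.range S.n).powerset,
    ((liftImage (S.η N J) ((S.restrict U').W J)).card : ℝ) * θ J
  obtain ⟨U', hU', hmax⟩ := Finset.exists_max_image S.U.powerset score
    ⟨S.U, Finset.mem_powerset_self _⟩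
  rw [Finset.mem_powerset] at hU'
  refine ⟨U', hU', fun J hJ v hv => ?_, ?_⟩
  · set F := (S.restrict U').fiberSet N J v
    have hFU : F ⊆ U' := (Finset.filter_subset _ _).trans (Finset.filter_subset _ _)
    have h1 := hmax (U' \ F) (Finset.mem_powerset.2 (Finset.sdiff_subset.trans hU'))
    have hW : ∀ J', (S.restrict (U' \ F)).W J' ⊆ (S.restrict U').W J' := fun J' =>
      W_restrict (S := S.restrict U') Finset.sdiff_subset J'
    have hsum : ∑ J' ∈ (Finset.range S.n).powerset,
        ((liftImage (S.η N J') ((S.restrict (U' \ F)).W J')).card : ℝ) * θ J' +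
        ∑ J' ∈ (Finset.range S.n).powerset, (if J' = J then θ J else 0) ≤
        ∑ J' ∈ (Finset.range S.n).powerset,
        ((liftImage (S.η N J') ((S.restrict U').W J')).card : ℝ) * θ J' := by
      rw [← Finset.sum_add_distrib]
      refine Finset.sum_le_sum fun J' _ => ?_
      split_ifs with h
      · subst h
        have hlt : (liftImage (S.η N J') ((S.restrict (U' \ F)).W J')).card + 1 ≤
            (liftImage (S.η N J') ((S.restrict U').W J')).card := by
          refine Finset.card_lt_card (Finset.ssubset_iff_subset_ne.2
            ⟨Finset.image_subset_image (hW J'), fun heq => ?_⟩)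
          have hmem : liftVec (S.η N J') v ∈ liftImage (S.η N J') ((S.restrict U').W J') :=
            liftVec_mem_liftImage _ hv
          rw [← heq] at hmem
          obtain ⟨w, hw, hwv⟩ := Finset.mem_image.1 hmem
          have hwF : w ∈ F := Finset.mem_filter.2 ⟨hW J' hw, hwv⟩
          exact (Finset.mem_sdiff.1 (mem_W.1 hw).1).2 hwF
        have hlt' : ((liftImage (S.η N J') ((S.restrict (U' \ F)).W J')).card : ℝ) + 1 ≤
            (liftImage (S.η N J') ((S.restrict U').W J')).card := by exact_mod_cast hlt
        have := mul_le_mul_of_nonneg_right hlt' (hθ J')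
        linarith
      · rw [add_zero]
        refine mul_le_mul_of_nonneg_right ?_ (hθ J')
        exact_mod_cast Finset.card_le_card (Finset.image_subset_image (hW J'))
    rw [Finset.sum_ite_eq', if_pos (Finset.mem_powerset.2 hJ)] at hsum
    have h2 := weight_sdiff f hFU
    dsimp only [score] at h1
    linarith
  · have h1 := hmax S.U (Finset.mem_powerset_self _)
    have h2 : 0 ≤ ∑ J ∈ (Finset.range S.n).powerset,
        ((liftImage (S.η N J) ((S.restrict U').W J)).card : ℝ) * θ J :=
      Finset.sum_nonneg fun J _ => mul_nonneg (Nat.cast_nonneg _) (hθ J)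
    have h3 : score U' ≤ weight f U' := by dsimp only [score]; linarith
    exact h1.trans h3

/-- As `(2 K + 1) / (2 K) ≤ 3 / 2`, the factor `(2 K) ^ (-d)` in the threshold makes the total cost
of the deletions over one `J` independent of `K`. -/
theorem card_mul_zpow_le {K d : ℕ} (hK : 1 ≤ K) {a : ℕ} (ha : a ≤ (2 * K + 1) ^ d) :
    (a : ℝ) * (2 * (K : ℝ)) ^ (-(d : ℤ)) ≤ (3 / 2) ^ d := by
  have hK' : (1 : ℝ) ≤ K := by exact_mod_cast hK
  have hpos : (0 : ℝ) < (2 * (K : ℝ)) ^ d := by positivity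
  rw [zpow_neg, zpow_natCast, ← div_eq_mul_inv, div_le_iff₀ hpos, ← mul_pow]
  calc (a : ℝ) ≤ (2 * K + 1) ^ d := by exact_mod_cast ha
    _ ≤ _ := pow_le_pow_left₀ (by positivity) (by linarith) d

/-- The threshold for the weight of the fibers over the set of `J`. -/
def threshold (S : MarkSystem p V) (N d : ℕ) (δ T : ℝ) (J : Finset ℕ) : ℝ :=
  δ ^ 3 * (2 * (S.coordSize N J : ℝ)) ^ (-(d : ℤ)) * T

theorem threshold_nonneg (S : MarkSystem p V) (N d : ℕ) {δ T : ℝ} (hδ : 0 ≤ δ) (hT : 0 ≤ T)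
    (J : Finset ℕ) : 0 ≤ S.threshold N d δ T J := by
  unfold threshold
  positivity

theorem Bounded.sum_card_mul_threshold_le [Fact p.Prime] [Finite V] (hb : S.Bounded) {N : ℕ}
    (hp : ∀ J, ∀ T : Finset (Fin N → ℤ), T ⊆ intBox N (S.bound J) → IsCoprimeTo p T) {δ T : ℝ}
    (hδ : 0 ≤ δ) (hT : 0 ≤ T) :
    ∑ J ∈ (Finset.range S.n).powerset, ((liftImage (S.η N J) (S.W J)).card : ℝ) *
      S.threshold N (Module.finrank (ZMod p) V) δ T J ≤
      2 ^ S.n * ((3 / 2) ^ Module.finrank (ZMod p) V * δ ^ 3 * T) := by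
  set d := Module.finrank (ZMod p) V
  have hJ : ∀ J ∈ (Finset.range S.n).powerset, ((liftImage (S.η N J) (S.W J)).card : ℝ) *
      S.threshold N d δ T J ≤ (3 / 2) ^ d * δ ^ 3 * T := fun J _ => by
    rcases (S.W J).eq_empty_or_nonempty with h | h
    · rw [h]
      simp only [liftImage, Finset.image_empty, Finset.card_empty, Nat.cast_zero, zero_mul]
      positivity
    · have hsub := hb.liftImage_subset N J subset_rfl
      have h1 := card_mul_zpow_le (one_le_boxBound N (S.bound J))
        (card_liftImage_le h (hp J _ hsub) hsub)
      have h2 := mul_le_mul_of_nonneg_right h1 (show 0 ≤ δ ^ 3 * T by positivity)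
      unfold threshold coordSize
      linarith
  refine (Finset.sum_le_card_nsmul _ _ _ hJ).trans (le_of_eq ?_)
  rw [Finset.card_powerset, Finset.card_range, nsmul_eq_mul]
  push_cast
  ring

/-! ### Existence of complete systems -/

/-- The points of the set of `J` at which `ζ` is at most `K` in absolute value. -/
def slabSet (S : MarkSystem p V) (J : Finset ℕ) (ζ : V →ᵃ[ZMod p] ZMod p) (K : ℕ) : Finset V :=
  (S.W J).filter fun v => ∃ k : ℤ, |k| ≤ (K : ℤ) ∧ ζ v = (k : ZMod p)

/-- The conditions on the systems that occur in the construction of a complete one. -/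
structure IsAdmissible [Fintype V] (S : MarkSystem p V) (f : V → ℕ) (g : ℕ → ℕ) (N : ℕ)
    (c δ : ℝ) : Prop where
  inv : S.Inv f (Module.finrank (ZMod p) V) N c
  bounded : S.Bounded
  b_le : ∀ k < S.m, S.b k ≤ sizeSeq g N (S.n + S.m)
  weight_le : weight f Finset.univ - (S.n + S.m : ℕ) * (2 * δ * weight f Finset.univ) ≤
    weight f S.U

/-- The conditions on a system from which a flag decomposition is obtained. -/
structure IsCompleteSystem [Fintype V] (S : MarkSystem p V) (f : V → ℕ) (g : ℕ → ℕ) (N : ℕ)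
    (ε δ : ℝ) : Prop where
  n_le : S.n ≤ N
  m_le : S.m ≤ N
  supp : ∀ v ∈ S.U, f v ≠ 0
  bounded : S.Bounded
  bound_le : ∀ J, S.bound J ≤ sizeSeq g N N
  sharp : (1 - ε) * weight f Finset.univ ≤ weight f S.U
  thick : ∀ J ⊆ Finset.range S.n, ∀ ζ : V →ᵃ[ZMod p] ZMod p,
    (∃ v ∈ affineSpan (ZMod p) (S.W J : Set V), ∃ w ∈ affineSpan (ZMod p) (S.W J : Set V),
      (∀ k, S.Active J k → S.ξ k v = S.ξ k w) ∧ ζ v ≠ ζ w) →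
    weight f (S.slabSet J ζ (g (S.coordSize N J))) < (1 - δ) * weight f (S.W J)
  faces : ∀ J ⊆ Finset.range S.n, ∀ X, S.IsLargeFaceSet f ε N J X →
    ∃ J' ⊆ Finset.range S.n, S.W J' = X
  gap : ∀ J ⊆ Finset.range S.n, ∀ v ∈ S.W J,
    S.threshold N (Module.finrank (ZMod p) V) δ (weight f Finset.univ) J ≤
      weight f (S.fiberSet N J v)

theorem bound_le_of_b_le {s : ℕ} (h : ∀ k < S.m, S.b k ≤ s) (J : Finset ℕ) : S.bound J ≤ s :=
  Finset.sup_le fun k hk => h k (Finset.mem_range.1 (Finset.mem_filter.1 hk).1)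

theorem exists_addFunction [Fintype V] [Fact p.Prime] {f : V → ℕ} {g : ℕ → ℕ} (hg : Monotone g)
    {N : ℕ} {c δ : ℝ} (hδ : 0 ≤ δ) (hinv : S.Inv f (Module.finrank (ZMod p) V) N c)
    (hb : S.Bounded) (hble : ∀ k < S.m, S.b k ≤ sizeSeq g N (S.n + S.m))
    (hw : weight f Finset.univ - (S.n + S.m : ℕ) * (2 * δ * weight f Finset.univ) -
      δ * weight f Finset.univ ≤ weight f S.U) {J : Finset ℕ} (hJ : J ⊆ Finset.range S.n)
    {ζ : V →ᵃ[ZMod p] ZMod p}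
    (hζ : ∃ v ∈ affineSpan (ZMod p) (S.W J : Set V), ∃ w ∈ affineSpan (ZMod p) (S.W J : Set V),
      (∀ k, S.Active J k → S.ξ k v = S.ξ k w) ∧ ζ v ≠ ζ w)
    (hthin : (1 - δ) * weight f (S.W J) ≤
      weight f (S.slabSet J ζ (g (S.coordSize N J)))) :
    ∃ S' : MarkSystem p V, S'.IsAdmissible f g N c δ ∧ S'.n + S'.m = S.n + S.m + 1 := by
  set K := g (S.coordSize N J) with hK
  -- Only points of `W J` outside the slab are removed, of total weight at most `δ` times that of `W
  -- J`.
  set U' := S.U \ (S.W J \ S.slabSet J ζ K) with hU'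
  have hU'sub : U' ⊆ S.U := Finset.sdiff_subset
  refine ⟨(S.addFunction J ζ K).restrict U', ⟨?_, ?_, ?_, ?_⟩, ?_⟩
  · refine Inv.restrict (hinv.addFunction hJ ?_) hU'sub
    obtain ⟨v, hv, w, hw, hvw, hne⟩ := hζ
    refine ⟨v -ᵥ w, mem_fiberDir.2 ⟨?_, fun k hk => ?_⟩, ?_⟩
    · rw [← direction_affineSpan]
      exact AffineSubspace.vsub_mem_direction hv hw
    · rw [AffineMap.linearMap_vsub, hvw k hk, vsub_self]
    · rw [AffineMap.linearMap_vsub, vsub_eq_sub]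
      exact sub_ne_zero.2 hne
  · intro k hk v hv
    obtain ⟨hvU, hvA⟩ := mem_W.1 hv
    by_cases hkm : k = S.m
    · subst hkm
      have hξ : (S.addFunction J ζ K).ξ S.m = ζ := Function.update_self _ _ _
      have hfp : (S.addFunction J ζ K).fpar S.m = J := Function.update_self _ _ _
      have hbm : (S.addFunction J ζ K).b S.m = K := Function.update_self _ _ _
      change |((S.addFunction J ζ K).ξ S.m v).valMinAbs| ≤ ((S.addFunction J ζ K).b S.m : ℤ)
      rw [hξ, hbm]
      have hvW : v ∈ S.W J := mem_W.2 ⟨hU'sub hvU, fun j hj => hvA j (by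
        change j ∈ (S.addFunction J ζ K).fpar S.m
        rwa [hfp])⟩
      have hslab : v ∈ S.slabSet J ζ K := by
        by_contra h
        exact (Finset.mem_sdiff.1 (show v ∈ S.U \ _ from hvU)).2 (Finset.mem_sdiff.2 ⟨hvW, h⟩)
      obtain ⟨i, hi, hi'⟩ := (Finset.mem_filter.1 hslab).2
      exact (abs_valMinAbs_le_of_eq_intCast hi').trans hi
    · have hk' : k < S.m := lt_of_le_of_ne (Nat.lt_succ_iff.1 hk) hkm
      have hξ : (S.addFunction J ζ K).ξ k = S.ξ k := Function.update_of_ne hkm _ _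
      have hfp : (S.addFunction J ζ K).fpar k = S.fpar k := Function.update_of_ne hkm _ _
      have hbk : (S.addFunction J ζ K).b k = S.b k := Function.update_of_ne hkm _ _
      change |((S.addFunction J ζ K).ξ k v).valMinAbs| ≤ ((S.addFunction J ζ K).b k : ℤ)
      rw [hξ, hbk]
      refine hb k hk' v (mem_W.2 ⟨hU'sub hvU, fun j hj => hvA j ?_⟩)
      change j ∈ (S.addFunction J ζ K).fpar k
      rwa [hfp]
  · intro k hk
    change (S.addFunction J ζ K).b k ≤ sizeSeq g N (S.n + S.m + 1)
    by_cases hkm : k = S.m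
    · subst hkm
      have hbm : (S.addFunction J ζ K).b S.m = K := Function.update_self _ _ _
      rw [hbm]
      exact (hg (boxBound_mono N (bound_le_of_b_le hble J))).trans (le_max_right _ _)
    · have hk' : k < S.m := lt_of_le_of_ne (Nat.lt_succ_iff.1 hk) hkm
      have hbk : (S.addFunction J ζ K).b k = S.b k := Function.update_of_ne hkm _ _
      rw [hbk]
      exact (hble k hk').trans (le_max_left _ _)
  · change weight f Finset.univ - (S.n + (S.m + 1) : ℕ) * (2 * δ * weight f Finset.univ) ≤
      weight f U'
    have h1 : weight f U' = weight f S.U - weight f (S.W J \ S.slabSet J ζ K) :=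
      weight_sdiff f (Finset.sdiff_subset.trans (Finset.filter_subset _ _))
    have h2 : weight f (S.W J \ S.slabSet J ζ K) =
        weight f (S.W J) - weight f (S.slabSet J ζ K) := weight_sdiff f (Finset.filter_subset _ _)
    have h3 : δ * weight f (S.W J) ≤ δ * weight f Finset.univ :=
      mul_le_mul_of_nonneg_left (weight_mono f (Finset.subset_univ _)) hδ
    push_cast at hw ⊢
    linarith
  · rfl

theorem exists_addMark [Fintype V] [Fact p.Prime] {f : V → ℕ} {g : ℕ → ℕ}
    {N : ℕ} {c δ ε : ℝ} (hδ : 0 ≤ δ) (hε : 0 ≤ ε) (hε1 : ε ≤ 1)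
    (hinv : S.Inv f (Module.finrank (ZMod p) V) N c)
    (hb : S.Bounded) (hble : ∀ k < S.m, S.b k ≤ sizeSeq g N (S.n + S.m))
    (hw : weight f Finset.univ - (S.n + S.m : ℕ) * (2 * δ * weight f Finset.univ) -
      δ * weight f Finset.univ ≤ weight f S.U)
    (hc : c ≤ (ε * (ε * weight f S.U)) ^ (Module.finrank (ZMod p) V + 1))
    {J : Finset ℕ} (hJ : J ⊆ Finset.range S.n)
    (hp : ∀ T : Finset (Fin N → ℤ), T ⊆ intBox N (S.bound J) → IsCoprimeTo p T)
    {X : Finset V} (hX : S.IsLargeFaceSet f ε N J X)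
    (hnew : ∀ J' ⊆ Finset.range S.n, S.W J' ≠ X) :
    ∃ S' : MarkSystem p V, S'.IsAdmissible f g N c δ ∧ S'.n + S'.m = S.n + S.m + 1 := by
  have hnm : (S.addMark J X).n + (S.addMark J X).m = S.n + S.m + 1 := by
    change S.n + 1 + S.m = _
    omega
  refine ⟨S.addMark J X, ⟨hinv.addMark hb hε hε1 hc hJ hp hX hnew,
    hb.addMark hinv.fpar_subset, fun k hk => ?_, ?_⟩, hnm⟩
  · rw [hnm]
    exact (hble k hk).trans (le_max_left _ _)
  · rw [hnm]
    change _ ≤ weight f S.U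
    have := mul_nonneg hδ (weight_nonneg f Finset.univ)
    push_cast at hw ⊢
    linarith

variable (p V) in
/-- The system without marks and functions. -/
def initial (U : Finset V) : MarkSystem p V where
  n := 0
  m := 0
  U := U
  A _ := ∅
  par _ := ∅
  dep _ := 0
  ξ _ := 0
  fpar _ := ∅
  b _ := 0

theorem isAdmissible_initial [Fintype V] [Fact p.Prime] (f : V → ℕ) (g : ℕ → ℕ) (N : ℕ)
    (c δ : ℝ) :
    (initial p V (Finset.univ.filter fun v => f v ≠ 0)).IsAdmissible f g N c δ where
  inv :=
    { par_lt := fun _ h => absurd h (Nat.not_lt_zero _)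
      dep_lt := fun _ h => absurd h (Nat.not_lt_zero _)
      dep_le := fun _ h => absurd h (Nat.not_lt_zero _)
      fpar_subset := fun _ h => absurd h (Nat.not_lt_zero _)
      functions := fun J => by
        refine (Nat.add_le_add_right (le_of_eq (Finset.card_eq_zero.2
          (Finset.filter_eq_empty_iff.2 fun k hk =>
            absurd (Finset.mem_range.1 hk) (Nat.not_lt_zero k)))) _).trans ?_
        rw [zero_add]
        exact Submodule.finrank_le _
      marks := fun J => by
        have := potential_le (S := initial p V (Finset.univ.filter fun v => f v ≠ 0)) f J
        simpa [initial] using this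
      faces := fun _ h => absurd h (Nat.not_lt_zero _)
      supp := fun v hv => (Finset.mem_filter.1 hv).2 }
  bounded := fun _ h => absurd h (Nat.not_lt_zero _)
  b_le := fun _ h => absurd h (Nat.not_lt_zero _)
  weight_le := by
    have : weight f (Finset.univ.filter fun v => f v ≠ 0) = weight f Finset.univ :=
      Finset.sum_filter_of_ne fun v _ h => by exact_mod_cast h
    simp [initial, this]

/-- If no system were complete, every admissible one could be corrected, giving admissible systems
of every size, against the size bound `N`. -/
theorem exists_isCompleteSystem [Fintype V] [Fact p.Prime] {f : V → ℕ} (hf : f ≠ 0) {g : ℕ → ℕ}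
    (hg : Monotone g) {d N C : ℕ} {δ ε : ℝ} (hd : Module.finrank (ZMod p) V = d) (hδ : 0 < δ)
    (hε : 0 < ε) (hε1 : ε ≤ 1 / 2) (hC : d ≤ C * (ε * (ε / 2)) ^ (d + 1))
    (hN : N = sizeBound d C) (hδN : (2 * N + 1) * δ ≤ ε) (hδ2 : 2 ^ N * (3 / 2) ^ d * δ ^ 2 ≤ 1)
    (hp : primeBound N (sizeSeq g N N) < p) :
    ∃ S : MarkSystem p V, S.IsCompleteSystem f g N ε δ := by
  subst hd
  set d := Module.finrank (ZMod p) V with hd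
  set T := weight f Finset.univ with hT
  have hTpos : 0 < T := by
    obtain ⟨v, hv⟩ := Function.ne_iff.1 hf
    refine Finset.sum_pos' (fun _ _ => Nat.cast_nonneg _) ⟨v, Finset.mem_univ _, ?_⟩
    exact_mod_cast Nat.pos_of_ne_zero hv
  -- Since `ε ≤ 1 / 2`, the working set always keeps weight at least `T / 2`, so `c` is a lower
  -- bound for the drop of the potential at every stage.
  set c := (ε * (ε * (T / 2))) ^ (d + 1) with hc
  have hcpos : 0 < c := by positivity
  have hCc : d * T ^ (d + 1) ≤ C * c := by
    have : c = (ε * (ε / 2)) ^ (d + 1) * T ^ (d + 1) := by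
      rw [hc, ← mul_pow]; congr 1; ring
    rw [this, ← mul_assoc]
    exact mul_le_mul_of_nonneg_right hC (by positivity)
  by_contra hno
  have hall : ∀ s, ∃ S : MarkSystem p V, S.IsAdmissible f g N c δ ∧ S.n + S.m = s := by
    intro s
    induction s with
    | zero => exact ⟨_, isAdmissible_initial f g N c δ, rfl⟩
    | succ s ih =>
      obtain ⟨S, hS, hs⟩ := ih
      have hsize : S.n + S.m ≤ N := hN ▸ hS.inv.size_le hcpos hCc
      have hbound : ∀ J, S.bound J ≤ sizeSeq g N N := fun J =>
        (bound_le_of_b_le hS.b_le J).trans (sizeSeq_mono g N hsize)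
      have hcop : ∀ J, ∀ T : Finset (Fin N → ℤ), T ⊆ intBox N (S.bound J) → IsCoprimeTo p T :=
        fun J T hT => isCoprimeTo_of_primeBound_lt Fact.out hp (hT.trans (intBox_mono (hbound J)))
      -- Cleaning comes before the test for completeness, so a system needing no correction already
      -- has the gap. It costs at most `δ T`, as does attaching a function: hence `2 δ T` per
      -- correction.
      obtain ⟨U', hU', hgap, hloss⟩ := S.exists_restrict_gap f N (S.threshold N d δ T)
        (S.threshold_nonneg N d hδ.le hTpos.le)
      have hloss' : weight f S.U - δ * T ≤ weight f U' := by
        have h1 := hS.bounded.sum_card_mul_threshold_le hcop hδ.le hTpos.le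
        have h2 : (2 : ℝ) ^ S.n * ((3 / 2) ^ d * δ ^ 3 * T) ≤ δ * T := by
          have h3 : (2 : ℝ) ^ S.n ≤ 2 ^ N := pow_le_pow_right₀ one_le_two (by omega)
          calc (2 : ℝ) ^ S.n * ((3 / 2) ^ d * δ ^ 3 * T) ≤ 2 ^ N * ((3 / 2) ^ d * δ ^ 3 * T) :=
                mul_le_mul_of_nonneg_right h3 (by positivity)
            _ = (2 ^ N * (3 / 2) ^ d * δ ^ 2) * (δ * T) := by ring
            _ ≤ 1 * (δ * T) := mul_le_mul_of_nonneg_right hδ2 (by positivity)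
            _ = δ * T := one_mul _
        linarith
      have hweight : T - (S.n + S.m : ℕ) * (2 * δ * T) - δ * T ≤ weight f U' := by
        have := hS.weight_le
        linarith
      have hsharp : (1 - ε) * T ≤ weight f U' := by
        refine le_trans ?_ hweight
        have h1 : ((S.n + S.m : ℕ) : ℝ) ≤ N := by exact_mod_cast hsize
        have h2 : (((S.n + S.m : ℕ) : ℝ) * 2 + 1) * δ ≤ ε := by
          refine le_trans (mul_le_mul_of_nonneg_right ?_ hδ.le) hδN
          linarith
        have h3 := mul_le_mul_of_nonneg_right h2 hTpos.le
        linarith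
      set R := S.restrict U' with hR
      have hRinv : R.Inv f d N c := hS.inv.restrict hU'
      have hRb : R.Bounded := hS.bounded.restrict hU'
      by_contra hstep
      have hstep' : ¬ ∃ S' : MarkSystem p V, S'.IsAdmissible f g N c δ ∧
          S'.n + S'.m = R.n + R.m + 1 := by
        intro h
        obtain ⟨S', h1, h2⟩ := h
        exact hstep ⟨S', h1, by rw [h2, ← hs]; rfl⟩
      refine hno ⟨R, ?_⟩
      refine ⟨?_, ?_, hRinv.supp, hRb, hbound, hsharp, fun J hJ ζ hζ => ?_, fun J hJ X hX => ?_,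
        hgap⟩
      · exact (Nat.le_add_right _ _).trans hsize
      · exact (Nat.le_add_left _ _).trans hsize
      · by_contra h
        exact hstep' (exists_addFunction hg hδ.le hRinv hRb hS.b_le hweight hJ hζ (not_lt.1 h))
      · by_contra! h
        refine hstep' (exists_addMark hδ.le hε.le (by linarith) hRinv hRb hS.b_le hweight ?_ hJ
          (hcop J) hX h)
        refine pow_le_pow_left₀ (by positivity) ?_ _
        have : T / 2 ≤ weight f R.U := by
          refine le_trans ?_ hsharp
          have := mul_le_mul_of_nonneg_right hε1 hTpos.le
          linarith
        gcongr
  obtain ⟨S, hS, hs⟩ := hall (N + 1)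
  have : S.n + S.m ≤ N := hN ▸ hS.inv.size_le hcpos hCc
  omega

end MarkSystem

/-! ### The flag decomposition of a system of marked subsets -/

/-- A rational affine map sends integral affine spans to integral affine spans. -/
theorem affineMap_mem_affineSpan_int {a b : ℕ} (A : QSpace a →ᵃ[ℚ] QSpace b) {s : Set (QSpace a)}
    {t : Set (QSpace b)} (h : ∀ q ∈ s, A q ∈ t) {q : QSpace a} (hq : q ∈ affineSpan ℤ s) :
    A q ∈ affineSpan ℤ t := by
  refine affineSpan_induction hq (fun q hq => subset_affineSpan ℤ _ (h q hq))
    (fun c u v w hu hv hw => ?_)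
  have : A (c • (u -ᵥ v) +ᵥ w) = c • (A u -ᵥ A v) +ᵥ A w := by
    rw [A.map_vadd, map_zsmul, A.linearMap_vsub]
  rw [this]
  exact AffineSubspace.smul_vsub_vadd_mem _ _ hu hv hw

theorem mass_ite {V : Type*} [Fintype V] (f : V → ℕ) (X : Finset V) (Q : Set V) :
    mass (fun v => if v ∈ X then f v else 0) Q = ∑ v ∈ X with v ∈ Q, f v := by
  unfold mass
  rw [Finset.sum_filter, ← Finset.sum_filter_add_sum_filter_not Finset.univ (· ∈ X)]
  have h0 : ∑ v with v ∉ X, Q.indicator (fun v => if v ∈ X then f v else 0) v = 0 := by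
    refine Finset.sum_eq_zero fun v hv => ?_
    have := (Finset.mem_filter.1 hv).2
    simp [Set.indicator_apply, this]
  rw [h0, add_zero, Finset.filter_mem_eq_inter, Finset.univ_inter]
  refine Finset.sum_congr rfl fun v hv => ?_
  simp [Set.indicator_apply, hv]

namespace MarkSystem

variable {p : ℕ} {V : Type*} [AddCommGroup V] [Module (ZMod p) V] (S : MarkSystem p V)

/-- The sets of marks that consist of all marks containing a given non-empty intersection. -/
def closedSets : Finset (Finset ℕ) :=
  (Finset.range S.n).powerset.filter fun J =>
    (S.W J).Nonempty ∧ ∀ j < S.n, S.W J ⊆ S.A j → j ∈ J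

/-- The poset of closed sets of marks, ordered by reverse inclusion. -/
abbrev Member : Type := {J : (Finset ℕ)ᵒᵈ // OrderDual.ofDual J ∈ S.closedSets}

variable {S}

/-- The marks of an element of the poset. -/
def Member.set (x : S.Member) : Finset ℕ := OrderDual.ofDual x.1

/-- The element of the poset given by a closed set of marks. -/
def Member.mk (J : Finset ℕ) (hJ : J ∈ S.closedSets) : S.Member := ⟨OrderDual.toDual J, hJ⟩

theorem mem_closedSets {J : Finset ℕ} : J ∈ S.closedSets ↔ J ⊆ Finset.range S.n ∧
    (S.W J).Nonempty ∧ ∀ j < S.n, S.W J ⊆ S.A j → j ∈ J := by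
  simp [closedSets]

theorem Member.set_subset (x : S.Member) : x.set ⊆ Finset.range S.n := (mem_closedSets.1 x.2).1

theorem Member.nonempty (x : S.Member) : (S.W x.set).Nonempty := (mem_closedSets.1 x.2).2.1

/-- Closedness makes an index set recoverable from its intersection. -/
theorem Member.le_iff_W {x y : S.Member} : x ≤ y ↔ S.W x.set ⊆ S.W y.set := by
  refine ⟨fun h => W_anti h, fun h => ?_⟩
  intro j hj
  refine (mem_closedSets.1 x.2).2.2 j (Finset.mem_range.1 (y.set_subset hj)) (h.trans ?_)
  intro v hv
  exact (mem_W.1 hv).2 j hj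

instance : Fintype S.Member :=
  Fintype.ofInjective (fun x : S.Member => (⟨x.set, x.2⟩ : {J // J ∈ S.closedSets}))
    fun _ _ h => Subtype.ext (congrArg Subtype.val h)

theorem card_member_le : Fintype.card S.Member ≤ 2 ^ S.n := by
  have h1 : Fintype.card S.Member ≤ Fintype.card {J // J ∈ S.closedSets} :=
    Fintype.card_le_of_injective (fun x : S.Member => (⟨x.set, x.2⟩ : {J // J ∈ S.closedSets}))
      fun _ _ h => Subtype.ext (congrArg Subtype.val h)
  rw [Fintype.card_coe] at h1
  refine h1.trans ((Finset.card_filter_le _ _).trans ?_)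
  rw [Finset.card_powerset, Finset.card_range]

variable (S) in
/-- The set of marks containing `v`. -/
def marksOf (v : V) : Finset ℕ := (Finset.range S.n).filter fun j => v ∈ S.A j

theorem subset_marksOf {J : Finset ℕ} (hJ : J ⊆ Finset.range S.n) {v : V} (hv : v ∈ S.U) :
    J ⊆ S.marksOf v ↔ v ∈ S.W J := by
  rw [mem_W]
  refine ⟨fun h => ⟨hv, fun j hj => (Finset.mem_filter.1 (h hj)).2⟩, fun h j hj => ?_⟩
  exact Finset.mem_filter.2 ⟨hJ hj, h.2 j hj⟩

theorem mem_W_marksOf {v : V} (hv : v ∈ S.U) : v ∈ S.W (S.marksOf v) :=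
  (subset_marksOf (Finset.filter_subset _ _) hv).1 subset_rfl

theorem marksOf_mem_closedSets {v : V} (hv : v ∈ S.U) : S.marksOf v ∈ S.closedSets :=
  mem_closedSets.2 ⟨Finset.filter_subset _ _, ⟨v, mem_W_marksOf hv⟩, fun _ hj h =>
    Finset.mem_filter.2 ⟨Finset.mem_range.2 hj, h (mem_W_marksOf hv)⟩⟩

/-- The least element of the poset whose set contains `v`. -/
def Member.ofPoint {v : V} (hv : v ∈ S.U) : S.Member := .mk _ (marksOf_mem_closedSets hv)

theorem Member.ofPoint_le {v : V} (hv : v ∈ S.U) {x : S.Member} :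
    Member.ofPoint hv ≤ x ↔ v ∈ S.W x.set := subset_marksOf x.set_subset hv

/-- The supremum consists of the marks common to all members of `Q`; an intersection of closed sets
of marks is closed. -/
theorem Member.exists_isLUB (Q : Set S.Member) (hQ : Q.Nonempty) : ∃ s, IsLUB Q s := by
  let J : Finset ℕ := (Finset.range S.n).filter fun j => ∀ x ∈ Q, j ∈ x.set
  have hJx : ∀ x ∈ Q, J ⊆ x.set := fun x hx j hj => (Finset.mem_filter.1 hj).2 x hx
  have hW : ∀ x ∈ Q, S.W x.set ⊆ S.W J := fun x hx => W_anti (hJx x hx)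
  obtain ⟨x₀, hx₀⟩ := hQ
  have hJ : J ∈ S.closedSets := mem_closedSets.2 ⟨Finset.filter_subset _ _,
    x₀.nonempty.mono (hW x₀ hx₀), fun j hj h => Finset.mem_filter.2 ⟨Finset.mem_range.2 hj,
      fun x hx => (mem_closedSets.1 x.2).2.2 j hj ((hW x hx).trans h)⟩⟩
  refine ⟨.mk J hJ, fun x hx => hJx x hx, fun y hy j hj => ?_⟩
  exact Finset.mem_filter.2 ⟨y.set_subset hj, fun x hx => hy hx hj⟩

/-- Every non-empty intersection of marked sets is the set of an element of the poset. -/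
theorem Member.exists_W_eq {J : Finset ℕ} (hJ : J ⊆ Finset.range S.n) (hne : (S.W J).Nonempty) :
    ∃ x : S.Member, S.W x.set = S.W J := by
  let J' : Finset ℕ := (Finset.range S.n).filter fun j => S.W J ⊆ S.A j
  have hJJ' : J ⊆ J' := fun j hj => Finset.mem_filter.2 ⟨hJ hj, fun v hv => (mem_W.1 hv).2 j hj⟩
  have hW : S.W J' = S.W J := (W_anti hJJ').antisymm fun v hv =>
    mem_W.2 ⟨(mem_W.1 hv).1, fun j hj => (Finset.mem_filter.1 hj).2 hv⟩
  refine ⟨.mk J' (mem_closedSets.2 ⟨Finset.filter_subset _ _, hW ▸ hne, fun j hj h => ?_⟩), hW⟩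
  exact Finset.mem_filter.2 ⟨Finset.mem_range.2 hj, hW ▸ h⟩

/-! ### Maps, polytopes and lattices of the flag -/

variable (S) in
/-- The coordinate projection onto the coordinates of the functions active on `J`. -/
def mask (N : ℕ) (J : Finset ℕ) : QSpace N →ₗ[ℚ] QSpace N :=
  LinearMap.pi fun k => if S.Active J k then LinearMap.proj k else 0

theorem mask_apply {N : ℕ} {J : Finset ℕ} (q : QSpace N) (k : Fin N) :
    S.mask N J q k = if S.Active J k then q k else 0 := by
  simp only [mask, LinearMap.pi_apply]
  split_ifs <;> simp

/-- The map between the spaces of two elements of the poset. -/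
def Member.map (N : ℕ) (y x : S.Member) : QSpace N →ᵃ[ℚ] QSpace N :=
  -- The case distinction is needed because `ConvexFlag.map_id` concerns all of `QSpace N`, and the
  -- mask is not the identity on inactive coordinates.
  if y = x then AffineMap.id ℚ _ else (S.mask N x.set).toAffineMap

theorem Member.map_self (N : ℕ) (x : S.Member) (q : QSpace N) : Member.map N x x q = q := by
  simp [Member.map]

theorem Member.map_of_ne {N : ℕ} {y x : S.Member} (h : y ≠ x) (q : QSpace N) :
    Member.map N y x q = S.mask N x.set q := by
  simp [Member.map, h]

theorem Member.map_map {N : ℕ} {z y x : S.Member} (h : z ≤ y) (h' : y ≤ x) (q : QSpace N) :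
    Member.map N z x q = Member.map N y x (Member.map N z y q) := by
  rcases eq_or_ne z y with rfl | hzy
  · rw [Member.map_self]
  rcases eq_or_ne y x with rfl | hyx
  · rw [Member.map_self]
  have hzx : z ≠ x := fun e => hyx (le_antisymm h' (e ▸ h))
  rw [Member.map_of_ne hzy, Member.map_of_ne hyx, Member.map_of_ne hzx]
  ext k
  simp only [mask_apply]
  split_ifs with h1 h2
  · rfl
  · exact absurd (h1.mono h') h2
  · rfl

theorem _root_.Reduces.map {N : ℕ} {y x : S.Member} (h : y ≤ x) {v : V} {q : QSpace N}
    (hq : Reduces (S.η N y.set) v q) : Reduces (S.η N x.set) v (Member.map N y x q) := by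
  rcases eq_or_ne y x with rfl | hyx
  · rwa [Member.map_self]
  rw [Member.map_of_ne hyx]
  obtain ⟨z, rfl, hz⟩ := hq
  refine ⟨fun k => if S.Active x.set k then z k else 0, ?_, fun k => ?_⟩
  · ext k
    rw [mask_apply, ratVec_apply, ratVec_apply]
    split_ifs <;> simp
  · have := hz k
    by_cases h1 : S.Active x.set k
    · have h2 : S.Active y.set k := h1.mono h
      simpa only [η, if_pos h1, if_pos h2] using this
    · simp [η, h1]

theorem Member.map_liftVec {N : ℕ} {y x : S.Member} (h : y ≤ x) (v : V) :
    Member.map N y x (ratVec N (liftVec (S.η N y.set) v)) =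
      ratVec N (liftVec (S.η N x.set) v) := by
  rcases eq_or_ne y x with rfl | hyx
  · rw [Member.map_self]
  rw [Member.map_of_ne hyx]
  ext k
  rw [mask_apply, ratVec_apply, ratVec_apply]
  by_cases h1 : S.Active x.set k
  · have h2 : S.Active y.set k := h1.mono h
    simp only [liftVec, η, if_pos h1, if_pos h2]
  · simp [liftVec, η, h1]

/-- The integral points of the space of `x` that come from the set of `x`. -/
def Member.points (N : ℕ) (x : S.Member) : Finset (Fin N → ℤ) :=
  liftImage (S.η N x.set) (S.W x.set)

theorem Member.points_nonempty (N : ℕ) (x : S.Member) : (x.points N).Nonempty :=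
  liftImage_nonempty _ x.nonempty

/-- The polytope of `x`. -/
def Member.poly (N : ℕ) (x : S.Member) : Set (QSpace N) :=
  convexHull ℚ (ratVec N '' (x.points N : Set (Fin N → ℤ)))

theorem Member.map_mem_image {N : ℕ} {y x : S.Member} (h : y ≤ x) {q : QSpace N}
    (hq : q ∈ ratVec N '' (y.points N : Set (Fin N → ℤ))) :
    Member.map N y x q ∈ ratVec N '' (x.points N : Set (Fin N → ℤ)) := by
  obtain ⟨z, hz, rfl⟩ := hq
  obtain ⟨v, hv, rfl⟩ := Finset.mem_image.1 (Finset.mem_coe.1 hz)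
  rw [Member.map_liftVec h]
  exact ⟨_, Finset.mem_coe.2 (liftVec_mem_liftImage _ (Member.le_iff_W.1 h hv)), rfl⟩

/-- The conditions under which a system of marked subsets gives a flag decomposition. -/
structure IsRealizable (S : MarkSystem p V) (f : V → ℕ) (N : ℕ) : Prop where
  nonempty : S.U.Nonempty
  supp : ∀ v ∈ S.U, f v ≠ 0
  bounded : S.Bounded
  coprime : ∀ J, ∀ T : Finset (Fin N → ℤ), T ⊆ intBox N (S.bound J) → IsCoprimeTo p T
  two_mul_lt : ∀ J, 2 * S.coordSize N J < p

variable {f : V → ℕ} {N : ℕ}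

/-- The convex flag of a system. -/
def IsRealizable.flag (h : S.IsRealizable f N) : ConvexFlag S.Member where
  nonempty := ⟨Member.ofPoint h.nonempty.choose_spec⟩
  exists_sup := Member.exists_isLUB
  dim _ := N
  poly x := x.poly N
  isPolytope x := ⟨(x.points N).image (ratVec N), (x.points_nonempty N).image _, by
    rw [Finset.coe_image]; rfl⟩
  map {y x} _ := Member.map N y x
  map_poly {y x} hyx := by
    intro q hq
    have h1 : Member.map N y x q ∈ (Member.map N y x) ''
        convexHull ℚ (ratVec N '' (y.points N : Set (Fin N → ℤ))) := ⟨q, hq, rfl⟩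
    rw [AffineMap.image_convexHull] at h1
    refine convexHull_mono ?_ h1
    rintro _ ⟨r, hr, rfl⟩
    exact Member.map_mem_image hyx hr
  map_id x q := Member.map_self N x q
  map_comp h1 h2 q := Member.map_map h1 h2 q

/-- The lattice of a system. -/
def IsRealizable.lattice (h : S.IsRealizable f N) : FlagLattice h.flag where
  lat x := spanLattice (x.points N) (x.points_nonempty N)
  map_lat {_ _} hyx _ hq := affineMap_mem_affineSpan_int _ (fun _ => Member.map_mem_image hyx) hq

theorem IsRealizable.points_subset (h : S.IsRealizable f N) (x : S.Member) :
    x.points N ⊆ intBox N (S.bound x.set) := h.bounded.liftImage_subset N x.set subset_rfl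

theorem IsRealizable.exists_map (h : S.IsRealizable f N) (x : S.Member)
    [Nonempty (affineSpan (ZMod p) (S.W x.set : Set V))] :
    ∃ φ : affineSpan (ZMod p) (S.W x.set : Set V) →ᵃ[ZMod p] (h.lattice.lat x).Mod p,
      Function.Surjective φ ∧
        ∀ v q, φ v = TorsorMod.mk p q ↔ Reduces (S.η N x.set) (v : V) q.1 :=
  exists_reduction_map x.nonempty (h.coprime _ _ (h.points_subset x))

instance Member.instNonemptySpan (x : S.Member) :
    Nonempty (affineSpan (ZMod p) (S.W x.set : Set V)) :=
  let ⟨w, hw⟩ := x.nonempty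
  ⟨⟨w, subset_affineSpan _ _ hw⟩⟩

/-- The representation given by a system. -/
def IsRealizable.rep (h : S.IsRealizable f N) : FlagRep h.lattice p V where
  sub x := affineSpan (ZMod p) (S.W x.set : Set V)
  φ x := (h.exists_map x).choose
  surj x := (h.exists_map x).choose_spec.1
  sub_mono hyx := affineSpan_mono _ (by exact_mod_cast Member.le_iff_W.1 hyx)
  compat {y x} hyx v q hv :=
    ((h.exists_map x).choose_spec.2 _ _).2 ((((h.exists_map y).choose_spec.2 _ _).1 hv).map hyx)

theorem IsRealizable.rep_eq_mk (h : S.IsRealizable f N) (x : S.Member) (v : h.rep.sub x)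
    (q : (h.lattice.lat x).carrier) :
    h.rep.φ x v = TorsorMod.mk p q ↔ Reduces (S.η N x.set) (v : V) q.1 :=
  (h.exists_map x).choose_spec.2 v q

/-- The bases of the lattice of a system. -/
def IsRealizable.bases (h : S.IsRealizable f N) : h.lattice.Bases := fun x =>
  spanBasis (x.points N) (x.points_nonempty N)

theorem IsRealizable.isBounded (h : S.IsRealizable f N) :
    h.lattice.IsBounded h.bases fun x => S.coordSize N x.set :=
  ⟨fun _ _ hyx => coordSize_mono hyx, fun x q hq i =>
    abs_coord_le_boxBound (x.points_nonempty N) (h.points_subset x) q hq i⟩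

/-- The basis coefficients of a lifted point are at most `coordSize`, which is below `p / 2`; hence
the lifting of the basis returns the vector of least residues. -/
theorem IsRealizable.mem_fiber (h : S.IsRealizable f N) {x : S.Member} {v : V}
    (hv : v ∈ S.W x.set) (q : QSpace N) :
    v ∈ h.rep.fiber h.bases x q ↔ ratVec N (liftVec (S.η N x.set) v) = q := by
  have hmem : liftVec (S.η N x.set) v ∈ x.points N := liftVec_mem_liftImage _ hv
  let r : (h.lattice.lat x).carrier :=
    ⟨ratVec N (liftVec (S.η N x.set) v), ratVec_mem_latticeSpan hmem⟩
  have hsub : v ∈ h.rep.sub x := subset_affineSpan (ZMod p) _ hv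
  have h1 : h.rep.φ x ⟨v, hsub⟩ = TorsorMod.mk p r :=
    (h.rep_eq_mk x _ r).2 (reduces_liftVec _ v)
  have h2 : (h.bases x).lift (h.rep.φ x ⟨v, hsub⟩) = r := by
    rw [h1]
    refine lift_mk_eq_self _ r fun i => ?_
    have h3 := h.isBounded.2 x r
      (show ratVec N _ ∈ x.poly N from subset_convexHull ℚ _ (Set.mem_image_of_mem _ hmem)) i
    have h4 := h.two_mul_lt x.set
    simp only at h3
    omega
  constructor
  · rintro ⟨hs, hq⟩
    rw [h2] at hq
    exact hq
  · intro hq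
    exact ⟨hsub, by rw [h2]; exact hq⟩

/-! ### Splitting the function over the poset -/

variable (S f) in
/-- The part of `f` belonging to an element of the poset. -/
def partOf (x : S.Member) (v : V) : ℕ := if v ∈ S.U ∧ S.marksOf v = x.set then f v else 0

theorem sum_partOf (Q : S.Member → Prop) (v : V) :
    ∑ y with Q y, S.partOf f y v =
      if ∃ hv : v ∈ S.U, Q (Member.ofPoint hv) then f v else 0 := by
  by_cases hv : v ∈ S.U
  · have h1 : ∀ y : S.Member, S.partOf f y v = if y = Member.ofPoint hv then f v else 0 := by
      intro y
      unfold partOf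
      congr 1
      refine propext ⟨fun h => Subtype.ext h.2.symm, ?_⟩
      rintro rfl
      exact ⟨hv, rfl⟩
    rw [Finset.sum_congr rfl fun y _ => h1 y, Finset.sum_ite_eq']
    simp [hv]
  · rw [if_neg (fun h => hv h.1)]
    exact Finset.sum_eq_zero fun y _ => if_neg fun h => hv h.1

/-- The element carrying `v` is the least one whose set contains `v`, so it lies below `x` exactly
when `v` belongs to the set of `x`. -/
theorem sumBelow_partOf (x : S.Member) (v : V) :
    sumBelow (S.partOf f) x v = if v ∈ S.W x.set then f v else 0 := by
  unfold sumBelow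
  rw [sum_partOf (fun y => y ≤ x)]
  congr 1
  refine propext ⟨fun ⟨hv, h⟩ => (Member.ofPoint_le hv).1 h, fun h => ?_⟩
  exact ⟨(mem_W.1 h).1, (Member.ofPoint_le _).2 h⟩

theorem sum_univ_partOf (v : V) : ∑ x, S.partOf f x v = if v ∈ S.U then f v else 0 := by
  have := sum_partOf (S := S) (f := f) (fun _ => True) v
  simpa using this

variable [Fintype V]

theorem IsRealizable.star_eq (h : S.IsRealizable f N) (x : S.Member) (q : QSpace N) :
    h.rep.star h.bases (S.partOf f) x q =
      ∑ v ∈ S.W x.set with ratVec N (liftVec (S.η N x.set) v) = q, f v := by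
  have h1 : h.rep.star h.bases (S.partOf f) x q =
      mass (sumBelow (S.partOf f) x) (h.rep.fiber h.bases x q) := by
    unfold FlagRep.star mass sumBelow
    rw [Finset.sum_comm]
    refine Finset.sum_congr rfl fun v _ => ?_
    by_cases hv : v ∈ h.rep.fiber h.bases x q
    · simp [Set.indicator_of_mem hv]
    · simp [Set.indicator_of_notMem hv]
  rw [h1, show sumBelow (S.partOf f) x = fun v => if v ∈ S.W x.set then f v else 0 from
    funext (sumBelow_partOf x), mass_ite]
  refine Finset.sum_congr (Finset.filter_congr fun v hv => ?_) fun _ _ => rfl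
  exact h.mem_fiber hv q

theorem IsRealizable.star_ne_zero (h : S.IsRealizable f N) (x : S.Member) (q : QSpace N) :
    h.rep.star h.bases (S.partOf f) x q ≠ 0 ↔
      q ∈ ratVec N '' (x.points N : Set (Fin N → ℤ)) := by
  rw [h.star_eq, Ne, Finset.sum_eq_zero_iff]
  push Not
  constructor
  · rintro ⟨v, hv, -⟩
    obtain ⟨hv, hq⟩ := Finset.mem_filter.1 hv
    exact ⟨_, Finset.mem_coe.2 (liftVec_mem_liftImage _ hv), hq⟩
  · rintro ⟨z, hz, rfl⟩
    obtain ⟨v, hv, rfl⟩ := Finset.mem_image.1 (Finset.mem_coe.1 hz)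
    exact ⟨v, Finset.mem_filter.2 ⟨hv, rfl⟩, h.supp v (mem_W.1 hv).1⟩

/-- The flag decomposition of a system. -/
def IsRealizable.decomposition (h : S.IsRealizable f N) : FlagDecomposition h.rep f where
  part := S.partOf f
  basis := h.bases
  part_supp x v hv := by
    refine if_neg fun ⟨hU, hm⟩ => hv (subset_affineSpan (ZMod p) _ ?_)
    rw [← hm]
    exact mem_W_marksOf hU
  sum_le v := by
    rw [sum_univ_partOf]
    split_ifs
    · exact le_rfl
    · exact Nat.zero_le _
  convexHull_eq x := by
    refine congrArg (convexHull ℚ) (Set.ext fun q => ?_)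
    refine ⟨fun hq => (h.star_ne_zero x q).1 hq.2, fun hq => ⟨?_, (h.star_ne_zero x q).2 hq⟩⟩
    exact subset_affineSpan ℤ _ hq

end MarkSystem

/-! ### Faces of polytopes -/

/-- A convex combination reaches the bound `c` only if all points with positive coefficient do. The
property is convex and holds on `T`. -/
theorem mem_convexHull_inter_of_eq {n : ℕ} {T : Set (QSpace n)} {l : QSpace n →ₗ[ℚ] ℚ} {c : ℚ}
    (hl : ∀ q ∈ T, l q ≤ c) {q : QSpace n} (hq : q ∈ convexHull ℚ T) :
    l q ≤ c ∧ (l q = c → q ∈ convexHull ℚ (T ∩ {q | l q = c})) := by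
  have hconv : Convex ℚ {q | l q ≤ c ∧ (l q = c → q ∈ convexHull ℚ (T ∩ {q | l q = c}))} := by
    intro u hu w hw a b ha hb hab
    have hlq : l (a • u + b • w) = a * l u + b * l w := by simp
    have h1 : a * l u ≤ a * c := mul_le_mul_of_nonneg_left hu.1 ha
    have h2 : b * l w ≤ b * c := mul_le_mul_of_nonneg_left hw.1 hb
    have h3 : a * c + b * c = c := by rw [← add_mul, hab, one_mul]
    refine ⟨by rw [hlq]; linarith, fun heq => ?_⟩
    rw [hlq] at heq
    rcases ha.eq_or_lt with rfl | ha'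
    · have hb1 : b = 1 := by linarith
      subst hb1
      simp only [zero_smul, one_smul, zero_add]
      exact hw.2 (by linarith)
    rcases hb.eq_or_lt with rfl | hb'
    · have ha1 : a = 1 := by linarith
      subst ha1
      simp only [zero_smul, one_smul, add_zero]
      exact hu.2 (by linarith)
    have h4 : l u = c := mul_left_cancel₀ ha'.ne' (by linarith)
    have h5 : l w = c := mul_left_cancel₀ hb'.ne' (by linarith)
    exact convex_convexHull ℚ _ (hu.2 h4) (hw.2 h5) ha hb hab
  refine convexHull_min (fun q hq => ?_) hconv hq
  exact ⟨hl q hq, fun h => subset_convexHull ℚ _ ⟨hq, h⟩⟩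

theorem IsFace.exists_functional {n : ℕ} {Q Γ : Set (QSpace n)} (h : IsFace Q Γ) :
    ∃ (l : QSpace n →ₗ[ℚ] ℚ) (c : ℚ), (∀ q ∈ Q, l q ≤ c) ∧ ∀ q, q ∈ Γ ↔ q ∈ Q ∧ l q = c := by
  obtain ⟨q₀, hq₀⟩ := h.1
  obtain ⟨l, hl⟩ := h.2 h.1
  have h0 := hq₀
  rw [hl] at h0
  refine ⟨l.toLinearMap, l q₀, h0.2, fun q => ?_⟩
  rw [hl]
  constructor
  · rintro ⟨hq, hmax⟩
    exact ⟨hq, le_antisymm (h0.2 q hq) (hmax q₀ h0.1)⟩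
  · rintro ⟨hq, heq⟩
    refine ⟨hq, fun y hy => ?_⟩
    have : l q = l q₀ := heq
    rw [this]
    exact h0.2 y hy

theorem isFace_of_functional {n : ℕ} {Q Γ : Set (QSpace n)} (l : QSpace n →ₗ[ℚ] ℚ) (c : ℚ)
    (hl : ∀ q ∈ Q, l q ≤ c) (hΓ : ∀ q, q ∈ Γ ↔ q ∈ Q ∧ l q = c) (hne : Γ.Nonempty) :
    IsFace Q Γ := by
  refine ⟨hne, fun _ => ⟨⟨l, ?_⟩, Set.ext fun q => ?_⟩⟩
  · have : ⇑l = fun q => ∑ k, q k * l (Pi.single k 1) := by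
      funext q
      conv_lhs => rw [pi_eq_sum_univ' q]
      simp
    change Continuous ⇑l
    rw [this]
    fun_prop
  · obtain ⟨q₀, hq₀⟩ := hne
    have h0 := (hΓ q₀).1 hq₀
    rw [hΓ]
    constructor
    · rintro ⟨hq, heq⟩
      exact ⟨hq, fun y hy => (hl y hy).trans heq.ge⟩
    · rintro ⟨hq, hmax⟩
      refine ⟨hq, le_antisymm (hl q hq) ?_⟩
      have : l q₀ ≤ l q := hmax q₀ h0.1
      rw [← h0.2]
      exact this

theorem ratDot_eq {n : ℕ} (l : QSpace n →ₗ[ℚ] ℚ) : ratDot (fun k => l (Pi.single k 1)) = l := by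
  ext k
  simp [ratDot, Pi.single_apply]

theorem exists_affineMap_extension {k V : Type*} [Field k] [AddCommGroup V] [Module k V]
    (s : AffineSubspace k V) [Nonempty s] (ξ : s →ᵃ[k] k) :
    ∃ ζ : V →ᵃ[k] k, ∀ v : s, ζ v = ξ v := by
  obtain ⟨o⟩ := ‹Nonempty s›
  obtain ⟨L, hL⟩ := LinearMap.exists_extend ξ.linear
  refine ⟨L.toAffineMap.comp (AffineMap.id k V - AffineMap.const k V (o : V)) +
    AffineMap.const k V (ξ o), fun v => ?_⟩
  have h1 : L ((v : V) - o) = ξ.linear (v -ᵥ o) := by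
    rw [← hL]
    rfl
  have h2 : ξ v = ξ.linear (v -ᵥ o) + ξ o := by
    rw [ξ.linearMap_vsub]
    simp
  rw [h2, ← h1]
  simp

/-! ### Weights and faces in terms of subsets of `V` -/

namespace MarkSystem

variable {p : ℕ} {V : Type*} [AddCommGroup V] [Module (ZMod p) V] {S : MarkSystem p V}
  {f : V → ℕ} {N : ℕ}

/-- The points of the set of `x` lying over `Q`. -/
def Member.over (N : ℕ) (x : S.Member) (Q : Set (QSpace N)) : Finset V :=
  (S.W x.set).filter fun v => ratVec N (liftVec (S.η N x.set) v) ∈ Q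

theorem Member.mem_over {x : S.Member} {Q : Set (QSpace N)} {v : V} :
    v ∈ x.over N Q ↔ v ∈ S.W x.set ∧ ratVec N (liftVec (S.η N x.set) v) ∈ Q :=
  Finset.mem_filter

theorem Member.liftVec_mem_poly {x : S.Member} {v : V} (hv : v ∈ S.W x.set) :
    ratVec N (liftVec (S.η N x.set) v) ∈ x.poly N :=
  subset_convexHull ℚ _ ⟨_, Finset.mem_coe.2 (liftVec_mem_liftImage _ hv), rfl⟩

theorem Member.mem_convexHull_over {x : S.Member} {Γ : Set (QSpace N)}
    {l : QSpace N →ₗ[ℚ] ℚ} {c : ℚ} (hl : ∀ q ∈ x.poly N, l q ≤ c)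
    (hΓ : ∀ q, q ∈ Γ ↔ q ∈ x.poly N ∧ l q = c) {q : QSpace N} (hq : q ∈ Γ) :
    q ∈ convexHull ℚ ((fun v => ratVec N (liftVec (S.η N x.set) v)) '' (x.over N Γ : Set V)) := by
  obtain ⟨hq1, hq2⟩ := (hΓ q).1 hq
  refine convexHull_mono ?_ ((mem_convexHull_inter_of_eq
    (fun r hr => hl r (subset_convexHull ℚ _ hr)) hq1).2 hq2)
  rintro _ ⟨⟨z, hz, rfl⟩, hc⟩
  obtain ⟨v, hv, rfl⟩ := Finset.mem_image.1 (Finset.mem_coe.1 hz)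
  exact ⟨v, Finset.mem_coe.2 (Member.mem_over.2 ⟨hv, (hΓ _).2
    ⟨Member.liftVec_mem_poly hv, hc⟩⟩), rfl⟩

variable [Fintype V]

theorem cast_sum_eq_weight {V : Type*} (f : V → ℕ) (X : Finset V) :
    ((∑ v ∈ X, f v : ℕ) : ℝ) = weight f X := by
  simp [weight]

theorem IsRealizable.total_eq (h : S.IsRealizable f N) :
    (h.decomposition.total : ℝ) = weight f S.U := by
  have h1 : h.decomposition.total = mass (fun v => if v ∈ S.U then f v else 0) Set.univ :=
    congrArg (fun F => mass F Set.univ) (funext fun v => sum_univ_partOf v)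
  rw [h1, mass_ite]
  simp [weight]

theorem IsRealizable.starSet_eq (h : S.IsRealizable f N) (x : S.Member) (Q : Set (QSpace N)) :
    (h.decomposition.starSet x (Q ∩ (h.lattice.lat x).points) : ℝ) = weight f (x.over N Q) := by
  rw [← cast_sum_eq_weight]
  congr 1
  let t : Finset (QSpace N) := (x.over N Q).image fun v => ratVec N (liftVec (S.η N x.set) v)
  have h1 : h.decomposition.starSet x (Q ∩ (h.lattice.lat x).points) =
      ∑ q ∈ t, h.rep.star h.bases (S.partOf f) x q := by
    refine finsum_mem_eq_sum_of_inter_support_eq _ (Set.ext fun q => ?_)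
    refine and_congr_left fun hq => ?_
    obtain ⟨z, hz, rfl⟩ := (h.star_ne_zero x q).1 hq
    have hzmem := hz
    obtain ⟨v, hv, rfl⟩ := Finset.mem_image.1 (Finset.mem_coe.1 hz)
    constructor
    · rintro ⟨hQ, -⟩
      exact Finset.mem_coe.2 (Finset.mem_image.2 ⟨v, Member.mem_over.2 ⟨hv, hQ⟩, rfl⟩)
    · intro hmem
      obtain ⟨w, hw, hwv⟩ := Finset.mem_image.1 (Finset.mem_coe.1 hmem)
      exact ⟨hwv ▸ (Member.mem_over.1 hw).2, ratVec_mem_latticeSpan (Finset.mem_coe.1 hzmem)⟩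
  rw [h1, ← Finset.sum_fiberwise_of_maps_to (s := x.over N Q) (t := t)
    (g := fun v => ratVec N (liftVec (S.η N x.set) v)) fun v hv => Finset.mem_image_of_mem _ hv]
  refine Finset.sum_congr rfl fun q hq => ?_
  rw [h.star_eq]
  obtain ⟨w, hw, rfl⟩ := Finset.mem_image.1 hq
  refine Finset.sum_congr (Finset.ext fun v => ?_) fun _ _ => rfl
  simp only [Finset.mem_filter, Member.mem_over]
  refine and_congr_left fun hv => ⟨fun h => ⟨h, ?_⟩, fun h => h.1⟩
  rw [hv]
  exact (Member.mem_over.1 hw).2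

theorem IsRealizable.gap_ge (h : S.IsRealizable f N) {x : S.Member} {θ : ℝ}
    (hθ : ∀ v ∈ S.W x.set, θ ≤ weight f (S.fiberSet N x.set v)) :
    θ ≤ (h.decomposition.gap x : ℝ) := by
  have hpos : ∀ q : QSpace N, h.decomposition.star x q =
      ∑ v ∈ S.W x.set with ratVec N (liftVec (S.η N x.set) v) = q, f v := h.star_eq x
  have hne : {m | 0 < m ∧ ∃ q ∈ (h.lattice.lat x).points,
      h.decomposition.star x q = m}.Nonempty := by
    obtain ⟨v, hv⟩ := x.nonempty
    have hmem := liftVec_mem_liftImage (S.η N x.set) hv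
    refine ⟨_, Nat.pos_of_ne_zero ?_, ratVec N (liftVec (S.η N x.set) v),
      ratVec_mem_latticeSpan hmem, rfl⟩
    exact (h.star_ne_zero x _).2 ⟨_, hmem, rfl⟩
  obtain ⟨h0, q, hq, heq⟩ := Nat.sInf_mem hne
  change θ ≤ ((sInf {m | 0 < m ∧ ∃ q ∈ (h.lattice.lat x).points,
      h.decomposition.star x q = m} : ℕ) : ℝ)
  rw [← heq] at h0 ⊢
  obtain ⟨z, hz, rfl⟩ := (h.star_ne_zero x q).1 h0.ne'
  obtain ⟨v, hv, rfl⟩ := Finset.mem_image.1 (Finset.mem_coe.1 hz)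
  refine (hθ v hv).trans (le_of_eq ?_)
  rw [hpos, cast_sum_eq_weight]
  refine congrArg _ (Finset.filter_congr fun w _ => ?_)
  exact (ratVec_injective N).eq_iff.symm

/-! ### Proper points and good faces -/

theorem IsRealizable.mass_part_pos (h : S.IsRealizable f N) (y : S.Member) (q : QSpace N) :
    0 < mass (h.decomposition.part y) (h.rep.fiber h.decomposition.basis y q) ↔
      ∃ v, ∃ hv : v ∈ S.U, Member.ofPoint hv = y ∧
        ratVec N (liftVec (S.η N y.set) v) = q := by
  have hpart : ∀ v, S.partOf f y v ≠ 0 ↔ ∃ hv : v ∈ S.U, Member.ofPoint hv = y := by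
    intro v
    unfold partOf
    constructor
    · intro hne
      by_cases hc : v ∈ S.U ∧ S.marksOf v = y.set
      · exact ⟨hc.1, Subtype.ext hc.2⟩
      · exact absurd (if_neg hc) hne
    · rintro ⟨hv, rfl⟩
      rw [if_pos ⟨hv, rfl⟩]
      exact h.supp v hv
  rw [Nat.pos_iff_ne_zero]
  unfold mass
  rw [Ne, Finset.sum_eq_zero_iff]
  push Not
  refine exists_congr fun v => ?_
  rw [Set.indicator_apply_ne_zero]
  constructor
  · rintro ⟨-, hfib, hne⟩
    obtain ⟨hv, rfl⟩ := (hpart v).1 hne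
    exact ⟨hv, rfl, (h.mem_fiber (x := .ofPoint hv) (mem_W_marksOf hv) q).1 hfib⟩
  · rintro ⟨hv, rfl, hq⟩
    exact ⟨Finset.mem_univ _, (h.mem_fiber (x := .ofPoint hv) (mem_W_marksOf hv) q).2 hq,
      (hpart v).2 ⟨hv, rfl⟩⟩

/-- Proper points are convex combinations of points given by single vectors `v ∈ U`. Such a
combination lies over `Γ` only if all its vectors do, and conversely each vector over `Γ` gives a
proper point that any competitor of `z` has to accommodate. -/
theorem IsRealizable.isFaceElement (h : S.IsRealizable f N) {x z : S.Member}
    {Γ : Set (QSpace N)} {l : QSpace N →ₗ[ℚ] ℚ} {c : ℚ} (hl : ∀ q ∈ x.poly N, l q ≤ c)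
    (hΓ : ∀ q, q ∈ Γ ↔ q ∈ x.poly N ∧ l q = c) (hz : S.W z.set = x.over N Γ) :
    ConvexFlag.IsFaceElement (F := h.flag) h.decomposition.proper x Γ z := by
  have hzx : z ≤ x := Member.le_iff_W.2 (hz.subset.trans (Finset.filter_subset _ _))
  refine ⟨⟨hzx, ?_⟩, fun z' hz' => ?_⟩
  · rintro q ⟨n, r, α, hr, hα, hsum, hlub, hle, hpt⟩ hqx hmem
    refine hlub.2 ?_
    rintro _ ⟨i, rfl⟩
    have hv : ∀ i, ∃ v, ∃ hv : v ∈ S.U, Member.ofPoint hv = (r i).base ∧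
        ratVec N (liftVec (S.η N (r i).base.set) v) = (r i).pt := fun i =>
      (h.mass_part_pos _ _).1 (hr i)
    choose v hvU hvbase hvpt using hv
    have hix : ∀ i, (r i).base ≤ x := fun i => (hle i).trans hqx
    have hvW : ∀ i, v i ∈ S.W x.set := fun i =>
      (Member.ofPoint_le (hvU i)).1 ((hvbase i).trans_le (hix i))
    have hval : Member.map N q.base x q.pt =
        ∑ i, α i • ratVec N (liftVec (S.η N x.set) (v i)) := by
      have h1 : q.pt = ∑ i, α i • ratVec N (liftVec (S.η N q.base.set) (v i)) := by
        rw [hpt]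
        refine Finset.sum_congr rfl fun i _ => ?_
        rw [← hvpt i]
        exact congrArg (α i • ·) (Member.map_liftVec (hle i) (v i))
      have h2 : ∑ i, α i • ratVec N (liftVec (S.η N q.base.set) (v i)) =
          Finset.univ.affineCombination ℚ
            (fun i => ratVec N (liftVec (S.η N q.base.set) (v i))) α :=
        (Finset.affineCombination_eq_linear_combination _ _ _ hsum).symm
      rw [h1, h2, Finset.map_affineCombination _ _ _ hsum,
        Finset.affineCombination_eq_linear_combination _ _ _ hsum]
      refine Finset.sum_congr rfl fun i _ => ?_
      exact congrArg (α i • ·) (Member.map_liftVec hqx (v i))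
    have hlc : ∑ i, α i * l (ratVec N (liftVec (S.η N x.set) (v i))) = c := by
      have h1 := ((hΓ _).1 hmem).2
      change l (Member.map N q.base x q.pt) = c at h1
      rw [hval] at h1
      simpa using h1
    -- All coefficients are positive, so one value of `l` below `c` would bring the average below
    -- `c`.
    have hli : l (ratVec N (liftVec (S.η N x.set) (v i))) = c := by
      by_contra hne
      have h1 : ∑ i, α i * l (ratVec N (liftVec (S.η N x.set) (v i))) < ∑ i, α i * c := by
        refine Finset.sum_lt_sum (fun j _ => mul_le_mul_of_nonneg_left
          (hl _ (Member.liftVec_mem_poly (hvW j))) (hα j).le) ⟨i, Finset.mem_univ _, ?_⟩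
        exact mul_lt_mul_of_pos_left
          (lt_of_le_of_ne (hl _ (Member.liftVec_mem_poly (hvW i))) hne) (hα i)
      rw [← Finset.sum_mul, hsum, one_mul, hlc] at h1
      exact lt_irrefl _ h1
    refine (hvbase i).symm.trans_le ((Member.ofPoint_le (hvU i)).2 ?_)
    rw [hz]
    exact Member.mem_over.2 ⟨hvW i, (hΓ _).2 ⟨Member.liftVec_mem_poly (hvW i), hli⟩⟩
  · refine Member.le_iff_W.2 fun v hv => ?_
    rw [hz] at hv
    obtain ⟨hvx, hvΓ⟩ := Member.mem_over.1 hv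
    have hvU := (mem_W.1 hvx).1
    have hle : Member.ofPoint hvU ≤ x := (Member.ofPoint_le hvU).2 hvx
    let q : h.flag.Point := ⟨Member.ofPoint hvU, ratVec N (liftVec (S.η N (S.marksOf v)) v),
      Member.liftVec_mem_poly (x := Member.ofPoint hvU) (mem_W_marksOf hvU)⟩
    refine (Member.ofPoint_le hvU).1 (hz'.2 q ?_ hle ?_)
    · refine ⟨1, fun _ => q, fun _ => 1, fun _ => ?_, fun _ => one_pos, by simp, ?_,
        fun _ => le_rfl, ?_⟩
      · exact (h.mass_part_pos _ _).2 ⟨v, hvU, rfl, rfl⟩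
      · rw [Set.range_const]
        exact isLUB_singleton
      · rw [Fin.sum_univ_one, one_smul]
        exact (h.flag.map_id _ _).symm
    · change Member.map N (Member.ofPoint hvU) x _ ∈ Γ
      have := Member.map_liftVec (N := N) hle v
      exact this.symm ▸ hvΓ

theorem IsRealizable.isReduced (h : S.IsRealizable f N) (x : S.Member) :
    ConvexFlag.IsReduced h.decomposition.proper x := by
  refine h.isFaceElement (Γ := x.poly N) (l := 0) (c := 0) (fun _ _ => le_rfl) (fun q => by simp) ?_
  exact (Finset.filter_true_of_mem fun v hv => Member.liftVec_mem_poly hv).symm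

/-- Faces of `Γ` and face sets of the points over it correspond through their functionals, since `Γ`
is the hull of the lifts of these points. -/
theorem IsRealizable.isLargeFaceSet (h : S.IsRealizable f N) {ε : ℝ} (hε1 : ε ≤ 1)
    {x : S.Member} {Γ : Set (QSpace N)} (hΓ : h.decomposition.IsLargeFace ε x Γ) :
    S.IsLargeFaceSet f ε N x.set (x.over N Γ) := by
  obtain ⟨hface, htot, hprop⟩ := hΓ
  have hface' : IsFace (x.poly N) Γ := hface
  obtain ⟨l, c, hl, hlΓ⟩ := hface'.exists_functional
  have hfun : ∀ (l : QSpace N →ₗ[ℚ] ℚ) w, S.functional N x.set (fun k => l (Pi.single k 1)) w =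
      l (ratVec N (liftVec (S.η N x.set) w)) := fun l w => by rw [functional, ratDot_eq]
  refine ⟨Finset.filter_subset _ _, ?_, ⟨fun k => l (Pi.single k 1), c, fun w hw => ?_⟩, ?_,
    fun Z hZ hZface hne => ?_⟩
  · obtain ⟨q, hq⟩ := hface.1
    have := Member.mem_convexHull_over hl hlΓ hq
    by_contra hemp
    rw [Finset.not_nonempty_iff_eq_empty.1 hemp, Finset.coe_empty, Set.image_empty,
      convexHull_empty] at this
    exact this
  · rw [hfun]
    refine ⟨hl _ (Member.liftVec_mem_poly hw), fun hmem => ?_, fun heq => ?_⟩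
    · exact ((hlΓ _).1 (Member.mem_over.1 hmem).2).2
    · exact Member.mem_over.2 ⟨hw, (hlΓ _).2 ⟨Member.liftVec_mem_poly hw, heq⟩⟩
  · rw [← h.starSet_eq, ← h.total_eq]
    exact htot
  -- The empty set counts as a face set but not as a face; it has weight zero.
  · rcases Z.eq_empty_or_nonempty with rfl | hZne
    · have := mul_nonneg (sub_nonneg.2 hε1) (weight_nonneg f (x.over N Γ))
      simpa [weight] using this
    obtain ⟨l', c', hl'⟩ := hZface
    let Γ' : Set (QSpace N) := {q | q ∈ Γ ∧ ratDot l' q = c'}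
    have hover : x.over N Γ' = Z := by
      ext v
      constructor
      · intro hv
        obtain ⟨hvW, hvΓ, hvc⟩ := Member.mem_over.1 hv
        exact (hl' v (Member.mem_over.2 ⟨hvW, hvΓ⟩)).2.2 hvc
      · intro hv
        obtain ⟨hvW, hvΓ⟩ := Member.mem_over.1 (hZ hv)
        exact Member.mem_over.2 ⟨hvW, hvΓ, (hl' v (hZ hv)).2.1 hv⟩
    have hface2 : IsFace Γ Γ' := by
      refine isFace_of_functional (ratDot l') c' (fun q hq => ?_) (fun q => Iff.rfl) ?_
      · refine (mem_convexHull_inter_of_eq ?_ (Member.mem_convexHull_over hl hlΓ hq)).1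
        rintro _ ⟨v, hv, rfl⟩
        exact (hl' v (Finset.mem_coe.1 hv)).1
      · obtain ⟨v, hv⟩ := hZne
        rw [← hover] at hv
        exact ⟨_, (Member.mem_over.1 hv).2⟩
    have hne' : Γ' ≠ Γ := fun heq => hne (by rw [← hover, heq])
    have := hprop Γ' hface2 hne'
    have e1 := h.starSet_eq x Γ'
    have e2 := h.starSet_eq x Γ
    rw [hover] at e1
    rw [← e1, ← e2]
    exact this

/-- The points over `Γ` form the set of some element `z`, which is therefore `x_Γ`. Its polytope is
spanned by their lifts, and these map into the convex set `Γ`. -/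
theorem IsRealizable.isGood (h : S.IsRealizable f N) {ε : ℝ} (hε1 : ε ≤ 1)
    (hfaces : ∀ J ⊆ Finset.range S.n, ∀ X, S.IsLargeFaceSet f ε N J X →
      ∃ J' ⊆ Finset.range S.n, S.W J' = X)
    {x : S.Member} {Γ : Set (QSpace N)} (hΓ : h.decomposition.IsLargeFace ε x Γ) :
    ConvexFlag.IsGood (F := h.flag) h.decomposition.proper x Γ := by
  have hlarge := h.isLargeFaceSet hε1 hΓ
  obtain ⟨J', hJ', hW⟩ := hfaces x.set x.set_subset _ hlarge
  obtain ⟨z, hz⟩ := Member.exists_W_eq hJ' (hW ▸ hlarge.nonempty)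
  rw [hW] at hz
  have hface' : IsFace (x.poly N) Γ := hΓ.1
  obtain ⟨l, c, hl, hlΓ⟩ := hface'.exists_functional
  have hzx : z ≤ x := Member.le_iff_W.2 (hz.subset.trans (Finset.filter_subset _ _))
  refine ⟨z, h.isFaceElement hl hlΓ hz, hzx, ?_⟩
  intro q hq
  have h1 : Member.map N z x q ∈ (Member.map N z x) ''
      convexHull ℚ (ratVec N '' (z.points N : Set (Fin N → ℤ))) := ⟨q, hq, rfl⟩
  rw [AffineMap.image_convexHull] at h1
  have h2 : ∀ r ∈ Member.map N z x '' (ratVec N '' (z.points N : Set (Fin N → ℤ))),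
      r ∈ x.poly N ∧ l r = c := by
    rintro _ ⟨_, ⟨w, hw, rfl⟩, rfl⟩
    obtain ⟨v, hv, rfl⟩ := Finset.mem_image.1 (Finset.mem_coe.1 hw)
    rw [Member.map_liftVec hzx, ← hlΓ]
    rw [hz] at hv
    exact (Member.mem_over.1 hv).2
  have h3 : Convex ℚ {r | r ∈ x.poly N ∧ l r = c} :=
    (convex_convexHull ℚ _).inter ((convex_singleton c).linear_preimage l)
  exact (hlΓ _).2 (convexHull_min h2 h3 h1)

/-! ### Thickness -/

theorem IsRealizable.isThick (h : S.IsRealizable f N) [Fact p.Prime] (hm : S.m ≤ N) {δ : ℝ}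
    {x : S.Member} {K : ℕ}
    (hthick : ∀ ζ : V →ᵃ[ZMod p] ZMod p,
      (∃ v ∈ affineSpan (ZMod p) (S.W x.set : Set V),
        ∃ w ∈ affineSpan (ZMod p) (S.W x.set : Set V),
        (∀ k, S.Active x.set k → S.ξ k v = S.ξ k w) ∧ ζ v ≠ ζ w) →
      weight f (S.slabSet x.set ζ K) < (1 - δ) * weight f (S.W x.set))
    [Nonempty (h.rep.sub x)] (ξ : h.rep.sub x →ᵃ[ZMod p] ZMod p)
    (hξ : ∃ v w, h.rep.φ x v = h.rep.φ x w ∧ ξ v ≠ ξ w) :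
    IsThick (h.rep.sub x) (sumBelow (S.partOf f) x) K δ ξ := by
  obtain ⟨ζ, hζ⟩ := exists_affineMap_extension (h.rep.sub x) ξ
  obtain ⟨v, w, hvw, hne⟩ := hξ
  have hlt := hthick ζ ⟨v, v.2, w, w.2, fun k hk => ?_, by rwa [hζ, hζ]⟩
  · unfold IsThick IsThin
    rw [show sumBelow (S.partOf f) x = fun v => if v ∈ S.W x.set then f v else 0 from
      funext (sumBelow_partOf x), mass_ite, mass_ite, not_le]
    have e1 : (S.W x.set).filter (fun v => v ∈ (h.rep.sub x : Set V)) = S.W x.set :=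
      Finset.filter_true_of_mem fun v hv => subset_affineSpan (ZMod p) _ hv
    have e2 : (S.W x.set).filter (fun v => v ∈ slab (h.rep.sub x) ξ K) =
        S.slabSet x.set ζ K := by
      refine Finset.filter_congr fun u hu => ?_
      have hsub : u ∈ h.rep.sub x := subset_affineSpan (ZMod p) _ hu
      constructor
      · rintro ⟨hu', k, hk, hk'⟩
        exact ⟨k, hk, (hζ ⟨u, hu'⟩).trans hk'⟩
      · rintro ⟨k, hk, hk'⟩
        exact ⟨hsub, k, hk, (hζ ⟨u, hsub⟩).symm.trans hk'⟩
    rw [e1, e2, cast_sum_eq_weight, cast_sum_eq_weight]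
    exact hlt
  -- A common representative of the two classes reduces to the values of the active functions at
  -- both points. As `m ≤ N`, every active function occurs among the coordinates.
  · have h1 := (h.rep_eq_mk x v (h.rep.φ x v).out).1 (TorsorMod.mk_out _).symm
    have h2 := (h.rep_eq_mk x w (h.rep.φ x v).out).1 (hvw.symm.trans (TorsorMod.mk_out _).symm)
    obtain ⟨a, ha, hav⟩ := h1
    obtain ⟨b, hb, hbw⟩ := h2
    have hab : a = b := ratVec_injective N (ha.trans hb.symm)
    have h3 := (hav ⟨k, hk.1.trans_le hm⟩).symm.trans
      ((by rw [hab] : ((a _ : ℤ) : ZMod p) = (b _ : ℤ)).trans (hbw ⟨k, hk.1.trans_le hm⟩))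
    simpa only [η, if_pos hk] using h3

end MarkSystem

/-! ### Choice of constants and conclusion -/

theorem mass_univ_eq_weight {V : Type*} [Fintype V] (f : V → ℕ) :
    (mass f Set.univ : ℝ) = weight f Finset.univ := by
  simp [mass, weight]

theorem MarkSystem.IsCompleteSystem.isRealizable {p : ℕ} [Fact p.Prime] {V : Type*}
    [AddCommGroup V] [Module (ZMod p) V] [Fintype V] {S : MarkSystem p V} {f : V → ℕ} {g : ℕ → ℕ}
    {N : ℕ} {ε δ : ℝ} (hS : S.IsCompleteSystem f g N ε δ) (hf : f ≠ 0) (hε : ε < 1)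
    (hp : primeBound N (sizeSeq g N N) < p) (hp' : 2 * boxBound N (sizeSeq g N N) < p) :
    S.IsRealizable f N where
  nonempty := by
    by_contra h
    obtain ⟨v, hv⟩ := Function.ne_iff.1 hf
    have hpos : 0 < weight f Finset.univ := by
      refine Finset.sum_pos' (fun _ _ => Nat.cast_nonneg _) ⟨v, Finset.mem_univ _, ?_⟩
      exact_mod_cast Nat.pos_of_ne_zero hv
    have h1 := hS.sharp
    rw [Finset.not_nonempty_iff_eq_empty.1 h] at h1
    have h2 : weight f ∅ = 0 := Finset.sum_empty
    have h3 := mul_pos (sub_pos.2 hε) hpos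
    linarith
  supp := hS.supp
  bounded := hS.bounded
  coprime J _ hT :=
    isCoprimeTo_of_primeBound_lt Fact.out hp (hT.trans (intBox_mono (hS.bound_le J)))
  two_mul_lt J := lt_of_le_of_lt (Nat.mul_le_mul_left _ (boxBound_mono N (hS.bound_le J))) hp'

/-- Lowering `ε` only enlarges the class of large faces, so the construction may be run with `ε ≤ 1
/ 2`. -/
theorem IsLargeFace_anti {P : Type} [PartialOrder P] [Fintype P] {F : ConvexFlag P}
    {Λ : FlagLattice F} {p : ℕ} {V : Type*} [AddCommGroup V] [Module (ZMod p) V] [Fintype V]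
    {φ : FlagRep Λ p V} {f : V → ℕ} {D : FlagDecomposition φ f} {ε ε' : ℝ} (h : ε' ≤ ε) {x : P}
    {Γ : Set (QSpace (F.dim x))} (hΓ : D.IsLargeFace ε x Γ) : D.IsLargeFace ε' x Γ := by
  refine ⟨hΓ.1, (mul_le_mul_of_nonneg_right h (Nat.cast_nonneg _)).trans hΓ.2.1,
    fun Γ' h1 h2 => (hΓ.2.2 Γ' h1 h2).trans ?_⟩
  exact mul_le_mul_of_nonneg_right (by linarith) (Nat.cast_nonneg _)

end

theorem mainTheorem8 (d : ℕ) (ε : ℝ) (hε : 0 < ε) :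
    ∃ (δ : ℝ) (M : ℕ), 0 < δ ∧
      ∀ g : ℕ → ℕ, Monotone g →
        ∃ p₀ K₀ : ℕ,
          ∀ (p : ℕ) [Fact p.Prime], p₀ < p →
          ∀ (V : Type*) [AddCommGroup V] [Module (ZMod p) V] [Fintype V],
            Module.finrank (ZMod p) V = d →
          ∀ f : V → ℕ, f ≠ 0 →
            ∃ (P : Type) (_ : PartialOrder P) (_ : Fintype P) (F : ConvexFlag P)
              (Λ : FlagLattice F) (φ : FlagRep Λ p V) (D : FlagDecomposition φ f) (K : P → ℕ),
              D.IsSharp ε ∧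
              D.IsBounded K ∧ (∀ x, 1 ≤ K x ∧ K x ≤ K₀) ∧ Fintype.card P ≤ M ∧
              D.IsComplete K g ε δ ∧
              ∀ x, δ ^ 3 * (2 * (K x : ℝ)) ^ (-(d : ℤ)) * (mass f Set.univ : ℝ) ≤ (D.gap x : ℝ) := by
  set ε' : ℝ := min ε (1 / 2) with hε'
  have hε'0 : 0 < ε' := lt_min hε one_half_pos
  have hε'1 : ε' ≤ 1 / 2 := min_le_right _ _
  have hε'ε : ε' ≤ ε := min_le_left _ _
  -- `C` bounds the number of marks on one intersection: the maximal potential divided by the least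
  -- drop.
  obtain ⟨C, hC⟩ := exists_nat_ge ((d : ℝ) / (ε' * (ε' / 2)) ^ (d + 1))
  rw [div_le_iff₀ (by positivity)] at hC
  set N := MarkSystem.sizeBound d C with hN
  -- The first term pays for `N` corrections at `2 δ` each and a final cleaning; the second keeps
  -- the cost of one cleaning below `δ`. Neither involves `g`.
  set δ : ℝ := min (ε' / (2 * N + 1)) (1 / (2 ^ N * (3 / 2) ^ d)) with hδ
  have hδ0 : 0 < δ := lt_min (by positivity) (by positivity)
  have hδN : (2 * N + 1) * δ ≤ ε' := by
    have h1 : δ ≤ ε' / (2 * N + 1) := min_le_left _ _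
    rw [le_div_iff₀ (by positivity)] at h1
    linarith
  have hδ1 : δ ≤ 1 := by
    have h1 : δ ≤ (2 * N + 1) * δ := le_mul_of_one_le_left hδ0.le (by
      linarith [N.cast_nonneg (α := ℝ)])
    linarith
  have hδ2 : 2 ^ N * (3 / 2) ^ d * δ ^ 2 ≤ 1 := by
    have h1 : δ ≤ 1 / (2 ^ N * (3 / 2) ^ d) := min_le_right _ _
    rw [le_div_iff₀ (by positivity)] at h1
    calc (2 : ℝ) ^ N * (3 / 2) ^ d * δ ^ 2 = (δ * (2 ^ N * (3 / 2) ^ d)) * δ := by ring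
      _ ≤ 1 * 1 := mul_le_mul h1 hδ1 hδ0.le zero_le_one
      _ = 1 := one_mul 1
  refine ⟨δ, 2 ^ N, hδ0, fun g hg => ⟨max (primeBound N (sizeSeq g N N))
    (2 * boxBound N (sizeSeq g N N)), boxBound N (sizeSeq g N N), ?_⟩⟩
  intro p _ hp V _ _ _ hd f hf
  have hp1 := lt_of_le_of_lt (le_max_left _ _) hp
  have hp2 := lt_of_le_of_lt (le_max_right _ _) hp
  obtain ⟨S, hS⟩ := MarkSystem.exists_isCompleteSystem hf hg hd hδ0 hε'0 hε'1 hC hN hδN hδ2 hp1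
  have h := hS.isRealizable hf (by linarith) hp1 hp2
  refine ⟨S.Member, inferInstance, inferInstance, h.flag, h.lattice, h.rep, h.decomposition,
    fun x => S.coordSize N x.set, ?_, h.isBounded, fun x => ⟨one_le_boxBound _ _,
      boxBound_mono N (hS.bound_le _)⟩, ?_, ⟨h.isReduced, h.isBounded, fun x _ => ⟨h.isReduced x, ?_⟩,
      fun x Γ hΓ => h.isGood (by linarith) hS.faces (IsLargeFace_anti hε'ε hΓ)⟩, fun x => ?_⟩
  · unfold FlagDecomposition.IsSharp
    rw [h.total_eq, mass_univ_eq_weight]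
    refine le_trans ?_ hS.sharp
    exact mul_le_mul_of_nonneg_right (by linarith) (weight_nonneg _ _)
  · exact MarkSystem.card_member_le.trans (Nat.pow_le_pow_right two_pos hS.n_le)
  · intro ξ hξ
    have := h.rep.sub_nonempty x
    exact h.isThick hS.m_le (hS.thick x.set x.set_subset) ξ hξ
  · rw [mass_univ_eq_weight]
    refine h.gap_ge fun v hv => ?_
    rw [← hd]
    exact hS.gap x.set x.set_subset v hv
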